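/- Consider the following M/G/1 queue with vacations. Customers arrive according to a Poisson process with rate $\lambda>0$, independently of the state of the server. Service times are independent of each other and of the arrivals and vacations, and are distributed as a random variable $B\ge 0$ with $\mathbb{E}[B^2]<\infty$. After every service completion the server takes a vacation (that is, $\psi(i)=1$ for all $i\ge 0$, where $\psi(i)$ is the probability that the server becomes inactive after a service completion that leaves $i$ customers behind). While the server is on vacation and $i$ customers are present, it becomes active, and starts serving one customer, at rate $f(i)$; in other words a vacation ends at the first point of a Poisson process whose rate is $f(i)$ whenever $i$ customers are present. Here $f:[0,\infty)\to[0,\infty)$ is a strictly increasing function with $f(0)=0$. Let $L(t)$ be the number of customers in the system at time $t$, including the one in service, let $\rho=\lambda\,\mathbb{E}[B]$, and assume that the system is stable, i.e. $\rho<1$. For $y\ge 0$ write $f^{-1}(y)=\inf\{x\ge 0: f(x)\ge y\}$, which is the ordinary inverse of $f$ whenever $y$ lies in the range of $f$. (i) If $f$ is unbounded and concave, then $L(t)$ converges in distribution as $t\to\infty$ to a random variable $L$ whose law does not depend on the initial state (number of customers, server status, residual service time), and $$\mathbb{E}[L]\;\ge\;\frac{\lambda^2\,\mathbb{E}[B^2]}{2(1-\rho)}+\rho+f^{-1}\Big(\frac{\lambda}{1-\rho}\Big).$$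 (ii) If $f$ is convex, then $L(t)$ converges in distribution as $t\to\infty$ to a random variable $L$ whose law does not depend on the initial state, and $$\mathbb{E}[L]\;\le\;\frac{\lambda^2\,\mathbb{E}[B^2]}{2(1-\rho)}+\rho+f^{-1}\Big(\frac{\lambda}{1-\rho}\Big).$$ -/

import Mathlib

open MeasureTheory ProbabilityTheory Filter Set
open scoped ENNReal Topology

namespace BackoffQueue

/-- State of the queue. `vacation n`: the server is inactive and `n` customers are present.
`service n r`: the server is active, the customer in service has residual service time `r`, and
`n` other customers are waiting (so `n + 1` customers are present). -/
inductive QState where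
  | vacation (n : ℕ)
  | service (n : ℕ) (r : ℝ)

/-- Number of customers in the system, including the one in service. -/
def QState.customers : QState → ℕ
  | .vacation n => n
  | .service n _ => n + 1

/-- A state is admissible when the residual service time (if any) is nonnegative. -/
def QState.Admissible : QState → Prop
  | .vacation _ => True
  | .service _ r => 0 ≤ r

/-- Source of randomness: for each event number, an arrival clock, an activation clock and a
service time. -/
abbrev Clocks := ℕ → ℝ × ℝ × ℝ

/-- Law of the clocks: all of them are independent, the arrival clocks are exponential with rate
`lam`, the activation clocks are exponential with rate `1`, the service times have law `G`. -/
noncomputable def clockLaw (lam : ℝ) (G : Measure ℝ) : Measure Clocks :=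
  Measure.infinitePi (fun _ : ℕ => (expMeasure lam).prod ((expMeasure 1).prod G))

/-- One event of the queue: the next state and the time until it is entered.

* On vacation with `n` customers, arrivals occur at rate `lam` (time `a`) and activation occurs at
  rate `f n` (time `c / f n`, with `c` standard exponential; never if `n = 0`, since `f 0 = 0`).
  The earlier of the two happens.  Upon activation one customer enters service, with a fresh
  service time `b`.
* During a service with residual time `r`, either an arrival (time `a`) or the service completion
  (time `r`) happens first.  After each service completion the server takes a vacation
  (vacation probability `1`, whatever the number of customers left behind).

Exponential clocks are redrawn at each event, as usual in the construction of a Markov process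
from its transition rates: arrivals form a Poisson process of rate `lam` irrespective of the
server, and the server returns from a vacation at the first point of a Poisson process whose
rate is `f n` while `n` customers are present. -/
noncomputable def step (f : ℝ → ℝ) : QState → ℝ × ℝ × ℝ → QState × ℝ
  | .vacation 0, (a, _, _) => (.vacation 1, a)
  | .vacation (n + 1), (a, c, b) =>
      if a < c / f ((n + 1 : ℕ) : ℝ) then (.vacation (n + 2), a)
      else (.service n b, c / f ((n + 1 : ℕ) : ℝ))
  | .service n r, (a, _, _) =>
      if a < r then (.service (n + 1) (r - a), a)
      else (.vacation n, r)

/-- State entered at the `m`-th event, and the time of the `m`-th event, for the queue started in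
state `s` at time `0`. -/
noncomputable def eventSeq (f : ℝ → ℝ) (s : QState) (ω : Clocks) : ℕ → QState × ℝ
  | 0 => (s, 0)
  | m + 1 =>
      ((step f (eventSeq f s ω m).1 (ω m)).1,
        (eventSeq f s ω m).2 + (step f (eventSeq f s ω m).1 (ω m)).2)

/-- State of the queue at time `t`: the state entered at the last event up to time `t`. -/
noncomputable def stateAt (f : ℝ → ℝ) (s : QState) (ω : Clocks) (t : ℝ) : QState :=
  (eventSeq f s ω (sSup {m : ℕ | (eventSeq f s ω m).2 ≤ t})).1

/-- `L(t)`: the number of customers in the system at time `t`. -/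
noncomputable def numCustomers (f : ℝ → ℝ) (s : QState) (ω : Clocks) (t : ℝ) : ℕ :=
  (stateAt f s ω t).customers

/-- `p` is the steady-state law of the number of customers: from every initial state,
`P(L(t) = j) → p j` as `t → ∞`, for all `j`. -/
def IsSteadyStateLaw (lam : ℝ) (G : Measure ℝ) (f : ℝ → ℝ) (p : PMF ℕ) : Prop :=
  ∀ s : QState, s.Admissible → ∀ j : ℕ,
    Tendsto (fun t : ℝ => clockLaw lam G {ω | numCustomers f s ω t = j}) atTop (𝓝 (p j))

/-- Mean of a law on `ℕ`, as an extended nonnegative number. -/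
noncomputable def mean (p : PMF ℕ) : ℝ≥0∞ := ∑' j : ℕ, (j : ℝ≥0∞) * p j

/-- Traffic intensity `ρ = λ E[B]`. -/
noncomputable def rho (lam : ℝ) (G : Measure ℝ) : ℝ := lam * ∫ x, x ∂G

/-- Inverse of an increasing function on `[0, ∞)`: `f⁻¹(y) = inf {x ≥ 0 : f x ≥ y}`. -/
noncomputable def inv (f : ℝ → ℝ) (y : ℝ) : ℝ := sInf {x : ℝ | 0 ≤ x ∧ y ≤ f x}

/-- `inv f` is the ordinary inverse on the range of a strictly increasing `f`. -/
theorem inv_apply {f : ℝ → ℝ} (hf : StrictMonoOn f (Ici 0)) {x : ℝ} (hx : 0 ≤ x) :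
    inv f (f x) = x := by
  have h : {z : ℝ | 0 ≤ z ∧ f x ≤ f z} = Ici x := by
    ext z
    constructor
    · rintro ⟨hz, h⟩
      exact (hf.le_iff_le hx hz).1 h
    · intro h
      have hz : 0 ≤ z := le_trans hx h
      exact ⟨hz, (hf.le_iff_le hx hz).2 h⟩
  rw [inv, h, csInf_Ici]

/-- The bound `λ² E[B²] / (2 (1 - ρ)) + ρ + f⁻¹(λ / (1 - ρ))`. -/
noncomputable def bound (lam : ℝ) (G : Measure ℝ) (f : ℝ → ℝ) : ℝ :=
  lam ^ 2 * (∫ x, x ^ 2 ∂G) / (2 * (1 - rho lam G)) + rho lam G + inv f (lam / (1 - rho lam G))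

end BackoffQueue

/-! The empty system is a regeneration state: an exponential time of rate λ = `lam` is spent there,
and the queue then starts afresh from `.vacation 1`. All long-run quantities are therefore integrals
over one cycle, taken against the occupation measure `occ` of the event chain killed at `empty`.

Write β = E[B]. Over the stretch from `.vacation 1` to `empty`, let z be the mean number of
activations, V the mean vacation time, and N_v, N_s the mean time integrals of the number of waiting
customers over vacations and over services. Dynkin's formula for the killed chain
(`lintegral_occ_le`, `le_lintegral_occ`), applied to one function of the state at a time, gives the
following balances. Waiting customers n: z = 1 + λ(V + time in service). Residual service time r:
time in service = βz. Half of r²: the integral of r over services is zE[B²]/2. β·C(n,2), plus n·r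
during services: (1-ρ)N_s = ρN_v + λzE[B²]/2.

Hence λV + 1 = z(1-ρ), and the stationary mean λ(N_v + N_s + βz)/z equals λ²E[B²]/(2(1-ρ)) + ρ + x₀,
where x₀ = λN_v/(z(1-ρ)) is the mean number of customers seen on vacation, the empty period
included. Activations occur at rate f(n), so under the same law f has mean z/(V + 1/λ) = λ/(1-ρ).
Jensen's inequality gives f(x₀) ≥ λ/(1-ρ) for concave f and f(x₀) ≤ λ/(1-ρ) for convex f; inverting
f yields the two bounds.

Two facts make this rigorous. Cycles have finite mean (`positive_recurrence`): f is unbounded, so a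
Lyapunov function with slopes that decrease in n has the required drift. The law of L(t) converges
(`renewal_limit`, `tendsto_transProb`): the exponential idle period smooths the cycle length, which
excludes any lattice phenomenon, and every initial state reaches `empty` almost surely. Since
`stateAt` is built from event times, explosion must also be excluded (`ae_exists_eventSeq_gt`). -/

namespace BackoffQueue

/-! ### Measurable structure on the state space -/

/-- The state space is a disjoint union of `ℕ` and `ℕ × ℝ`. -/
def QState.toSum : QState ≃ ℕ ⊕ (ℕ × ℝ) where
  toFun
    | .vacation n => .inl n
    | .service n r => .inr (n, r)
  invFun
    | .inl n => .vacation n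
    | .inr (n, r) => .service n r
  left_inv s := by cases s <;> rfl
  right_inv s := by rcases s with n | ⟨n, r⟩ <;> rfl

instance : MeasurableSpace QState := MeasurableSpace.comap QState.toSum inferInstance

/-- `QState.toSum` as a measurable equivalence. -/
def QState.toSumMeasurable : QState ≃ᵐ ℕ ⊕ (ℕ × ℝ) where
  toEquiv := QState.toSum
  measurable_toFun := comap_measurable _
  measurable_invFun := by
    rintro _ ⟨t, ht, rfl⟩
    rw [← preimage_comp]
    simpa using ht

theorem measurable_service : Measurable (fun p : ℕ × ℝ => QState.service p.1 p.2) :=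
  QState.toSumMeasurable.symm.measurable.comp measurable_inr

theorem QState.measurable_iff {δ : Type*} [MeasurableSpace δ] {g : QState → δ} :
    Measurable g ↔ ∀ n, Measurable fun r => g (.service n r) := by
  constructor
  · intro h n
    exact h.comp (measurable_service.comp (measurable_const.prodMk measurable_id))
  · intro h
    have h1 : Measurable (g ∘ QState.toSumMeasurable.symm) := by
      refine measurable_fun_sum (measurable_of_countable _) ?_
      exact measurable_from_prod_countable_right h
    have h2 : g = (g ∘ QState.toSumMeasurable.symm) ∘ QState.toSumMeasurable := by
      ext s; simp
    rw [h2]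
    exact h1.comp QState.toSumMeasurable.measurable

theorem QState.measurable_prod {γ δ : Type*} [MeasurableSpace γ] [MeasurableSpace δ]
    {g : QState × γ → δ} (h1 : ∀ n, Measurable fun c => g (.vacation n, c))
    (h2 : ∀ n, Measurable fun p : ℝ × γ => g (.service n p.1, p.2)) : Measurable g := by
  intro A hA
  have hv (n : ℕ) : MeasurableSet {x : QState × γ | x.1 = .vacation n} := by
    have : MeasurableSet {s : QState | s = .vacation n} := by
      have h : Measurable fun s : QState => s = .vacation n := by
        rw [QState.measurable_iff]; intro m; simp
      exact measurableSet_setOfPred.2 h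
    exact measurable_fst this
  -- Total coordinate functions: `b'` records the branch, and `r'` takes a dummy value on vacations.
  -- The preimage then splits into countably many measurable pieces.
  let n' : QState → ℕ := fun s => match s with | .vacation n => n | .service n _ => n
  let r' : QState → ℝ := fun s => match s with | .vacation _ => 0 | .service _ r => r
  let b' : QState → Bool := fun s => match s with | .vacation _ => true | .service _ _ => false
  have hn : Measurable n' := QState.measurable_iff.2 fun n => measurable_const
  have hr : Measurable r' := QState.measurable_iff.2 fun n => measurable_id
  have hb : Measurable b' := QState.measurable_iff.2 fun n => measurable_const
  have : g ⁻¹' A = ⋃ n, (({x | n' x.1 = n} ∩ {x | b' x.1 = true} ∩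
      {x | g (.vacation n, x.2) ∈ A}) ∪ ({x | n' x.1 = n} ∩ {x | b' x.1 = false} ∩
      {x | g (.service n (r' x.1), x.2) ∈ A})) := by
    ext ⟨s, c⟩
    cases s <;> simp [n', r', b']
  rw [this]
  refine MeasurableSet.iUnion fun n => MeasurableSet.union ?_ ?_
  · exact (((hn.comp measurable_fst) (measurableSet_singleton n)).inter
      ((hb.comp measurable_fst) (measurableSet_singleton true))).inter
      (((h1 n).comp measurable_snd) hA)
  · exact (((hn.comp measurable_fst) (measurableSet_singleton n)).inter
      ((hb.comp measurable_fst) (measurableSet_singleton false))).inter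
      (((h2 n).comp ((hr.comp measurable_fst).prodMk measurable_snd)) hA)

theorem measurable_customers : Measurable QState.customers :=
  QState.measurable_iff.2 fun _ => measurable_const

theorem measurableSet_eq_vacation (n : ℕ) : MeasurableSet {s : QState | s = .vacation n} := by
  have h : Measurable fun s : QState => s = .vacation n := by
    rw [QState.measurable_iff]; intro m; simp
  exact measurableSet_setOfPred.2 h

theorem measurableSet_admissible : MeasurableSet {s : QState | s.Admissible} := by
  have h : Measurable fun s : QState => s.Admissible := by
    rw [QState.measurable_iff]; intro m
    exact measurableSet_setOfPred.1 (measurableSet_Ici (a := (0 : ℝ)))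
  exact measurableSet_setOfPred.2 h

theorem measurable_step (f : ℝ → ℝ) :
    Measurable fun p : QState × (ℝ × ℝ × ℝ) => step f p.1 p.2 := by
  refine QState.measurable_prod (fun n => ?_) (fun n => ?_)
  · cases n with
    | zero =>
      simp only [step]
      fun_prop
    | succ n =>
      simp only [step]
      refine Measurable.ite (measurableSet_lt (by fun_prop) (by fun_prop)) (by fun_prop) ?_
      exact (measurable_service.comp (measurable_const.prodMk (by fun_prop))).prodMk (by fun_prop)
  · simp only [step]
    refine Measurable.ite (measurableSet_lt (by fun_prop) (by fun_prop)) ?_ (by fun_prop)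
    exact (measurable_service.comp (measurable_const.prodMk (by fun_prop))).prodMk (by fun_prop)

/-! ### Exponential integrals -/

/-- No measurability of `g` is needed, because the density is measurable and finite everywhere. -/
theorem lintegral_expMeasure (lam : ℝ) (g : ℝ → ℝ≥0∞) :
    ∫⁻ x, g x ∂expMeasure lam = ∫⁻ x in Ioi 0, ENNReal.ofReal (lam * Real.exp (-(lam * x))) * g x := by
  have h : expMeasure lam = volume.withDensity (exponentialPDF lam) := rfl
  have hm : Measurable (exponentialPDF lam) := by
    unfold exponentialPDF; exact (measurable_exponentialPDFReal lam).ennreal_ofReal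
  rw [h, lintegral_withDensity_eq_lintegral_mul_non_measurable _ hm
    (by filter_upwards with x; simp [exponentialPDF])]
  rw [← lintegral_add_compl _ (measurableSet_Ici (a := (0 : ℝ))), compl_Ici]
  have h0 : ∫⁻ x in Iio 0, (exponentialPDF lam * g) x = 0 := by
    rw [setLIntegral_congr_fun measurableSet_Iio (g := fun _ => 0), lintegral_zero]
    intro x hx
    simp [exponentialPDF_of_neg (show x < 0 from hx)]
  rw [h0, add_zero, setLIntegral_congr Ioi_ae_eq_Ici.symm]
  refine setLIntegral_congr_fun measurableSet_Ioi fun x hx => ?_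
  simp [exponentialPDF_of_nonneg (show 0 ≤ x from le_of_lt hx)]

theorem lintegral_exp_Ioi {k : ℝ} (hk : 0 < k) (x : ℝ) :
    ∫⁻ t in Ioi x, ENNReal.ofReal (Real.exp (-(k * t))) =
      ENNReal.ofReal (Real.exp (-(k * x)) / k) := by
  have h := integral_exp_mul_Ioi (neg_lt_zero.2 hk) x
  have hi := exp_neg_integrableOn_Ioi x hk
  rw [← ofReal_integral_eq_lintegral_ofReal]
  · congr 1
    simp only [← neg_mul]
    rw [h]; field_simp
  · simpa only [← neg_mul] using hi.integrable
  · filter_upwards with t; positivity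

theorem lintegral_Ioo_of_hasDerivAt {A g : ℝ → ℝ} {r : ℝ} (hA : ∀ x, HasDerivAt A (g x) x)
    (hg : Continuous g) (hr : 0 ≤ r) (hpos : ∀ x ∈ Ioo 0 r, 0 ≤ g x) :
    ∫⁻ t in Ioo 0 r, ENNReal.ofReal (g t) = ENNReal.ofReal (A r - A 0) := by
  rw [← intervalIntegral.integral_eq_sub_of_hasDerivAt (fun x _ => hA x)
    (hg.intervalIntegrable 0 r), intervalIntegral.integral_of_le hr, integral_Ioc_eq_integral_Ioo,
    ofReal_integral_eq_lintegral_ofReal]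
  · exact (hg.integrableOn_Icc).mono_set Ioo_subset_Icc_self
  · exact (ae_restrict_iff' measurableSet_Ioo).2 (Eventually.of_forall hpos)

/-- Integral of a function of an exponential clock that rings before time `r`. -/
theorem setLIntegral_expMeasure_Iio {lam r : ℝ} {A g : ℝ → ℝ} (hlam : 0 < lam)
    (hA : ∀ x, HasDerivAt A (lam * Real.exp (-(lam * x)) * g x) x) (hg : Continuous g)
    (hpos : ∀ x < r, 0 ≤ g x) :
    ∫⁻ x in Iio r, ENNReal.ofReal (g x) ∂expMeasure lam = ENNReal.ofReal (A (max r 0) - A 0) := by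
  rw [← lintegral_indicator measurableSet_Iio, lintegral_expMeasure]
  have h1 : ∀ x, ENNReal.ofReal (lam * Real.exp (-(lam * x))) *
      (Iio r).indicator (fun x => ENNReal.ofReal (g x)) x =
      (Iio r).indicator (fun x => ENNReal.ofReal (lam * Real.exp (-(lam * x)) * g x)) x := by
    intro x
    by_cases hx : x ∈ Iio r
    · rw [indicator_of_mem hx, indicator_of_mem hx, ← ENNReal.ofReal_mul (by positivity)]
    · rw [indicator_of_notMem hx, indicator_of_notMem hx, mul_zero]
  simp_rw [h1]
  rw [lintegral_indicator measurableSet_Iio, Measure.restrict_restrict measurableSet_Iio,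
    inter_comm, Ioi_inter_Iio]
  -- The clock lives on the positive axis, so for `r ≤ 0` the region is empty; `max r 0` makes one
  -- formula cover both cases.
  rcases le_total r 0 with h | h
  · rw [Ioo_eq_empty_of_le h, max_eq_right h]; simp
  · rw [max_eq_left h]
    refine lintegral_Ioo_of_hasDerivAt hA (by fun_prop) h fun x hx => ?_
    have := hpos x hx.2
    positivity

theorem hasDerivAt_exp_neg_mul (k x : ℝ) :
    HasDerivAt (fun y => Real.exp (-(k * y))) (-k * Real.exp (-(k * x))) x := by
  have := (((hasDerivAt_id x).const_mul k).neg).exp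
  simpa [mul_comm] using this

theorem expMeasure_Iio {lam : ℝ} (hlam : 0 < lam) (r : ℝ) :
    expMeasure lam (Iio r) = ENNReal.ofReal (1 - Real.exp (-(lam * max r 0))) := by
  have h := setLIntegral_expMeasure_Iio (r := r) (g := fun _ => 1)
    (A := fun x => -Real.exp (-(lam * x))) hlam (fun x => by
      convert! (hasDerivAt_exp_neg_mul lam x).neg using 1; ring) (by fun_prop) (by simp)
  simp at h
  rw [h]; congr 1; ring

theorem expMeasure_Ici {lam : ℝ} (hlam : 0 < lam) (r : ℝ) :
    expMeasure lam (Ici r) = ENNReal.ofReal (Real.exp (-(lam * max r 0))) := by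
  have := isProbabilityMeasure_expMeasure hlam
  rw [← compl_Iio, prob_compl_eq_one_sub measurableSet_Iio, expMeasure_Iio hlam,
    ← ENNReal.ofReal_one, ← ENNReal.ofReal_sub]
  · congr 1; ring
  · have : Real.exp (-(lam * max r 0)) ≤ 1 := by
      rw [Real.exp_le_one_iff]; have := le_max_right r 0; nlinarith
    linarith

theorem setLIntegral_expMeasure_sub {lam : ℝ} (hlam : 0 < lam) (r : ℝ) :
    ∫⁻ x in Iio r, ENNReal.ofReal (r - x) ∂expMeasure lam =
      ENNReal.ofReal (max r 0 - (1 - Real.exp (-(lam * max r 0))) / lam) := by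
  -- The primitive comes from integration by parts: minus the exponential times the sum of the k-th
  -- derivatives of `g` divided by `lam ^ k`. The same recipe gives the quadratic case.
  rw [setLIntegral_expMeasure_Iio (r := r) (g := fun x => r - x)
    (A := fun x => -(r - x - 1 / lam) * Real.exp (-(lam * x))) hlam (fun x => by
      convert! (((hasDerivAt_id x).const_sub r).sub_const (1 / lam)).neg.mul
        (hasDerivAt_exp_neg_mul lam x) using 1
      simp; field_simp; ring) (by fun_prop) (fun x hx => by linarith)]
  congr 1
  rcases le_total r 0 with h | h
  · simp [max_eq_right h]
  · simp [max_eq_left h]; field_simp; ring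

theorem setLIntegral_expMeasure_sub_sq {lam : ℝ} (hlam : 0 < lam) (r : ℝ) :
    ∫⁻ x in Iio r, ENNReal.ofReal ((r - x) ^ 2 / 2) ∂expMeasure lam =
      ENNReal.ofReal ((max r 0) ^ 2 / 2 -
        (max r 0 - (1 - Real.exp (-(lam * max r 0))) / lam) / lam) := by
  rw [setLIntegral_expMeasure_Iio (r := r) (g := fun x => (r - x) ^ 2 / 2)
    (A := fun x => -((r - x) ^ 2 / 2 - (r - x) / lam + 1 / lam ^ 2) * Real.exp (-(lam * x)))
    hlam (fun x => by
      convert! (((((hasDerivAt_id x).const_sub r).pow 2).div_const 2).sub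
        (((hasDerivAt_id x).const_sub r).div_const lam) |>.add_const (1 / lam ^ 2)).neg.mul
        (hasDerivAt_exp_neg_mul lam x) using 1
      simp; field_simp; ring) (by fun_prop) (fun x hx => by positivity)]
  congr 1
  rcases le_total r 0 with h | h
  · simp [max_eq_right h]
  · simp [max_eq_left h]; field_simp; ring

theorem setLIntegral_expMeasure_exp_neg {lam : ℝ} (hlam : 0 < lam) (r : ℝ) :
    ∫⁻ x in Iio r, ENNReal.ofReal (Real.exp (-x)) ∂expMeasure lam =
      ENNReal.ofReal (lam / (lam + 1) * (1 - Real.exp (-((lam + 1) * max r 0)))) := by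
  have h0 : lam + 1 ≠ 0 := by positivity
  rw [setLIntegral_expMeasure_Iio (r := r) (g := fun x => Real.exp (-x))
    (A := fun x => -(lam / (lam + 1)) * Real.exp (-((lam + 1) * x))) hlam (fun x => by
      convert! (hasDerivAt_exp_neg_mul (lam + 1) x).const_mul (-(lam / (lam + 1))) using 1
      rw [mul_assoc, ← Real.exp_add]; field_simp; congr 2; ring_nf) (by fun_prop)
    (fun x hx => by positivity)]
  congr 1
  simp; ring

/-! ### One event of the queue -/

/-- Joint law of the clocks used at one event. -/
noncomputable def clock (lam : ℝ) (G : Measure ℝ) : Measure (ℝ × ℝ × ℝ) :=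
  (expMeasure lam).prod ((expMeasure 1).prod G)

theorem isProbabilityMeasure_clock {lam : ℝ} (hlam : 0 < lam) (G : Measure ℝ)
    [IsProbabilityMeasure G] : IsProbabilityMeasure (clock lam G) := by
  have := isProbabilityMeasure_expMeasure hlam
  have := isProbabilityMeasure_expMeasure one_pos
  unfold clock; infer_instance

theorem expMeasure_singleton (lam x : ℝ) : expMeasure lam {x} = 0 :=
  (withDensity_absolutelyContinuous _ _ : volume.withDensity (exponentialPDF lam) ≪ volume)
    Real.volume_singleton

theorem expMeasure_Ioi {lam : ℝ} (hlam : 0 < lam) (r : ℝ) :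
    expMeasure lam (Ioi r) = ENNReal.ofReal (Real.exp (-(lam * max r 0))) := by
  rw [measure_congr (Ioi_ae_eq_Ici' (expMeasure_singleton lam r)), expMeasure_Ici hlam]

theorem lintegral_clock {lam : ℝ} (hlam : 0 < lam) (G : Measure ℝ) [IsProbabilityMeasure G]
    {g : ℝ × ℝ × ℝ → ℝ≥0∞} (hg : Measurable g) :
    ∫⁻ z, g z ∂clock lam G =
      ∫⁻ a, ∫⁻ c, ∫⁻ b, g (a, c, b) ∂G ∂expMeasure 1 ∂expMeasure lam := by
  have := isProbabilityMeasure_expMeasure hlam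
  have := isProbabilityMeasure_expMeasure one_pos
  rw [clock, lintegral_prod _ hg.aemeasurable]
  refine lintegral_congr fun a => ?_
  rw [lintegral_prod]
  exact (hg.comp measurable_prodMk_left).aemeasurable

theorem measurable_step_right (f : ℝ → ℝ) (s : QState) : Measurable (step f s) :=
  (measurable_step f).comp (measurable_const.prodMk measurable_id : Measurable fun z => (s, z))

/-- The function sees both the new state and the duration, so that plain and discounted expectations
are both instances. -/
theorem lintegral_step_service {lam : ℝ} (hlam : 0 < lam) (G : Measure ℝ) [IsProbabilityMeasure G]
    (f : ℝ → ℝ) (n : ℕ) (r : ℝ) {g : QState × ℝ → ℝ≥0∞} (hg : Measurable g) :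
    ∫⁻ z, g (step f (.service n r) z) ∂clock lam G =
      ∫⁻ a in Iio r, g (.service (n + 1) (r - a), a) ∂expMeasure lam +
        expMeasure lam (Ici r) * g (.vacation n, r) := by
  have := isProbabilityMeasure_expMeasure one_pos
  rw [lintegral_clock hlam G (g := fun z => g (step f (.service n r) z))
    (hg.comp (measurable_step_right f _))]
  simp only [step, lintegral_const, measure_univ, mul_one]
  rw [← lintegral_add_compl _ (measurableSet_Iio (a := r)), compl_Iio]
  congr 1
  · exact setLIntegral_congr_fun measurableSet_Iio fun a ha => by
      rw [if_pos (show a < r from ha)]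
  · rw [setLIntegral_congr_fun measurableSet_Ici (g := fun _ => g (.vacation n, r)),
      setLIntegral_const, mul_comm]
    intro a ha
    simp only
    rw [if_neg (not_lt.2 ha)]

theorem lintegral_expMeasure_exp_neg {lam k : ℝ} (hlam : 0 < lam) (hk : 0 ≤ k) :
    ∫⁻ x, ENNReal.ofReal (Real.exp (-(k * max x 0))) ∂expMeasure lam =
      ENNReal.ofReal (lam / (lam + k)) := by
  rw [lintegral_expMeasure]
  have h : ∀ x ∈ Ioi (0 : ℝ), ENNReal.ofReal (lam * Real.exp (-(lam * x))) *
      ENNReal.ofReal (Real.exp (-(k * max x 0))) =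
      ENNReal.ofReal lam * ENNReal.ofReal (Real.exp (-((lam + k) * x))) := by
    intro x hx
    rw [max_eq_left (le_of_lt hx), ← ENNReal.ofReal_mul (by positivity),
      ← ENNReal.ofReal_mul hlam.le, mul_assoc, ← Real.exp_add]
    congr 3; ring
  rw [setLIntegral_congr_fun measurableSet_Ioi h, lintegral_const_mul _ (by fun_prop),
    lintegral_exp_Ioi (by positivity), ← ENNReal.ofReal_mul hlam.le]
  congr 1; simp; field_simp

theorem ae_expMeasure_nonneg {lam : ℝ} (hlam : 0 < lam) : ∀ᵐ x ∂expMeasure lam, 0 ≤ x := by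
  have h : expMeasure lam (Iio 0) = 0 := by rw [expMeasure_Iio hlam]; simp
  rw [ae_iff]
  convert h using 2
  ext x; simp

/-- One event on vacation, with discounting at rate `s`. -/
theorem lintegral_step_vacation {lam : ℝ} (hlam : 0 < lam) (G : Measure ℝ) [IsProbabilityMeasure G]
    {f : ℝ → ℝ} {n : ℕ} (hf : 0 < f ((n + 1 : ℕ) : ℝ)) {s : ℝ} (hs : 0 ≤ s)
    {g : QState → ℝ≥0∞} (hg : Measurable g) :
    ∫⁻ z, ENNReal.ofReal (Real.exp (-(s * (step f (.vacation (n + 1)) z).2))) *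
        g (step f (.vacation (n + 1)) z).1 ∂clock lam G =
      ENNReal.ofReal (lam / (lam + f ((n + 1 : ℕ) : ℝ) + s)) * g (.vacation (n + 2)) +
        ENNReal.ofReal (f ((n + 1 : ℕ) : ℝ) / (lam + f ((n + 1 : ℕ) : ℝ) + s)) *
          ∫⁻ b, g (.service n b) ∂G := by
  have := isProbabilityMeasure_expMeasure hlam
  have := isProbabilityMeasure_expMeasure one_pos
  set φ := f ((n + 1 : ℕ) : ℝ) with hφ
  have hst : Measurable (step f (.vacation (n + 1))) := measurable_step_right f _
  rw [lintegral_clock hlam G (by fun_prop)]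
  have hgb : Measurable fun b => g (.service n b) := QState.measurable_iff.1 hg n
  set I := ∫⁻ b, g (.service n b) ∂G with hI
  -- The service time is used only upon activation. Integrating it out first leaves two competing
  -- clocks, split by which one rings first.
  have h1 : ∀ a c : ℝ, ∫⁻ b, ENNReal.ofReal (Real.exp (-(s *
      (step f (.vacation (n + 1)) (a, c, b)).2))) * g (step f (.vacation (n + 1)) (a, c, b)).1 ∂G =
      {p : ℝ × ℝ | p.1 < p.2 / φ}.indicator
        (fun p => ENNReal.ofReal (Real.exp (-(s * p.1))) * g (.vacation (n + 2))) (a, c) +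
      {p : ℝ × ℝ | p.1 < p.2 / φ}ᶜ.indicator
        (fun p => ENNReal.ofReal (Real.exp (-(s * (p.2 / φ)))) * I) (a, c) := by
    intro a c
    simp only [step, ← hφ]
    by_cases h : a < c / φ
    · have h' : (a, c) ∈ {p : ℝ × ℝ | p.1 < p.2 / φ} := h
      rw [indicator_of_mem h', indicator_of_notMem (by simpa using h)]
      simp [h]
    · have h' : (a, c) ∉ {p : ℝ × ℝ | p.1 < p.2 / φ} := h
      rw [indicator_of_notMem h', indicator_of_mem (by simpa using h)]
      simp only [h, if_false, zero_add]
      rw [lintegral_const_mul _ hgb]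
  simp_rw [h1]
  have hms : MeasurableSet {p : ℝ × ℝ | p.1 < p.2 / φ} :=
    measurableSet_lt (by fun_prop) (by fun_prop)
  have hm1 : Measurable ({p : ℝ × ℝ | p.1 < p.2 / φ}.indicator
        (fun p => ENNReal.ofReal (Real.exp (-(s * p.1))) * g (.vacation (n + 2)))) :=
    Measurable.indicator (by fun_prop) hms
  have hm2 : Measurable ({p : ℝ × ℝ | p.1 < p.2 / φ}ᶜ.indicator
        (fun p => ENNReal.ofReal (Real.exp (-(s * (p.2 / φ)))) * I)) :=
    Measurable.indicator (by fun_prop) hms.compl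
  rw [← lintegral_prod (μ := expMeasure lam) (ν := expMeasure 1)
    (fun p => _ + _) (hm1.add hm2).aemeasurable, lintegral_add_left hm1]
  congr 1
  · rw [lintegral_prod _ hm1.aemeasurable]
    have h2 : ∀ᵐ a ∂expMeasure lam, ∫⁻ c, {p : ℝ × ℝ | p.1 < p.2 / φ}.indicator
        (fun p => ENNReal.ofReal (Real.exp (-(s * p.1))) * g (.vacation (n + 2))) (a, c)
        ∂expMeasure 1 = ENNReal.ofReal (Real.exp (-((φ + s) * max a 0))) * g (.vacation (n + 2)) := by
      filter_upwards [ae_expMeasure_nonneg hlam] with a ha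
      have : ∀ c : ℝ, {p : ℝ × ℝ | p.1 < p.2 / φ}.indicator
        (fun p => ENNReal.ofReal (Real.exp (-(s * p.1))) * g (.vacation (n + 2))) (a, c) =
        (Ioi (φ * a)).indicator
          (fun _ => ENNReal.ofReal (Real.exp (-(s * a))) * g (.vacation (n + 2))) c := by
        intro c
        simp only [indicator, mem_ofPred_eq, mem_Ioi, lt_div_iff₀ hf, mul_comm]
      simp_rw [this]
      rw [lintegral_indicator measurableSet_Ioi, setLIntegral_const, expMeasure_Ioi one_pos,
        max_eq_left (by positivity), max_eq_left ha, mul_right_comm,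
        ← ENNReal.ofReal_mul (by positivity), ← Real.exp_add]
      congr 3; ring
    rw [lintegral_congr_ae h2, lintegral_mul_const _ (by fun_prop),
      lintegral_expMeasure_exp_neg hlam (by positivity), add_assoc]
  -- On the activation side the arrival clock is integrated first, hence the exchanged order.
  · rw [lintegral_prod_symm _ hm2.aemeasurable]
    have h2 : ∀ᵐ c ∂expMeasure 1, ∫⁻ a, {p : ℝ × ℝ | p.1 < p.2 / φ}ᶜ.indicator
        (fun p => ENNReal.ofReal (Real.exp (-(s * (p.2 / φ)))) * I) (a, c)
        ∂expMeasure lam = ENNReal.ofReal (Real.exp (-(((lam + s) / φ) * max c 0))) * I := by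
      filter_upwards [ae_expMeasure_nonneg one_pos] with c hc
      have : ∀ a : ℝ, {p : ℝ × ℝ | p.1 < p.2 / φ}ᶜ.indicator
        (fun p => ENNReal.ofReal (Real.exp (-(s * (p.2 / φ)))) * I) (a, c) =
        (Ici (c / φ)).indicator
          (fun _ => ENNReal.ofReal (Real.exp (-(s * (c / φ)))) * I) a := by
        intro a
        simp [indicator]
      simp_rw [this]
      rw [lintegral_indicator measurableSet_Ici, setLIntegral_const, expMeasure_Ici hlam,
        max_eq_left (by positivity), max_eq_left hc, mul_right_comm,
        ← ENNReal.ofReal_mul (by positivity), ← Real.exp_add]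
      congr 3; field_simp; ring
    rw [lintegral_congr_ae h2, lintegral_mul_const _ (by fun_prop),
      lintegral_expMeasure_exp_neg one_pos (by positivity)]
    congr 2; field_simp; ring

/-- Expected value of `g` after one event from the state `x`. -/
noncomputable def expect (lam : ℝ) (G : Measure ℝ) (f : ℝ → ℝ) (g : QState → ℝ≥0∞)
    (x : QState) : ℝ≥0∞ :=
  ∫⁻ z, g (step f x z).1 ∂clock lam G

/-- Expected time until the next event from the state `x`. -/
noncomputable def meanDur (lam : ℝ) (G : Measure ℝ) (f : ℝ → ℝ) (x : QState) : ℝ≥0∞ :=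
  ∫⁻ t in Ici 0, clock lam G {z | t < (step f x z).2}

theorem expect_vacation {lam : ℝ} (hlam : 0 < lam) (G : Measure ℝ) [IsProbabilityMeasure G]
    {f : ℝ → ℝ} {n : ℕ} (hf : 0 < f ((n + 1 : ℕ) : ℝ)) {g : QState → ℝ≥0∞} (hg : Measurable g) :
    expect lam G f g (.vacation (n + 1)) =
      ENNReal.ofReal (lam / (lam + f ((n + 1 : ℕ) : ℝ))) * g (.vacation (n + 2)) +
        ENNReal.ofReal (f ((n + 1 : ℕ) : ℝ) / (lam + f ((n + 1 : ℕ) : ℝ))) *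
          ∫⁻ b, g (.service n b) ∂G := by
  simpa [expect] using lintegral_step_vacation hlam G hf le_rfl hg

theorem expect_service {lam : ℝ} (hlam : 0 < lam) (G : Measure ℝ) [IsProbabilityMeasure G]
    (f : ℝ → ℝ) (n : ℕ) (r : ℝ) {g : QState → ℝ≥0∞} (hg : Measurable g) :
    expect lam G f g (.service n r) =
      ∫⁻ a in Iio r, g (.service (n + 1) (r - a)) ∂expMeasure lam +
        expMeasure lam (Ici r) * g (.vacation n) :=
  lintegral_step_service hlam G f n r (hg.comp measurable_fst)

theorem meanDur_service {lam : ℝ} (hlam : 0 < lam) (G : Measure ℝ) [IsProbabilityMeasure G]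
    (f : ℝ → ℝ) (n : ℕ) (r : ℝ) :
    meanDur lam G f (.service n r) =
      ENNReal.ofReal ((1 - Real.exp (-(lam * max r 0))) / lam) := by
  have := isProbabilityMeasure_expMeasure hlam
  have := isProbabilityMeasure_expMeasure one_pos
  have h : ∀ t ∈ Ici (0 : ℝ), clock lam G {z | t < (step f (.service n r) z).2} =
      (Iio r).indicator (fun t => ENNReal.ofReal (Real.exp (-(lam * t)))) t := by
    intro t ht
    by_cases htr : t < r
    · have : {z | t < (step f (.service n r) z).2} = Ioi t ×ˢ (univ : Set (ℝ × ℝ)) := by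
        ext ⟨a, c, b⟩
        by_cases har : a < r
        · simp [step, har]
        · simp only [step, har, if_false, mem_ofPred_eq, mem_prod, mem_Ioi, mem_univ, and_true,
            htr, true_iff]
          linarith
      rw [this, clock, Measure.prod_prod, measure_univ, mul_one, expMeasure_Ioi hlam,
        max_eq_left ht, indicator_of_mem (by exact htr)]
    · have : {z | t < (step f (.service n r) z).2} = ∅ := by
        ext ⟨a, c, b⟩
        by_cases har : a < r
        · simp [step, har]; linarith
        · simp [step, har]; linarith
      rw [this, measure_empty, indicator_of_notMem (by exact htr)]
  rw [meanDur, setLIntegral_congr_fun measurableSet_Ici h, lintegral_indicator measurableSet_Iio,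
    Measure.restrict_restrict measurableSet_Iio, inter_comm, Ici_inter_Iio]
  rcases le_total r 0 with h0 | h0
  · rw [Ico_eq_empty_of_le h0, max_eq_right h0]; simp
  · rw [max_eq_left h0, setLIntegral_congr Ioo_ae_eq_Ico.symm,
      lintegral_Ioo_of_hasDerivAt (A := fun x => -Real.exp (-(lam * x)) / lam)
        (fun x => by
          convert! (hasDerivAt_exp_neg_mul lam x).neg.div_const lam using 1; field_simp)
        (by fun_prop) h0 (fun x _ => by positivity)]
    congr 1; simp; ring

theorem meanDur_vacation {lam : ℝ} (hlam : 0 < lam) (G : Measure ℝ) [IsProbabilityMeasure G]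
    {f : ℝ → ℝ} {n : ℕ} (hf : 0 < f ((n + 1 : ℕ) : ℝ)) :
    meanDur lam G f (.vacation (n + 1)) = ENNReal.ofReal (1 / (lam + f ((n + 1 : ℕ) : ℝ))) := by
  have := isProbabilityMeasure_expMeasure hlam
  have := isProbabilityMeasure_expMeasure one_pos
  set φ := f ((n + 1 : ℕ) : ℝ) with hφ
  have h : ∀ t ∈ Ici (0 : ℝ), clock lam G {z | t < (step f (.vacation (n + 1)) z).2} =
      ENNReal.ofReal (Real.exp (-((lam + φ) * t))) := by
    intro t ht
    -- The event lasts min(a, c/φ), so surviving past `t` is a product of two half-lines.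
    have : {z | t < (step f (.vacation (n + 1)) z).2} =
        Ioi t ×ˢ (Ioi (φ * t) ×ˢ (univ : Set ℝ)) := by
      ext ⟨a, c, b⟩
      have hc : φ * t < c ↔ t < c / φ := by rw [lt_div_iff₀ hf, mul_comm]
      by_cases har : a < c / φ
      · simp only [step, ← hφ, har, if_true, mem_ofPred_eq, mem_prod, mem_Ioi, mem_univ, and_true, hc]
        exact ⟨fun h => ⟨h, h.trans har⟩, fun h => h.1⟩
      · simp only [step, ← hφ, har, if_false, mem_ofPred_eq, mem_prod, mem_Ioi, mem_univ, and_true,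
          hc]
        exact ⟨fun h => ⟨h.trans_le (not_lt.1 har), h⟩, fun h => h.2⟩
    have ht : 0 ≤ t := ht
    rw [this, clock, Measure.prod_prod, Measure.prod_prod, measure_univ, mul_one,
      expMeasure_Ioi hlam, expMeasure_Ioi one_pos, max_eq_left ht, max_eq_left (by positivity),
      ← ENNReal.ofReal_mul (by positivity), ← Real.exp_add]
    congr 2; ring
  rw [meanDur, setLIntegral_congr_fun measurableSet_Ici h, setLIntegral_congr Ioi_ae_eq_Ici.symm,
    lintegral_exp_Ioi (by positivity)]
  simp

/-! ### Admissibility -/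

/-- All clocks of an event are nonnegative. -/
def Good (z : ℝ × ℝ × ℝ) : Prop := 0 ≤ z.1 ∧ 0 ≤ z.2.1 ∧ 0 ≤ z.2.2

theorem ae_good {lam : ℝ} (hlam : 0 < lam) {G : Measure ℝ} [IsProbabilityMeasure G]
    (hG : ∀ᵐ x ∂G, 0 ≤ x) : ∀ᵐ z ∂clock lam G, Good z := by
  have := isProbabilityMeasure_expMeasure hlam
  have := isProbabilityMeasure_expMeasure one_pos
  have h1 : ∀ᵐ z ∂clock lam G, 0 ≤ z.1 :=
    Measure.quasiMeasurePreserving_fst.ae (ae_expMeasure_nonneg hlam)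
  have h2 : ∀ᵐ z ∂clock lam G, 0 ≤ z.2.1 ∧ 0 ≤ z.2.2 := by
    refine Measure.quasiMeasurePreserving_snd.ae (p := fun y : ℝ × ℝ => 0 ≤ y.1 ∧ 0 ≤ y.2) ?_
    filter_upwards [Measure.quasiMeasurePreserving_fst.ae (ae_expMeasure_nonneg one_pos),
      Measure.quasiMeasurePreserving_snd.ae hG] with y h1 h2
    exact ⟨h1, h2⟩
  filter_upwards [h1, h2] with z h1 h2
  exact ⟨h1, h2⟩

theorem step_admissible {f : ℝ → ℝ} (hf : ∀ n : ℕ, 0 < f ((n + 1 : ℕ) : ℝ)) {x : QState}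
    (hx : x.Admissible) {z : ℝ × ℝ × ℝ} (hz : Good z) :
    (step f x z).1.Admissible ∧ 0 ≤ (step f x z).2 := by
  obtain ⟨a, c, b⟩ := z
  obtain ⟨ha, hc, hb⟩ := hz
  rcases x with n | ⟨n, r⟩
  · rcases n with _ | n
    · exact ⟨trivial, ha⟩
    · have := hf n
      by_cases h : a < c / f ((n + 1 : ℕ) : ℝ)
      · simp only [step, h, if_true]; exact ⟨trivial, ha⟩
      · simp only [step, h, if_false]; exact ⟨hb, div_nonneg hc this.le⟩
  · by_cases h : a < r
    · simp only [step, h, if_true]; exact ⟨sub_nonneg.2 h.le, ha⟩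
    · simp only [step, h, if_false]; exact ⟨trivial, hx⟩

/-! ### The queue stopped when it becomes empty -/

/-- The empty system with the server on vacation. -/
abbrev empty : QState := .vacation 0

/-- State and time after one more event. -/
noncomputable def advance (f : ℝ → ℝ) (q : (QState × ℝ) × (ℝ × ℝ × ℝ)) : QState × ℝ :=
  ((step f q.1.1 q.2).1, q.1.2 + (step f q.1.1 q.2).2)

theorem measurable_advance (f : ℝ → ℝ) : Measurable (advance f) := by
  have h : Measurable fun q : (QState × ℝ) × (ℝ × ℝ × ℝ) => step f q.1.1 q.2 :=
    (measurable_step f).comp ((measurable_fst.comp measurable_fst).prodMk measurable_snd)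
  exact h.fst.prodMk ((measurable_snd.comp measurable_fst).add h.snd)

/-- States with customers or an active server. -/
def busy : Set (QState × ℝ) := {p | p.1 ≠ empty}

theorem measurableSet_busy : MeasurableSet busy :=
  measurable_fst (measurableSet_eq_vacation 0).compl

/-- Law of the state and time after `k` events, on the event that the system has not been empty
before. -/
noncomputable def tabooLaw (lam : ℝ) (G : Measure ℝ) (f : ℝ → ℝ) (s : QState) :
    ℕ → Measure (QState × ℝ)
  | 0 => Measure.dirac (s, 0)
  | k + 1 => (((tabooLaw lam G f s k).restrict busy).prod (clock lam G)).map (advance f)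

section Taboo

variable {lam : ℝ} {G : Measure ℝ} (f : ℝ → ℝ)

theorem isFiniteMeasure_tabooLaw [IsProbabilityMeasure G] (hlam : 0 < lam) (s : QState) (k : ℕ) :
    IsFiniteMeasure (tabooLaw lam G f s k) := by
  have := isProbabilityMeasure_clock hlam G
  induction k with
  | zero => unfold tabooLaw; infer_instance
  | succ k ih => unfold tabooLaw; infer_instance

theorem lintegral_tabooLaw_succ [IsProbabilityMeasure G] (hlam : 0 < lam) (s : QState) (k : ℕ)
    {g : QState × ℝ → ℝ≥0∞}
    (hg : Measurable g) :
    ∫⁻ p, g p ∂tabooLaw lam G f s (k + 1) =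
      ∫⁻ p in busy, ∫⁻ z, g (advance f (p, z)) ∂clock lam G ∂tabooLaw lam G f s k := by
  have := isProbabilityMeasure_clock hlam G
  have := isFiniteMeasure_tabooLaw (G := G) f hlam s k
  rw [tabooLaw, lintegral_map hg (measurable_advance f),
    lintegral_prod (fun q => g (advance f q)) (hg.comp (measurable_advance f)).aemeasurable]

theorem lintegral_tabooLaw_succ_state [IsProbabilityMeasure G] (hlam : 0 < lam) (s : QState) (k : ℕ)
    {g : QState → ℝ≥0∞}
    (hg : Measurable g) :
    ∫⁻ p, g p.1 ∂tabooLaw lam G f s (k + 1) =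
      ∫⁻ p in busy, expect lam G f g p.1 ∂tabooLaw lam G f s k :=
  lintegral_tabooLaw_succ f hlam s k (hg.comp measurable_fst)

theorem tabooLaw_succ_univ [IsProbabilityMeasure G] (hlam : 0 < lam) (s : QState) (k : ℕ) :
    tabooLaw lam G f s (k + 1) univ = tabooLaw lam G f s k busy := by
  have := isProbabilityMeasure_clock hlam G
  have h := lintegral_tabooLaw_succ (G := G) f hlam s k (g := fun _ => 1) measurable_const
  simpa using h

theorem ae_tabooLaw [IsProbabilityMeasure G] {f : ℝ → ℝ} (hlam : 0 < lam) (hG : ∀ᵐ x ∂G, 0 ≤ x)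
    (hf : ∀ n : ℕ, 0 < f ((n + 1 : ℕ) : ℝ)) {s : QState} (hs : s.Admissible) (k : ℕ) :
    ∀ᵐ p ∂tabooLaw lam G f s k, p.1.Admissible ∧ 0 ≤ p.2 := by
  have := isProbabilityMeasure_clock hlam G
  have hm : MeasurableSet {p : QState × ℝ | p.1.Admissible ∧ 0 ≤ p.2} :=
    (measurable_fst measurableSet_admissible).inter (measurable_snd measurableSet_Ici)
  induction k with
  | zero =>
    rw [tabooLaw, ae_dirac_iff hm]
    exact ⟨hs, le_rfl⟩
  | succ k ih =>
    have := isFiniteMeasure_tabooLaw (G := G) f hlam s k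
    rw [tabooLaw, ae_map_iff (measurable_advance f).aemeasurable hm]
    have h1 := Measure.quasiMeasurePreserving_fst (ν := clock lam G)
      |>.ae (ae_restrict_of_ae (s := busy) ih)
    have h2 := Measure.quasiMeasurePreserving_snd
      (μ := (tabooLaw lam G f s k).restrict busy) |>.ae (ae_good hlam hG)
    filter_upwards [h1, h2] with q h1 h2
    have h3 := step_admissible hf h1.1 h2
    exact ⟨h3.1, add_nonneg h1.2 h3.2⟩

/-! ### Occupation measure, hitting time of the empty state, and Dynkin's formula -/

/-- Expected number of visits to states and times before the system becomes empty. -/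
noncomputable def occ (lam : ℝ) (G : Measure ℝ) (f : ℝ → ℝ) (s : QState) : Measure (QState × ℝ) :=
  Measure.sum fun k => (tabooLaw lam G f s k).restrict busy

/-- Law of the time at which the system first becomes empty. -/
noncomputable def hit (lam : ℝ) (G : Measure ℝ) (f : ℝ → ℝ) (s : QState) : Measure ℝ :=
  Measure.sum fun k => ((tabooLaw lam G f s k).restrict busyᶜ).map Prod.snd

theorem lintegral_occ (s : QState) (g : QState × ℝ → ℝ≥0∞) :
    ∫⁻ p, g p ∂occ lam G f s = ∑' k, ∫⁻ p in busy, g p ∂tabooLaw lam G f s k :=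
  lintegral_sum_measure _ _

theorem lintegral_hit (s : QState) {g : ℝ → ℝ≥0∞} (hg : Measurable g) :
    ∫⁻ y, g y ∂hit lam G f s = ∑' k, ∫⁻ p in busyᶜ, g p.2 ∂tabooLaw lam G f s k := by
  rw [hit, lintegral_sum_measure]
  exact tsum_congr fun k => lintegral_map hg measurable_snd

/-- The drift condition is summed over the events before emptiness and `φ` telescopes. The leftover
expectation of `φ` is nonnegative and can be dropped, so neither boundedness nor recurrence is
needed in this direction. -/
theorem lintegral_occ_le [IsProbabilityMeasure G] (hlam : 0 < lam) {g φ k : QState → ℝ≥0∞}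
    (hg : Measurable g)
    (hφ : Measurable φ) (h : ∀ x ≠ empty, g x + expect lam G f φ x ≤ φ x + k x) (s : QState) :
    ∫⁻ p, g p.1 ∂occ lam G f s ≤ φ s + ∫⁻ p, k p.1 ∂occ lam G f s := by
  have key : ∀ m, ∑ i ∈ Finset.range m, ∫⁻ p in busy, g p.1 ∂tabooLaw lam G f s i +
      ∫⁻ p, φ p.1 ∂tabooLaw lam G f s m ≤
      φ s + ∑ i ∈ Finset.range m, ∫⁻ p in busy, k p.1 ∂tabooLaw lam G f s i := by
    intro m
    induction m with
    | zero =>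
      simp only [Finset.range_zero, Finset.sum_empty, zero_add, add_zero, tabooLaw]
      rw [lintegral_dirac' _ (by fun_prop)]
    | succ m ih =>
      rw [Finset.sum_range_succ, Finset.sum_range_succ, lintegral_tabooLaw_succ_state f hlam s m hφ,
        add_assoc, ← add_assoc (φ s)]
      have h1 : ∫⁻ p in busy, g p.1 ∂tabooLaw lam G f s m +
          ∫⁻ p in busy, expect lam G f φ p.1 ∂tabooLaw lam G f s m ≤
          ∫⁻ p, φ p.1 ∂tabooLaw lam G f s m + ∫⁻ p in busy, k p.1 ∂tabooLaw lam G f s m := by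
        rw [← lintegral_add_left (by fun_prop)]
        calc _ ≤ ∫⁻ p in busy, φ p.1 + k p.1 ∂tabooLaw lam G f s m :=
              setLIntegral_mono' measurableSet_busy fun p hp => h _ hp
          _ = _ := lintegral_add_left (by fun_prop) _
          _ ≤ _ := by gcongr; exact Measure.restrict_le_self
      calc _ ≤ ∑ i ∈ Finset.range m, ∫⁻ p in busy, g p.1 ∂tabooLaw lam G f s i +
            (∫⁻ p, φ p.1 ∂tabooLaw lam G f s m +
              ∫⁻ p in busy, k p.1 ∂tabooLaw lam G f s m) := by gcongr
        _ ≤ _ := by rw [← add_assoc]; gcongr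
  rw [lintegral_occ, lintegral_occ, ENNReal.tsum_eq_iSup_nat]
  refine iSup_le fun m => le_trans (le_trans le_self_add (key m)) ?_
  gcongr
  exact ENNReal.sum_le_tsum _

/-- In this direction the leftover expectation of `φ` must vanish in the limit, which follows from
the bound `C` and the vanishing surviving mass. Mass absorbed at `empty` is discarded at the next
step, and `φ empty = 0` makes this harmless. Unbounded test functions are reached by truncation. -/
theorem le_lintegral_occ [IsProbabilityMeasure G] (hlam : 0 < lam) {g φ k : QState → ℝ≥0∞}
    (hg : Measurable g)
    (hφ : Measurable φ) (h : ∀ x ≠ empty, φ x + k x ≤ g x + expect lam G f φ x)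
    (h0 : φ empty = 0) {C : ℝ≥0∞} (hC : C ≠ ∞) (hφC : ∀ x, φ x ≤ C) (s : QState)
    (hs : Tendsto (fun m => tabooLaw lam G f s m univ) atTop (𝓝 0)) :
    φ s + ∫⁻ p, k p.1 ∂occ lam G f s ≤ ∫⁻ p, g p.1 ∂occ lam G f s := by
  have key : ∀ m, φ s + ∑ i ∈ Finset.range m, ∫⁻ p in busy, k p.1 ∂tabooLaw lam G f s i ≤
      ∑ i ∈ Finset.range m, ∫⁻ p in busy, g p.1 ∂tabooLaw lam G f s i +
      ∫⁻ p, φ p.1 ∂tabooLaw lam G f s m := by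
    intro m
    induction m with
    | zero =>
      simp only [Finset.range_zero, Finset.sum_empty, zero_add, add_zero, tabooLaw]
      rw [lintegral_dirac' _ (by fun_prop)]
    | succ m ih =>
      rw [Finset.sum_range_succ, Finset.sum_range_succ, lintegral_tabooLaw_succ_state f hlam s m hφ,
        add_assoc (∑ i ∈ Finset.range m, _), ← add_assoc (φ s)]
      have hb : ∫⁻ p, φ p.1 ∂tabooLaw lam G f s m =
          ∫⁻ p in busy, φ p.1 ∂tabooLaw lam G f s m := by
        rw [← lintegral_add_compl _ measurableSet_busy]
        have : ∫⁻ p in busyᶜ, φ p.1 ∂tabooLaw lam G f s m = 0 := by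
          rw [setLIntegral_congr_fun measurableSet_busy.compl (g := fun _ => 0), lintegral_zero]
          intro p hp
          simp only [busy, mem_compl_iff, mem_ofPred_eq, not_not] at hp
          simp only [hp, h0]
        rw [this, add_zero]
      have h1 : ∫⁻ p, φ p.1 ∂tabooLaw lam G f s m + ∫⁻ p in busy, k p.1 ∂tabooLaw lam G f s m ≤
          ∫⁻ p in busy, g p.1 ∂tabooLaw lam G f s m +
          ∫⁻ p in busy, expect lam G f φ p.1 ∂tabooLaw lam G f s m := by
        rw [hb, ← lintegral_add_left (by fun_prop),
          ← lintegral_add_left (by fun_prop)]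
        exact setLIntegral_mono' measurableSet_busy fun p hp => h _ hp
      calc _ ≤ ∑ i ∈ Finset.range m, ∫⁻ p in busy, g p.1 ∂tabooLaw lam G f s i +
            (∫⁻ p, φ p.1 ∂tabooLaw lam G f s m +
              ∫⁻ p in busy, k p.1 ∂tabooLaw lam G f s m) := by rw [← add_assoc]; gcongr
        _ ≤ _ := by gcongr
  rw [lintegral_occ, lintegral_occ]
  have hlim : Tendsto (fun m => φ s +
      ∑ i ∈ Finset.range m, ∫⁻ p in busy, k p.1 ∂tabooLaw lam G f s i) atTop
      (𝓝 (φ s + ∑' i, ∫⁻ p in busy, k p.1 ∂tabooLaw lam G f s i)) :=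
    tendsto_const_nhds.add ENNReal.summable.hasSum.tendsto_sum_nat
  have hlim2 : Tendsto (fun m => ∑' i, ∫⁻ p in busy, g p.1 ∂tabooLaw lam G f s i +
      C * tabooLaw lam G f s m univ) atTop
      (𝓝 (∑' i, ∫⁻ p in busy, g p.1 ∂tabooLaw lam G f s i + C * 0)) :=
    tendsto_const_nhds.add (ENNReal.Tendsto.const_mul hs (Or.inr hC))
  rw [mul_zero, add_zero] at hlim2
  refine le_of_tendsto_of_tendsto' hlim hlim2 fun m => (key m).trans ?_
  gcongr
  · exact ENNReal.sum_le_tsum _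
  · calc _ ≤ ∫⁻ p, C ∂tabooLaw lam G f s m := lintegral_mono fun p => hφC _
      _ = _ := by simp

/-- Decomposition at the first time at which the system is empty. -/
theorem eq_lintegral_occ_add_hit [IsProbabilityMeasure G] {f : ℝ → ℝ} (hlam : 0 < lam)
    (hG : ∀ᵐ x ∂G, 0 ≤ x)
    (hf : ∀ n : ℕ, 0 < f ((n + 1 : ℕ) : ℝ)) {u a : QState × ℝ → ℝ≥0∞} (hu : Measurable u)
    (ha : Measurable a) (h : ∀ p : QState × ℝ, p.1.Admissible → p.1 ≠ empty → 0 ≤ p.2 →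
      u p = a p + ∫⁻ z, u (advance f (p, z)) ∂clock lam G)
    (hu1 : ∀ p : QState × ℝ, p.1.Admissible → u p ≤ 1) {s : QState} (hsa : s.Admissible)
    (hs : Tendsto (fun m => tabooLaw lam G f s m univ) atTop (𝓝 0)) :
    u (s, 0) = ∫⁻ p, a p ∂occ lam G f s + ∫⁻ y, u (empty, y) ∂hit lam G f s := by
  -- After `m` events the value of `u` has split into what was collected on busy states, what was
  -- left at `empty` by the absorbed paths, and a remainder of at most the current mass.
  have key : ∀ m, u (s, 0) = ∑ i ∈ Finset.range m, ∫⁻ p in busy, a p ∂tabooLaw lam G f s i +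
      ∑ i ∈ Finset.range m, ∫⁻ p in busyᶜ, u (empty, p.2) ∂tabooLaw lam G f s i +
      ∫⁻ p, u p ∂tabooLaw lam G f s m := by
    intro m
    induction m with
    | zero =>
      simp only [Finset.range_zero, Finset.sum_empty, zero_add, tabooLaw]
      rw [lintegral_dirac' _ hu]
    | succ m ih =>
      rw [Finset.sum_range_succ, Finset.sum_range_succ, lintegral_tabooLaw_succ f hlam s m hu, ih,
        ← lintegral_add_compl u measurableSet_busy]
      have h1 : ∫⁻ p in busy, u p ∂tabooLaw lam G f s m =
          ∫⁻ p in busy, a p ∂tabooLaw lam G f s m + ∫⁻ p in busy,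
            ∫⁻ z, u (advance f (p, z)) ∂clock lam G ∂tabooLaw lam G f s m := by
        rw [← lintegral_add_left ha]
        refine lintegral_congr_ae ?_
        filter_upwards [ae_restrict_mem measurableSet_busy,
          ae_restrict_of_ae (ae_tabooLaw hlam hG hf hsa m)] with p hp hp2
        exact h p hp2.1 hp hp2.2
      have h2 : ∫⁻ p in busyᶜ, u p ∂tabooLaw lam G f s m =
          ∫⁻ p in busyᶜ, u (empty, p.2) ∂tabooLaw lam G f s m := by
        refine setLIntegral_congr_fun measurableSet_busy.compl fun p hp => ?_
        simp only [busy, mem_compl_iff, mem_ofPred_eq, not_not] at hp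
        simp only [← hp]
      rw [h1, h2]
      ring
  have hrem : Tendsto (fun m => ∫⁻ p, u p ∂tabooLaw lam G f s m) atTop (𝓝 0) := by
    refine tendsto_of_tendsto_of_tendsto_of_le_of_le tendsto_const_nhds hs (fun _ => zero_le) ?_
    intro m
    calc ∫⁻ p, u p ∂tabooLaw lam G f s m ≤ ∫⁻ p, 1 ∂tabooLaw lam G f s m :=
          lintegral_mono_ae <| by
            filter_upwards [ae_tabooLaw hlam hG hf hsa m] with p hp using hu1 p hp.1
      _ = _ := by simp
  have hlim := ((ENNReal.summable (f := fun i => ∫⁻ p in busy, a p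
    ∂tabooLaw lam G f s i)).hasSum.tendsto_sum_nat.add
      (ENNReal.summable (f := fun i => ∫⁻ p in busyᶜ, u (empty, p.2)
        ∂tabooLaw lam G f s i)).hasSum.tendsto_sum_nat).add hrem
  rw [add_zero] at hlim
  rw [lintegral_occ, lintegral_hit _ _ (by fun_prop)]
  exact tendsto_nhds_unique (tendsto_const_nhds.congr key) hlim

end Taboo

/-! ### One-step expectations of polynomial functions of the state -/

/-- Function on the state space given by its values during vacations and services. -/
def QState.fold (v : ℕ → ℝ≥0∞) (w : ℕ → ℝ → ℝ≥0∞) : QState → ℝ≥0∞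
  | .vacation n => v n
  | .service n r => w n r

@[simp] theorem QState.fold_vacation (v : ℕ → ℝ≥0∞) (w : ℕ → ℝ → ℝ≥0∞) (n : ℕ) :
    QState.fold v w (.vacation n) = v n := rfl

@[simp] theorem QState.fold_service (v : ℕ → ℝ≥0∞) (w : ℕ → ℝ → ℝ≥0∞) (n : ℕ) (r : ℝ) :
    QState.fold v w (.service n r) = w n r := rfl

theorem QState.measurable_fold {v : ℕ → ℝ≥0∞} {w : ℕ → ℝ → ℝ≥0∞} (hw : ∀ n, Measurable (w n)) :
    Measurable (QState.fold v w) := QState.measurable_iff.2 hw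

/-- Half the square of the positive part. -/
noncomputable def halfSq (r : ℝ) : ℝ≥0∞ := ENNReal.ofReal ((max r 0) ^ 2 / 2)

theorem measurable_halfSq : Measurable halfSq := by unfold halfSq; fun_prop

/-- Expected duration of an event during a service with residual time `r`. -/
noncomputable def servDur (lam r : ℝ) : ℝ≥0∞ :=
  ENNReal.ofReal ((1 - Real.exp (-(lam * max r 0))) / lam)

/-- Expected integral of the residual service time over an event. -/
noncomputable def servArea (lam r : ℝ) : ℝ≥0∞ :=
  ENNReal.ofReal ((max r 0 - (1 - Real.exp (-(lam * max r 0))) / lam) / lam)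

theorem measurable_servDur (lam : ℝ) : Measurable (servDur lam) := by unfold servDur; fun_prop

theorem measurable_servArea (lam : ℝ) : Measurable (servArea lam) := by unfold servArea; fun_prop

theorem one_sub_exp_div_nonneg {lam : ℝ} (hlam : 0 < lam) (r : ℝ) :
    0 ≤ (1 - Real.exp (-(lam * max r 0))) / lam := by
  have : Real.exp (-(lam * max r 0)) ≤ 1 := by
    rw [Real.exp_le_one_iff]; have := le_max_right r 0; nlinarith
  exact div_nonneg (by linarith) hlam.le

theorem one_sub_exp_div_le {lam : ℝ} (hlam : 0 < lam) (r : ℝ) :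
    (1 - Real.exp (-(lam * max r 0))) / lam ≤ max r 0 := by
  rw [div_le_iff₀ hlam]
  linarith [Real.add_one_le_exp (-(lam * max r 0))]

theorem ofReal_max_zero (r : ℝ) : ENNReal.ofReal (max r 0) = ENNReal.ofReal r := by
  rcases le_total r 0 with h | h
  · rw [max_eq_right h, ENNReal.ofReal_of_nonpos h, ENNReal.ofReal_zero]
  · rw [max_eq_left h]

/-- Here r = E[(r-a)⁺] + E[min(a,r)] for an exponential clock a: the first term is λ times
`servArea`, the second is `servDur`. -/
theorem mul_servArea_add_servDur {lam : ℝ} (hlam : 0 < lam) (r : ℝ) :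
    ENNReal.ofReal lam * servArea lam r + servDur lam r = ENNReal.ofReal r := by
  have h1 := one_sub_exp_div_nonneg hlam r
  have h2 := one_sub_exp_div_le hlam r
  rw [servArea, servDur, ← ENNReal.ofReal_mul hlam.le, ← ENNReal.ofReal_add, ← ofReal_max_zero r]
  · congr 1; field_simp; ring
  · rw [mul_div_cancel₀ _ hlam.ne']; linarith
  · exact h1

/-- λE[min(a,r)] is the probability that the arrival precedes the completion. -/
theorem mul_servDur_add {lam : ℝ} (hlam : 0 < lam) (r : ℝ) :
    ENNReal.ofReal lam * servDur lam r + expMeasure lam (Ici r) = 1 := by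
  have h1 := one_sub_exp_div_nonneg hlam r
  rw [servDur, expMeasure_Ici hlam, ← ENNReal.ofReal_mul hlam.le, ← ENNReal.ofReal_add,
    ← ENNReal.ofReal_one]
  · congr 1; field_simp; ring
  · positivity
  · positivity

/-- Along a path the residual time decreases at unit rate, so its integral over the event is the
drop of r²/2. -/
theorem half_sq_split {lam : ℝ} (hlam : 0 < lam) (r : ℝ) :
    ∫⁻ x in Iio r, halfSq (r - x) ∂expMeasure lam + servArea lam r = halfSq r := by
  have h0 : ∫⁻ x in Iio r, halfSq (r - x) ∂expMeasure lam =
      ∫⁻ x in Iio r, ENNReal.ofReal ((r - x) ^ 2 / 2) ∂expMeasure lam :=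
    setLIntegral_congr_fun measurableSet_Iio fun x hx => by
      simp only [halfSq]; rw [max_eq_left (sub_nonneg.2 (le_of_lt hx))]
  have h2 := one_sub_exp_div_le hlam r
  rw [h0, setLIntegral_expMeasure_sub_sq hlam, servArea, halfSq, ← ENNReal.ofReal_add]
  · congr 1; ring
  · set R := max r 0 with hR
    have hR0 : 0 ≤ R := le_max_right _ _
    -- Nonnegativity of the difference amounts to exp(-x) ≤ 1 - x + x²/2. This follows from exp(x) ≥
    -- 1 + x + x²/2, since the product of the two quadratics is 1 + x⁴/4.
    have h3 := Real.quadratic_le_exp_of_nonneg (x := lam * R) (by positivity)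
    have h4 : Real.exp (-(lam * R)) ≤ 1 - lam * R + (lam * R) ^ 2 / 2 := by
      set x := lam * R
      have hx : 0 ≤ 1 - x + x ^ 2 / 2 := by nlinarith [sq_nonneg (x - 1)]
      have h5 : 1 ≤ (1 - x + x ^ 2 / 2) * Real.exp x := by
        nlinarith [mul_le_mul_of_nonneg_left h3 hx, sq_nonneg (x ^ 2)]
      calc Real.exp (-x) = Real.exp (-x) * 1 := (mul_one _).symm
        _ ≤ Real.exp (-x) * ((1 - x + x ^ 2 / 2) * Real.exp x) := by gcongr
        _ = (1 - x + x ^ 2 / 2) * (Real.exp (-x) * Real.exp x) := by ring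
        _ = _ := by rw [← Real.exp_add]; simp
    have h6 : (R - (1 - Real.exp (-(lam * R))) / lam) / lam ≤ R ^ 2 / 2 := by
      rw [div_le_iff₀ hlam, sub_le_iff_le_add, ← sub_le_iff_le_add', le_div_iff₀ hlam]
      nlinarith
    linarith
  · exact div_nonneg (by linarith) hlam.le

theorem ae_restrict_Iio_expMeasure {lam : ℝ} (hlam : 0 < lam) (r : ℝ) :
    ∀ᵐ a ∂(expMeasure lam).restrict (Iio r), r - a ∈ Ioc 0 r := by
  filter_upwards [ae_restrict_mem measurableSet_Iio,
    ae_restrict_of_ae (ae_expMeasure_nonneg hlam)] with a h1 h2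
  exact ⟨sub_pos.2 h1, by linarith⟩

theorem setLIntegral_poly {lam : ℝ} (hlam : 0 < lam) (r : ℝ) (A B C : ℝ≥0∞) :
    ∫⁻ a in Iio r, A + B * ENNReal.ofReal (r - a) + C * halfSq (r - a) ∂expMeasure lam =
      A * (ENNReal.ofReal lam * servDur lam r) + B * (ENNReal.ofReal lam * servArea lam r) +
        C * ∫⁻ x in Iio r, halfSq (r - x) ∂expMeasure lam := by
  have hm : Measurable fun a => halfSq (r - a) := measurable_halfSq.comp (by fun_prop)
  have h1 := one_sub_exp_div_nonneg hlam r
  have h2 := one_sub_exp_div_le hlam r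
  rw [lintegral_add_right _ (by fun_prop), lintegral_add_right _ (by fun_prop),
    lintegral_const_mul _ (by fun_prop), lintegral_const_mul _ hm, setLIntegral_const,
    setLIntegral_expMeasure_sub hlam, expMeasure_Iio hlam, servDur, servArea,
    ← ENNReal.ofReal_mul hlam.le, ← ENNReal.ofReal_mul hlam.le, mul_div_cancel₀ _ hlam.ne',
    mul_div_cancel₀ _ hlam.ne']

section

variable {lam : ℝ} {G : Measure ℝ} {f : ℝ → ℝ}

/-- After an arrival at time a the residual is r - a, almost surely in (0, r]; a bound quadratic in
the residual and valid there is all that the test functions below require. -/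
theorem expect_service_le [IsProbabilityMeasure G] (hlam : 0 < lam) (n : ℕ) (r : ℝ)
    {g : QState → ℝ≥0∞} (hg : Measurable g) {A B C : ℝ≥0∞}
    (h : ∀ x ∈ Ioc 0 r, g (.service (n + 1) x) ≤ A + B * ENNReal.ofReal x + C * halfSq x) :
    expect lam G f g (.service n r) ≤
      A * (ENNReal.ofReal lam * servDur lam r) + B * (ENNReal.ofReal lam * servArea lam r) +
        C * ∫⁻ x in Iio r, halfSq (r - x) ∂expMeasure lam +
        expMeasure lam (Ici r) * g (.vacation n) := by
  rw [expect_service hlam G f n r hg, ← setLIntegral_poly hlam]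
  gcongr ?_ + _
  refine lintegral_mono_ae ?_
  filter_upwards [ae_restrict_Iio_expMeasure hlam r] with a ha using h _ ha

theorem le_expect_service [IsProbabilityMeasure G] (hlam : 0 < lam) (n : ℕ) (r : ℝ)
    {g : QState → ℝ≥0∞} (hg : Measurable g) {A B C : ℝ≥0∞}
    (h : ∀ x ∈ Ioc 0 r, A + B * ENNReal.ofReal x + C * halfSq x ≤ g (.service (n + 1) x)) :
    A * (ENNReal.ofReal lam * servDur lam r) + B * (ENNReal.ofReal lam * servArea lam r) +
        C * ∫⁻ x in Iio r, halfSq (r - x) ∂expMeasure lam +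
        expMeasure lam (Ici r) * g (.vacation n) ≤ expect lam G f g (.service n r) := by
  rw [expect_service hlam G f n r hg, ← setLIntegral_poly hlam]
  gcongr ?_ + _
  refine lintegral_mono_ae ?_
  filter_upwards [ae_restrict_Iio_expMeasure hlam r] with a ha using h _ ha

/-- Expected duration of an event on vacation with `n` customers. -/
noncomputable def vacDur (lam : ℝ) (f : ℝ → ℝ) (n : ℕ) : ℝ≥0∞ := ENNReal.ofReal (1 / (lam + f n))

theorem vacDur_add (hlam : 0 < lam) {n : ℕ} (hf : 0 ≤ f n) :
    ENNReal.ofReal lam * vacDur lam f n + ENNReal.ofReal (f n) * vacDur lam f n = 1 := by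
  rw [← add_mul, ← ENNReal.ofReal_add hlam.le hf, vacDur, ← ENNReal.ofReal_mul (by positivity),
    mul_one_div_cancel (by positivity), ENNReal.ofReal_one]

theorem expect_vacation' [IsProbabilityMeasure G] (hlam : 0 < lam) {n : ℕ}
    (hf : 0 < f ((n + 1 : ℕ) : ℝ)) {g : QState → ℝ≥0∞} (hg : Measurable g) :
    expect lam G f g (.vacation (n + 1)) =
      ENNReal.ofReal lam * vacDur lam f (n + 1) * g (.vacation (n + 2)) +
        ENNReal.ofReal (f ((n + 1 : ℕ) : ℝ)) * vacDur lam f (n + 1) *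
          ∫⁻ b, g (.service n b) ∂G := by
  rw [expect_vacation hlam G hf hg, vacDur, ← ENNReal.ofReal_mul hlam.le,
    ← ENNReal.ofReal_mul hf.le]
  simp only [mul_one_div]

end

/-! ### Lyapunov functions and positive recurrence -/

/-- These are slopes for the Lyapunov function. Where `f` is large a constant slope works, because
λβ < 1. For small n activation may be slow, so the slope grows geometrically as n decreases, until
even the rate `f 1` outweighs the arrivals. -/
theorem exists_slopes {lam β : ℝ} (hlam : 0 < lam) (hβ : 0 ≤ β) (hrho : lam * β < 1) {f : ℕ → ℝ}
    (hf1 : 0 < f 1) (hmono : Monotone f) (hunb : ∀ y, ∃ n, y ≤ f n) :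
    ∃ c : ℕ → ℝ, (∀ n, 0 ≤ c n) ∧ Antitone c ∧
      ∀ n, 1 + lam * c (n + 2) + f (n + 1) * (β * (1 + lam * c (n + 1))) ≤ f (n + 1) * c (n + 1) := by
  have hr : 0 < 1 - lam * β := by linarith
  obtain ⟨n0, hn0⟩ := hunb (max (2 * lam / (1 - lam * β)) 1)
  -- `C` satisfies C(1-λβ) = 2(β+1): beyond `n0` this pays for the β term, for λC ≤ f·(β+1) and for
  -- the constant 1. `M` is such that M(1-λβ) ≥ β + (1+λ)/f(1), which is what one step below `n0`
  -- costs.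
  set C := 2 * (β + 1) / (1 - lam * β) with hC
  set M := (β + (1 + lam) / f 1) / (1 - lam * β) + 1 with hM
  have hM1 : 1 ≤ M := by
    have : 0 ≤ (β + (1 + lam) / f 1) / (1 - lam * β) := by positivity
    linarith
  have hC1 : 1 ≤ C := by
    rw [hC, le_div_iff₀ hr]; nlinarith [mul_nonneg hlam.le hβ]
  have hCr : C * (1 - lam * β) = 2 * (β + 1) := by rw [hC, div_mul_cancel₀ _ hr.ne']
  have hMr : M * (1 - lam * β) ≥ β + (1 + lam) / f 1 := by
    rw [hM, add_mul, div_mul_cancel₀ _ hr.ne']; linarith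
  -- Truncated subtraction makes the slope constant, equal to `C`, from `n0` on.
  refine ⟨fun n => C * M ^ (n0 - n), fun n => by positivity, ?_, fun n => ?_⟩
  · intro a b hab
    have := pow_le_pow_right₀ hM1 (Nat.sub_le_sub_left hab n0)
    exact mul_le_mul_of_nonneg_left this (by positivity)
  suffices h : 1 + lam * (C * M ^ (n0 - (n + 2))) ≤
      f (n + 1) * (C * M ^ (n0 - (n + 1)) * (1 - lam * β) - β) by
    simp only; nlinarith
  rcases le_or_gt n0 (n + 1) with h | h
  · rw [Nat.sub_eq_zero_of_le h, Nat.sub_eq_zero_of_le (by omega), pow_zero, mul_one, hCr]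
    have h1 := (le_max_left _ _).trans (hn0.trans (hmono h))
    have h2 := (le_max_right _ _).trans (hn0.trans (hmono h))
    have h3 : lam * C ≤ f (n + 1) * (β + 1) := by
      have : lam * C = 2 * lam / (1 - lam * β) * (β + 1) := by rw [hC]; ring
      rw [this]; gcongr
    nlinarith
  · have h1 : n0 - (n + 1) = n0 - (n + 2) + 1 := by omega
    rw [h1, pow_succ]
    set y := C * M ^ (n0 - (n + 2)) with hy
    have hy1 : 1 ≤ y := one_le_mul_of_one_le_of_one_le hC1 (one_le_pow₀ hM1)
    have h2 : C * (M ^ (n0 - (n + 2)) * M) * (1 - lam * β) = y * (M * (1 - lam * β)) := by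
      rw [hy]; ring
    have h3 : y * ((1 + lam) / f 1) ≤ y * (M * (1 - lam * β)) - β := by nlinarith
    rw [h2]
    calc 1 + lam * y ≤ f 1 * (y * ((1 + lam) / f 1)) := by
          field_simp; nlinarith
      _ ≤ f (n + 1) * (y * (M * (1 - lam * β)) - β) := by
          refine mul_le_mul (hmono (by omega)) h3 (by positivity) ?_
          exact hf1.le.trans (hmono (by omega))

/-- Mean duration of an event, off the empty state. -/
noncomputable def durFun (lam : ℝ) (f : ℝ → ℝ) : QState → ℝ≥0∞ :=
  QState.fold (fun n => vacDur lam f n) (fun _ r => servDur lam r)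

theorem measurable_durFun (lam : ℝ) (f : ℝ → ℝ) : Measurable (durFun lam f) :=
  QState.measurable_fold fun _ => measurable_servDur lam

section

variable {lam : ℝ} {G : Measure ℝ} {f : ℝ → ℝ}

theorem meanDur_eq_durFun [IsProbabilityMeasure G] (hlam : 0 < lam)
    (hf : ∀ n : ℕ, 0 < f ((n + 1 : ℕ) : ℝ)) {x : QState} (hx : x ≠ empty) :
    meanDur lam G f x = durFun lam f x := by
  rcases x with n | ⟨n, r⟩
  · rcases n with _ | n
    · exact absurd rfl hx
    · exact meanDur_vacation hlam G (hf n)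
  · exact meanDur_service hlam G f n r

/-- Lyapunov function with slopes `c`. -/
noncomputable def lyap (lam : ℝ) (c : ℕ → ℝ≥0∞) : QState → ℝ≥0∞ :=
  QState.fold (fun n => ∑ k ∈ Finset.range n, c (k + 1))
    (fun n r => ENNReal.ofReal r * (1 + ENNReal.ofReal lam * c (n + 1)) +
      ∑ k ∈ Finset.range n, c (k + 1))

theorem measurable_lyap (lam : ℝ) (c : ℕ → ℝ≥0∞) : Measurable (lyap lam c) :=
  QState.measurable_fold fun _ => by fun_prop

/-- A residual time r costs r itself plus λr expected arrivals, each adding at most `c (n + 1)`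
because the slopes are antitone. The hypothesis `h` is exactly the drift needed on vacation.
Consequently `lyap` dominates the expected time to emptiness. -/
theorem lyap_drift [IsProbabilityMeasure G] (hlam : 0 < lam)
    (hf : ∀ n : ℕ, 0 < f ((n + 1 : ℕ) : ℝ)) {c : ℕ → ℝ≥0∞} (hc : Antitone c)
    (h : ∀ n : ℕ, 1 + ENNReal.ofReal lam * c (n + 2) + ENNReal.ofReal (f ((n + 1 : ℕ) : ℝ)) *
      ((∫⁻ b, ENNReal.ofReal b ∂G) * (1 + ENNReal.ofReal lam * c (n + 1))) ≤
      ENNReal.ofReal (f ((n + 1 : ℕ) : ℝ)) * c (n + 1)) (x : QState) (hx : x ≠ empty) :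
    durFun lam f x + expect lam G f (lyap lam c) x ≤ lyap lam c x := by
  have hm := measurable_lyap lam c
  set L := ENNReal.ofReal lam with hL
  rcases x with n | ⟨n, r⟩
  · rcases n with _ | n
    · exact absurd rfl hx
    rw [expect_vacation' hlam (hf n) hm]
    have hD := vacDur_add (f := f) hlam (n := n + 1) (hf n).le
    simp only [lyap, durFun, QState.fold_vacation, QState.fold_service, ← hL] at hD ⊢
    rw [lintegral_add_right _ measurable_const, lintegral_mul_const _ (by fun_prop)]
    simp only [lintegral_const, measure_univ, mul_one]
    have hn := h n
    set F := ENNReal.ofReal (f ((n + 1 : ℕ) : ℝ))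
    set D := vacDur lam f (n + 1)
    set b1 := ∫⁻ b, ENNReal.ofReal b ∂G
    rw [Finset.sum_range_succ, Finset.sum_range_succ]
    set V := ∑ k ∈ Finset.range n, c (k + 1)
    calc D + (L * D * (V + c (n + 1) + c (n + 1 + 1)) + F * D * (b1 * (1 + L * c (n + 1)) + V))
        = D * (1 + L * c (n + 2) + F * (b1 * (1 + L * c (n + 1)))) + L * D * c (n + 1) +
            (L * D + F * D) * V := by ring
      _ ≤ D * (F * c (n + 1)) + L * D * c (n + 1) + (L * D + F * D) * V := by gcongr
      _ = (L * D + F * D) * (V + c (n + 1)) := by ring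
      _ = V + c (n + 1) := by rw [hD, one_mul]
  · have h1 := expect_service_le (G := G) (f := f) hlam n r hm
      (A := ∑ k ∈ Finset.range (n + 1), c (k + 1)) (B := 1 + L * c (n + 1)) (C := 0) (by
        intro x hx
        simp only [lyap, QState.fold_service, zero_mul, add_zero, ← hL]
        rw [add_comm, mul_comm]
        gcongr
        exact hc (by omega))
    have h2 := mul_servArea_add_servDur hlam r
    have h3 := mul_servDur_add hlam r
    simp only [lyap, durFun, QState.fold_vacation, QState.fold_service, ← hL] at h1 h2 h3 ⊢
    rw [Finset.sum_range_succ] at h1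
    rw [zero_mul, add_zero] at h1
    set V := ∑ k ∈ Finset.range n, c (k + 1)
    set J := servArea lam r
    set δ := servDur lam r
    set pe := expMeasure lam (Ici r)
    rw [← h2]
    calc _ ≤ δ + ((V + c (n + 1)) * (L * δ) + (1 + L * c (n + 1)) * (L * J) + pe * V) := by gcongr
      _ = δ + (L * J * (1 + L * c (n + 1)) + δ * (L * c (n + 1)) + (L * δ + pe) * V) := by ring
      _ = (L * J + δ) * (1 + L * c (n + 1)) + V := by rw [h3, one_mul]; ring

/-- Number of activations and completions needed without further arrivals. -/
noncomputable def workCount : QState → ℝ≥0∞ :=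
  QState.fold (fun n => 2 * (n : ℝ≥0∞)) (fun n _ => 2 * (n : ℝ≥0∞) + 1)

theorem measurable_workCount : Measurable workCount :=
  QState.measurable_fold fun _ => by fun_prop

/-- An arrival raises the count by 2, and any other event lowers it by 1, so the drift is
3P(arrival) - 1, where P(arrival) is λ times the expected duration. This converts finite expected
time into a finite expected number of events. -/
theorem workCount_drift [IsProbabilityMeasure G] (hlam : 0 < lam)
    (hf : ∀ n : ℕ, 0 < f ((n + 1 : ℕ) : ℝ)) (x : QState) (hx : x ≠ empty) :
    1 + expect lam G f workCount x ≤ workCount x + 3 * ENNReal.ofReal lam * durFun lam f x := by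
  have hm := measurable_workCount
  set L := ENNReal.ofReal lam with hL
  rcases x with n | ⟨n, r⟩
  · rcases n with _ | n
    · exact absurd rfl hx
    rw [expect_vacation' hlam (hf n) hm]
    have hD := vacDur_add (f := f) hlam (n := n + 1) (hf n).le
    simp only [workCount, durFun, QState.fold_vacation, QState.fold_service, ← hL] at hD ⊢
    simp only [lintegral_const, measure_univ, mul_one]
    set F := ENNReal.ofReal (f ((n + 1 : ℕ) : ℝ))
    set D := vacDur lam f (n + 1)
    push_cast
    refine le_of_eq ?_
    calc 1 + (L * D * (2 * ((n : ℝ≥0∞) + 2)) + F * D * (2 * n + 1))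
        = 1 + ((L * D + F * D) * (2 * n + 1) + 3 * L * D) := by ring
      _ = _ := by rw [hD]; ring
  · have h1 := expect_service_le (G := G) (f := f) hlam n r hm
      (A := 2 * n + 3) (B := 0) (C := 0) (by
        intro x hx
        simp only [workCount, QState.fold_service, zero_mul, add_zero]
        push_cast; refine le_of_eq ?_; ring)
    have h3 := mul_servDur_add hlam r
    simp only [workCount, durFun, QState.fold_vacation, QState.fold_service, ← hL, zero_mul,
      add_zero] at h1 h3 ⊢
    set δ := servDur lam r
    set pe := expMeasure lam (Ici r)
    calc _ ≤ 1 + ((2 * n + 3) * (L * δ) + pe * (2 * n)) := by gcongr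
      _ = 1 + ((L * δ + pe) * (2 * n) + 3 * L * δ) := by ring
      _ = _ := by rw [h3]; ring

/-- The expected time until the system is empty and the expected number of events until then are
finite. -/
theorem positive_recurrence [IsProbabilityMeasure G] (hlam : 0 < lam)
    (hG : ∀ᵐ x ∂G, 0 ≤ x) (hGi : Integrable (fun x => x) G) (hrho : lam * ∫ x, x ∂G < 1)
    (hf : ∀ n : ℕ, 0 < f ((n + 1 : ℕ) : ℝ)) (hmono : Monotone fun n : ℕ => f n)
    (hunb : ∀ y, ∃ n : ℕ, y ≤ f n) (s : QState) :
    ∫⁻ p, durFun lam f p.1 ∂occ lam G f s ≠ ∞ ∧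
      Tendsto (fun m => tabooLaw lam G f s m univ) atTop (𝓝 0) := by
  have hβ : 0 ≤ ∫ x, x ∂G := integral_nonneg_of_ae hG
  obtain ⟨c, hc0, hca, hc⟩ := exists_slopes (f := fun n : ℕ => f n) hlam hβ hrho
    (by simpa using hf 0) hmono hunb
  set c' : ℕ → ℝ≥0∞ := fun n => ENNReal.ofReal (c n) with hc'
  have hb : ∫⁻ b, ENNReal.ofReal b ∂G = ENNReal.ofReal (∫ x, x ∂G) :=
    (ofReal_integral_eq_lintegral_ofReal hGi hG).symm
  have hca' : Antitone c' := fun a b hab => ENNReal.ofReal_le_ofReal (hca hab)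
  have hdrift := lyap_drift (G := G) hlam hf hca' (by
    intro n
    have h1 := hc n
    have h2 := hc0 (n + 1)
    have h3 := hc0 (n + 2)
    have h4 := (hf n).le
    simp only [hc', hb]
    rw [← ENNReal.ofReal_one, ← ENNReal.ofReal_mul hlam.le, ← ENNReal.ofReal_mul hlam.le,
      ← ENNReal.ofReal_add (by positivity) (by positivity),
      ← ENNReal.ofReal_add (by positivity) (by positivity), ← ENNReal.ofReal_mul (by positivity),
      ← ENNReal.ofReal_mul (by positivity), ← ENNReal.ofReal_add (by positivity) (by positivity),
      ← ENNReal.ofReal_mul (by positivity)]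
    exact ENNReal.ofReal_le_ofReal h1)
  have hfin : ∀ x, lyap lam c' x ≠ ∞ := by
    intro x
    rcases x with n | ⟨n, r⟩
    · simp only [lyap, QState.fold_vacation]
      exact ENNReal.sum_ne_top.2 fun k _ => ENNReal.ofReal_ne_top
    · simp only [lyap, QState.fold_service]
      refine ENNReal.add_ne_top.2 ⟨ENNReal.mul_ne_top ENNReal.ofReal_ne_top
        (ENNReal.add_ne_top.2 ⟨ENNReal.one_ne_top, ENNReal.mul_ne_top ENNReal.ofReal_ne_top
          ENNReal.ofReal_ne_top⟩), ENNReal.sum_ne_top.2 fun k _ => ENNReal.ofReal_ne_top⟩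
  have hT : ∫⁻ p, durFun lam f p.1 ∂occ lam G f s ≠ ∞ := by
    have h := lintegral_occ_le (G := G) f hlam (k := fun _ => 0) (measurable_durFun lam f)
      (measurable_lyap lam c') (by simpa using hdrift) s
    rw [lintegral_zero, add_zero] at h
    exact ne_top_of_le_ne_top (hfin s) h
  refine ⟨hT, ?_⟩
  -- The expected number of busy events is a convergent series whose terms are the surviving masses;
  -- these therefore tend to 0.
  have h := lintegral_occ_le (G := G) f hlam (g := fun _ => 1)
    (k := fun x => 3 * ENNReal.ofReal lam * durFun lam f x) measurable_const
    measurable_workCount (workCount_drift hlam hf) s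
  have hdm := measurable_durFun lam f
  rw [lintegral_const_mul _ (by fun_prop), lintegral_occ] at h
  have hw : workCount s ≠ ∞ := by
    rcases s with n | ⟨n, r⟩
    · simp only [workCount, QState.fold_vacation]
      exact ENNReal.mul_ne_top (by simp) (by simp)
    · simp only [workCount, QState.fold_service]
      exact ENNReal.add_ne_top.2 ⟨ENNReal.mul_ne_top (by simp) (by simp), by simp⟩
  have h2 := ne_top_of_le_ne_top (ENNReal.add_ne_top.2 ⟨hw, ENNReal.mul_ne_top
    (ENNReal.mul_ne_top (by simp) ENNReal.ofReal_ne_top) hT⟩) h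
  have h3 := ENNReal.tendsto_atTop_zero_of_tsum_ne_top h2
  rw [← tendsto_add_atTop_iff_nat 1]
  refine h3.congr fun m => ?_
  rw [tabooLaw_succ_univ f hlam]
  simp

end

/-! ### Conservation laws over a busy cycle -/

/-- Fatou's lemma, with a finite constant that may be subtracted and added back. It carries lower
bounds from truncated test functions to the limit. -/
theorem add_lintegral_le_of_tendsto {α : Type*} [MeasurableSpace α] {μ : Measure α}
    {k : ℕ → α → ℝ≥0∞} {k' : α → ℝ≥0∞} (hk : ∀ n, Measurable (k n))
    (h : ∀ x, Tendsto (fun n => k n x) atTop (𝓝 (k' x))) {c B : ℝ≥0∞} (hc : c ≠ ∞)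
    (hB : ∀ᶠ n in atTop, c + ∫⁻ x, k n x ∂μ ≤ B) : c + ∫⁻ x, k' x ∂μ ≤ B := by
  have h1 : ∫⁻ x, k' x ∂μ ≤ liminf (fun n => ∫⁻ x, k n x ∂μ) atTop := by
    calc ∫⁻ x, k' x ∂μ = ∫⁻ x, liminf (fun n => k n x) atTop ∂μ :=
          lintegral_congr fun x => (h x).liminf_eq.symm
      _ ≤ _ := lintegral_liminf_le hk
  have h2 : liminf (fun n => ∫⁻ x, k n x ∂μ) atTop ≤ B - c := by
    refine (liminf_le_liminf (v := fun _ => B - c) ?_).trans (liminf_const _).le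
    filter_upwards [hB] with n hn
    exact ENNReal.le_sub_of_add_le_left hc hn
  obtain ⟨n, hn⟩ := hB.exists
  calc c + ∫⁻ x, k' x ∂μ ≤ c + (B - c) := by gcongr; exact h1.trans h2
    _ = B := add_tsub_cancel_of_le (le_self_add.trans hn)

/-- Rate of activations. -/
noncomputable def actFun (lam : ℝ) (f : ℝ → ℝ) : QState → ℝ≥0∞ :=
  QState.fold (fun n => ENNReal.ofReal (f n) * vacDur lam f n) (fun _ _ => 0)

/-- Time spent in service. -/
noncomputable def servFun (lam : ℝ) : QState → ℝ≥0∞ :=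
  QState.fold (fun _ => 0) (fun _ r => servDur lam r)

/-- Integral of the residual service time. -/
noncomputable def areaFun (lam : ℝ) : QState → ℝ≥0∞ :=
  QState.fold (fun _ => 0) (fun _ r => servArea lam r)

/-- Waiting customers, integrated over vacations. -/
noncomputable def vacQueue (lam : ℝ) (f : ℝ → ℝ) : QState → ℝ≥0∞ :=
  QState.fold (fun n => n * vacDur lam f n) (fun _ _ => 0)

/-- Waiting customers, integrated over services. -/
noncomputable def servQueue (lam : ℝ) : QState → ℝ≥0∞ :=
  QState.fold (fun _ => 0) (fun n r => n * servDur lam r)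

theorem measurable_actFun (lam : ℝ) (f : ℝ → ℝ) : Measurable (actFun lam f) :=
  QState.measurable_fold fun _ => measurable_const

theorem measurable_areaFun (lam : ℝ) : Measurable (areaFun lam) :=
  QState.measurable_fold fun _ => measurable_servArea lam

theorem measurable_vacQueue (lam : ℝ) (f : ℝ → ℝ) : Measurable (vacQueue lam f) :=
  QState.measurable_fold fun _ => measurable_const

theorem measurable_servQueue (lam : ℝ) : Measurable (servQueue lam) :=
  QState.measurable_fold fun _ => (measurable_servDur lam).const_mul _

/-- Integral over the time from one customer on vacation until the system is empty. -/
noncomputable def occInt (lam : ℝ) (G : Measure ℝ) (f : ℝ → ℝ) (g : QState → ℝ≥0∞) : ℝ≥0∞ :=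
  ∫⁻ p, g p.1 ∂occ lam G f (.vacation 1)

/-- Mean service time. -/
noncomputable def meanServ (G : Measure ℝ) : ℝ≥0∞ := ∫⁻ b, ENNReal.ofReal b ∂G

/-- Half the second moment of the service time. -/
noncomputable def halfSecond (G : Measure ℝ) : ℝ≥0∞ := ∫⁻ b, halfSq b ∂G

/-- Truncation of a function at `K`. -/
noncomputable def trunc (q : ℝ → ℝ≥0∞) (K : ℕ) (r : ℝ) : ℝ≥0∞ := if r ≤ K then q r else 0

theorem measurable_trunc {q : ℝ → ℝ≥0∞} (hq : Measurable q) (K : ℕ) : Measurable (trunc q K) :=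
  Measurable.ite measurableSet_Iic hq measurable_const

theorem tendsto_lintegral_trunc (G : Measure ℝ) {q : ℝ → ℝ≥0∞} (hq : Measurable q) :
    Tendsto (fun K => ∫⁻ b, trunc q K b ∂G) atTop (𝓝 (∫⁻ b, q b ∂G)) := by
  refine lintegral_tendsto_of_tendsto_of_monotone
    (fun K => (measurable_trunc hq K).aemeasurable) ?_ ?_
  · filter_upwards with b K K' hK
    simp only [trunc]
    split_ifs with h1 h2
    · exact le_rfl
    · exact absurd (h1.trans (Nat.cast_le.2 hK)) h2
    · exact zero_le
    · exact le_rfl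
  · filter_upwards with b
    obtain ⟨N, hN⟩ := exists_nat_ge b
    refine tendsto_const_nhds.congr' ?_
    filter_upwards [eventually_ge_atTop N] with K hK
    rw [trunc, if_pos (hN.trans (Nat.cast_le.2 hK))]

theorem tendsto_ite_lt (n : ℕ) (a : ℝ≥0∞) :
    Tendsto (fun K : ℕ => if n < K then a else 0) atTop (𝓝 a) := by
  refine tendsto_const_nhds.congr' ?_
  filter_upwards [eventually_gt_atTop n] with K hK
  rw [if_pos hK]

section

variable {lam : ℝ} {G : Measure ℝ} {f : ℝ → ℝ}

/-- Balance of the number of waiting customers: it starts at 1, rises at rate λ and drops by one at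
each activation. -/
theorem occInt_act_le [IsProbabilityMeasure G] (hlam : 0 < lam)
    (hf : ∀ n : ℕ, 0 < f ((n + 1 : ℕ) : ℝ)) :
    occInt lam G f (actFun lam f) ≤ 1 + ENNReal.ofReal lam * occInt lam G f (durFun lam f) := by
  set L := ENNReal.ofReal lam with hL
  have hdm := measurable_durFun lam f
  have hm : Measurable (QState.fold (fun n => (n : ℝ≥0∞)) (fun n _ => n)) :=
    QState.measurable_fold fun _ => measurable_const
  have h := lintegral_occ_le (G := G) f hlam (k := fun x => L * durFun lam f x)
    (measurable_actFun lam f) hm ?_ (.vacation 1)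
  · rw [lintegral_const_mul _ (by fun_prop)] at h
    simpa [occInt] using h
  intro x hx
  rcases x with n | ⟨n, r⟩
  · rcases n with _ | n
    · exact absurd rfl hx
    rw [expect_vacation' hlam (hf n) hm]
    have hD := vacDur_add (f := f) hlam (n := n + 1) (hf n).le
    simp only [actFun, durFun, QState.fold_vacation, QState.fold_service, ← hL, lintegral_const,
      measure_univ, mul_one] at hD ⊢
    set F := ENNReal.ofReal (f ((n + 1 : ℕ) : ℝ))
    set D := vacDur lam f (n + 1)
    push_cast
    refine le_of_eq ?_
    calc _ = (L * D + F * D) * (n + 1) + L * D := by ring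
      _ = _ := by rw [hD]; ring
  · have h1 := expect_service_le (G := G) (f := f) hlam n r hm
      (A := n + 1) (B := 0) (C := 0) (by intro x hx; simp)
    have h3 := mul_servDur_add hlam r
    simp only [actFun, durFun, QState.fold_vacation, QState.fold_service, ← hL, zero_mul,
      add_zero, zero_add] at h1 h3 ⊢
    refine h1.trans (le_of_eq ?_)
    calc _ = (L * servDur lam r + expMeasure lam (Ici r)) * n + L * servDur lam r := by ring
      _ = _ := by rw [h3]; ring

/-- The same balance for min(n, K), which is bounded; arrivals are credited only below the cap, and
K tends to infinity. -/
theorem le_occInt_act [IsProbabilityMeasure G] (hlam : 0 < lam)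
    (hf : ∀ n : ℕ, 0 < f ((n + 1 : ℕ) : ℝ))
    (hs : Tendsto (fun m => tabooLaw lam G f (.vacation 1) m univ) atTop (𝓝 0)) :
    1 + ENNReal.ofReal lam * occInt lam G f (durFun lam f) ≤ occInt lam G f (actFun lam f) := by
  set L := ENNReal.ofReal lam with hL
  have hdm := measurable_durFun lam f
  set k : ℕ → QState → ℝ≥0∞ := fun K => QState.fold
    (fun n => if n < K then L * vacDur lam f n else 0)
    (fun n r => if n < K then L * servDur lam r else 0) with hk
  have hkm : ∀ K, Measurable (k K) := fun K => QState.measurable_fold fun n => by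
    split_ifs
    · exact (measurable_servDur lam).const_mul _
    · exact measurable_const
  rw [occInt, ← lintegral_const_mul _ (by fun_prop)]
  refine add_lintegral_le_of_tendsto (k := fun K p => k K p.1)
    (fun K => by have := hkm K; fun_prop) ?_ ENNReal.one_ne_top ?_
  · rintro ⟨n | ⟨n, r⟩, t⟩ <;> exact tendsto_ite_lt n _
  -- With `K ≥ 1` the capped count still starts at 1.
  filter_upwards [eventually_ge_atTop 1] with K hK
  set φ : QState → ℝ≥0∞ := QState.fold (fun n => ((min n K : ℕ) : ℝ≥0∞))
    (fun n _ => ((min n K : ℕ) : ℝ≥0∞)) with hφ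
  have hm : Measurable φ := QState.measurable_fold fun _ => measurable_const
  have h1 : φ (.vacation 1) = 1 := by simp [hφ, hK]
  rw [← h1]
  refine le_lintegral_occ (G := G) f hlam (measurable_actFun lam f) hm ?_ (by simp [hφ])
    (C := K) (by simp) ?_ _ hs
  · intro x hx
    rcases x with n | ⟨n, r⟩
    · rcases n with _ | n
      · exact absurd rfl hx
      rw [expect_vacation' hlam (hf n) hm]
      have hD := vacDur_add (f := f) hlam (n := n + 1) (hf n).le
      simp only [hk, hφ, actFun, QState.fold_vacation, QState.fold_service, ← hL,
        lintegral_const, measure_univ, mul_one] at hD ⊢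
      set F := ENNReal.ofReal (f ((n + 1 : ℕ) : ℝ))
      set D := vacDur lam f (n + 1)
      rcases lt_or_ge (n + 1) K with h | h
      · rw [if_pos h, min_eq_left (by omega), min_eq_left (by omega), min_eq_left (by omega)]
        push_cast
        refine le_of_eq ?_
        symm
        calc _ = (L * D + F * D) * (n + 1) + L * D := by ring
          _ = _ := by rw [hD]; ring
      -- At the cap arrivals change nothing and an activation lowers the capped count by at most
      -- one, so the inequality survives.
      · rw [if_neg (by omega), min_eq_right h, min_eq_right (by omega), add_zero]
        have : (K : ℝ≥0∞) ≤ 1 + (min n K : ℕ) := by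
          norm_cast; omega
        calc (K : ℝ≥0∞) = L * D * K + F * D * K := by rw [← add_mul, hD, one_mul]
          _ ≤ L * D * K + F * D * (1 + (min n K : ℕ)) := by gcongr
          _ = _ := by ring
    · have h1 := le_expect_service (G := G) (f := f) hlam n r hm
        (A := (min (n + 1) K : ℕ)) (B := 0) (C := 0) (by intro x hx; simp [hφ])
      have h3 := mul_servDur_add hlam r
      simp only [hk, hφ, actFun, QState.fold_vacation, QState.fold_service, ← hL, zero_mul,
        add_zero, zero_add] at h1 h3 ⊢
      refine le_trans (le_of_eq ?_) h1
      rcases lt_or_ge n K with h | h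
      · rw [if_pos h, min_eq_left (by omega), min_eq_left (by omega)]
        push_cast
        symm
        calc _ = (L * servDur lam r + expMeasure lam (Ici r)) * n + L * servDur lam r := by ring
          _ = _ := by rw [h3]; ring
      · rw [if_neg (by omega), min_eq_right (by omega), min_eq_right (by omega), add_zero]
        rw [mul_comm (K : ℝ≥0∞), ← add_mul, h3, one_mul]
  · intro x
    rcases x with n | ⟨n, r⟩ <;> simp [hφ]

/-! ### Integrals of the residual service time -/

/-- Upper bound for the integral over the services of a function of the residual service time. -/
theorem occInt_resid_le [IsProbabilityMeasure G] (hlam : 0 < lam)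
    (hf : ∀ n : ℕ, 0 < f ((n + 1 : ℕ) : ℝ)) {q w : ℝ → ℝ≥0∞} (hq : Measurable q)
    (hw : Measurable w)
    (h : ∀ r, w r + expect lam G f (QState.fold (fun _ => 0) (fun _ r => q r)) (.service 0 r) ≤ q r) :
    occInt lam G f (QState.fold (fun _ => 0) (fun _ r => w r)) ≤
      (∫⁻ b, q b ∂G) * occInt lam G f (actFun lam f) := by
  have ham := measurable_actFun lam f
  have hm : Measurable (QState.fold (fun _ => 0) (fun _ r => q r)) :=
    QState.measurable_fold fun _ => hq
  -- The test function vanishes on vacations, so each activation injects the mean of `q` under `G`,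
  -- whatever the number of customers.
  have h := lintegral_occ_le (G := G) f hlam
    (k := fun x => (∫⁻ b, q b ∂G) * actFun lam f x)
    (QState.measurable_fold (v := fun _ => 0) fun _ => hw) hm ?_ (.vacation 1)
  · rw [lintegral_const_mul _ (by fun_prop)] at h
    simpa [occInt] using h
  intro x hx
  rcases x with n | ⟨n, r⟩
  · rcases n with _ | n
    · exact absurd rfl hx
    rw [expect_vacation' hlam (hf n) hm]
    simp only [actFun, QState.fold_vacation, QState.fold_service, mul_zero, zero_add]
    rw [mul_comm]
  · have h2 := h r
    rw [expect_service hlam G f _ _ hm] at h2 ⊢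
    simpa [actFun] using h2

/-- Lower bound for the integral over the services of a function of the residual service time. -/
theorem le_occInt_resid [IsProbabilityMeasure G] (hlam : 0 < lam)
    (hf : ∀ n : ℕ, 0 < f ((n + 1 : ℕ) : ℝ)) {q w : ℝ → ℝ≥0∞} (hq : Measurable q)
    (hw : Measurable w) (hmono : Monotone q) (hfin : ∀ r, q r ≠ ∞)
    (hs : Tendsto (fun m => tabooLaw lam G f (.vacation 1) m univ) atTop (𝓝 0))
    (hact : occInt lam G f (actFun lam f) ≠ ∞)
    (h : ∀ r, q r ≤ w r + expect lam G f (QState.fold (fun _ => 0) (fun _ r => q r)) (.service 0 r)) :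
    (∫⁻ b, q b ∂G) * occInt lam G f (actFun lam f) ≤
      occInt lam G f (QState.fold (fun _ => 0) (fun _ r => w r)) := by
  have ham := measurable_actFun lam f
  -- Cutting `q` to zero above `K` makes it bounded; finiteness of the number of activations lets
  -- the limit pass through the product.
  refine le_of_tendsto' (ENNReal.Tendsto.mul_const (tendsto_lintegral_trunc G hq) (Or.inr hact))
    fun K => ?_
  have hm1 : Measurable (QState.fold (fun _ => 0) (fun _ r => q r)) :=
    QState.measurable_fold fun _ => hq
  have hm : Measurable (QState.fold (fun _ => 0) (fun _ r => trunc q K r)) :=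
    QState.measurable_fold fun _ => measurable_trunc hq K
  have h := le_lintegral_occ (G := G) f hlam
    (k := fun x => (∫⁻ b, trunc q K b ∂G) * actFun lam f x)
    (QState.measurable_fold (v := fun _ => 0) fun _ => hw) hm ?_ (by simp) (C := q K) (hfin _) ?_
    (.vacation 1) hs
  · rw [lintegral_const_mul _ (by fun_prop)] at h
    simpa [occInt] using h
  · intro x hx
    rcases x with n | ⟨n, r⟩
    · rcases n with _ | n
      · exact absurd rfl hx
      rw [expect_vacation' hlam (hf n) hm]
      simp only [actFun, QState.fold_vacation, QState.fold_service, mul_zero, zero_add]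
      rw [mul_comm]
    -- Residual times only decrease during a service: starting below `K` the cutoff is never felt,
    -- and above `K` the left side is zero.
    · by_cases hr : r ≤ K
      · have h2 := h r
        rw [expect_service hlam G f _ _ hm]
        rw [expect_service hlam G f _ _ hm1] at h2
        simp only [actFun, QState.fold_vacation, QState.fold_service, mul_zero, add_zero] at h2 ⊢
        rw [trunc, if_pos hr]
        refine h2.trans ?_
        gcongr 1
        refine lintegral_mono_ae ?_
        filter_upwards [ae_restrict_Iio_expMeasure hlam r] with a ha
        rw [trunc, if_pos (ha.2.trans hr)]
      · simp [actFun, trunc, hr]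
  · intro x
    rcases x with n | ⟨n, r⟩
    · simp
    · simp only [QState.fold_service, trunc]
      split_ifs with hr
      · exact hmono hr
      · exact zero_le

/-- Work enters at mean β per activation and is removed at unit rate during services. -/
theorem occInt_serv_eq [IsProbabilityMeasure G] (hlam : 0 < lam)
    (hf : ∀ n : ℕ, 0 < f ((n + 1 : ℕ) : ℝ))
    (hs : Tendsto (fun m => tabooLaw lam G f (.vacation 1) m univ) atTop (𝓝 0))
    (hact : occInt lam G f (actFun lam f) ≠ ∞) :
    occInt lam G f (servFun lam) = meanServ G * occInt lam G f (actFun lam f) := by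
  have hq : Measurable fun r : ℝ => ENNReal.ofReal r := by fun_prop
  have hm : Measurable (QState.fold (fun _ => 0) (fun _ r => ENNReal.ofReal r)) :=
    QState.measurable_fold fun _ => hq
  have key : ∀ r, servDur lam r + expect lam G f
      (QState.fold (fun _ => 0) (fun _ r => ENNReal.ofReal r)) (.service 0 r) =
      ENNReal.ofReal r := by
    intro r
    rw [← mul_servArea_add_servDur hlam r, add_comm]
    congr 1
    have h1 := expect_service_le (G := G) (f := f) hlam 0 r hm (A := 0) (B := 1) (C := 0)
      (by intro x hx; simp)
    have h2 := le_expect_service (G := G) (f := f) hlam 0 r hm (A := 0) (B := 1) (C := 0)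
      (by intro x hx; simp)
    simp only [zero_mul, one_mul, QState.fold_vacation, mul_zero, add_zero, zero_add] at h1 h2
    exact le_antisymm h1 h2
  exact le_antisymm (occInt_resid_le hlam hf hq (measurable_servDur lam) fun r => (key r).le)
    (le_occInt_resid hlam hf hq (measurable_servDur lam) (fun a b => ENNReal.ofReal_le_ofReal)
      (fun r => ENNReal.ofReal_ne_top) hs hact fun r => (key r).ge)

/-- The balance of r²/2, whose rate of decrease is r. -/
theorem occInt_area_eq [IsProbabilityMeasure G] (hlam : 0 < lam)
    (hf : ∀ n : ℕ, 0 < f ((n + 1 : ℕ) : ℝ))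
    (hs : Tendsto (fun m => tabooLaw lam G f (.vacation 1) m univ) atTop (𝓝 0))
    (hact : occInt lam G f (actFun lam f) ≠ ∞) :
    occInt lam G f (areaFun lam) = halfSecond G * occInt lam G f (actFun lam f) := by
  have hm : Measurable (QState.fold (fun _ => 0) (fun _ r => halfSq r)) :=
    QState.measurable_fold fun _ => measurable_halfSq
  have key : ∀ r, servArea lam r + expect lam G f
      (QState.fold (fun _ => 0) (fun _ r => halfSq r)) (.service 0 r) = halfSq r := by
    intro r
    rw [← half_sq_split hlam r, add_comm]
    congr 1
    rw [expect_service hlam G f _ _ hm]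
    simp
  have hmono : Monotone halfSq := by
    intro a b hab
    refine ENNReal.ofReal_le_ofReal ?_
    have : max a 0 ≤ max b 0 := max_le_max_right 0 hab
    have : 0 ≤ max a 0 := le_max_right _ _
    gcongr
  exact le_antisymm
    (occInt_resid_le hlam hf measurable_halfSq (measurable_servArea lam) fun r => (key r).le)
    (le_occInt_resid hlam hf measurable_halfSq (measurable_servArea lam) hmono
      (fun r => ENNReal.ofReal_ne_top) hs hact fun r => (key r).ge)

/-! ### Waiting customers during services -/

theorem choose_succ_two_cast (n : ℕ) :
    (((n + 1).choose 2 : ℕ) : ℝ≥0∞) = n.choose 2 + n := by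
  rw [Nat.choose_succ_succ' n 1]; push_cast; rw [Nat.choose_one_right]; ring

/-- The test function β·C(n,2), plus n·r during services, is built so that an activation is neutral
on average: passing from n+1 to n waiting customers loses βn and gains nE[B]. Arrivals contribute at
rate λ(βn + r), with the r term only in service, and the passage of service time removes n. `κ` is
1-ρ in a form free of subtraction. -/
theorem occInt_servQueue_le [IsProbabilityMeasure G] (hlam : 0 < lam)
    (hf : ∀ n : ℕ, 0 < f ((n + 1 : ℕ) : ℝ)) {κ : ℝ≥0∞}
    (hκ : κ + ENNReal.ofReal lam * meanServ G = 1) :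
    κ * occInt lam G f (servQueue lam) ≤
      ENNReal.ofReal lam * meanServ G * occInt lam G f (vacQueue lam f) +
        ENNReal.ofReal lam * occInt lam G f (areaFun lam) := by
  set L := ENNReal.ofReal lam with hL
  set β := meanServ G with hβ
  have hsm := measurable_servQueue lam
  have hvm := measurable_vacQueue lam f
  have ham := measurable_areaFun lam
  have hm : Measurable (QState.fold (fun n => β * (n.choose 2 : ℕ))
      (fun n r => β * (n.choose 2 : ℕ) + n * ENNReal.ofReal r)) :=
    QState.measurable_fold fun _ => by fun_prop
  have h := lintegral_occ_le (G := G) f hlam (g := fun x => κ * servQueue lam x)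
    (k := fun x => L * β * vacQueue lam f x + L * areaFun lam x) (by fun_prop) hm ?_ (.vacation 1)
  · rw [lintegral_add_left (by fun_prop), lintegral_const_mul _ (by fun_prop),
      lintegral_const_mul _ (by fun_prop), lintegral_const_mul _ (by fun_prop)] at h
    simpa [occInt] using h
  intro x hx
  rcases x with n | ⟨n, r⟩
  · rcases n with _ | n
    · exact absurd rfl hx
    rw [expect_vacation' hlam (hf n) hm]
    have hD := vacDur_add (f := f) hlam (n := n + 1) (hf n).le
    simp only [servQueue, vacQueue, areaFun, QState.fold_vacation, QState.fold_service,
      ← hL] at hD ⊢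
    rw [lintegral_add_left measurable_const, lintegral_const, lintegral_const_mul _ (by fun_prop),
      show ∫⁻ b, ENNReal.ofReal b ∂G = β from rfl]
    simp only [measure_univ, mul_one]
    set F := ENNReal.ofReal (f ((n + 1 : ℕ) : ℝ))
    set D := vacDur lam f (n + 1)
    rw [choose_succ_two_cast (n + 1), choose_succ_two_cast n]
    push_cast
    refine le_of_eq ?_
    calc _ = (L * D + F * D) * (β * (n.choose 2 + n)) + L * β * ((n + 1) * D) := by ring
      _ = _ := by rw [hD]; ring
  · have h1 := expect_service_le (G := G) (f := f) hlam n r hm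
      (A := β * ((n + 1).choose 2 : ℕ)) (B := n + 1) (C := 0) (by intro x hx; simp)
    have h2 := mul_servArea_add_servDur hlam r
    have h3 := mul_servDur_add hlam r
    simp only [servQueue, vacQueue, areaFun, QState.fold_vacation, QState.fold_service, ← hL,
      zero_mul, mul_zero, add_zero, zero_add] at h1 h2 h3 ⊢
    rw [← h2]
    rw [choose_succ_two_cast n] at h1
    set δ := servDur lam r
    set J := servArea lam r
    set pe := expMeasure lam (Ici r)
    calc _ ≤ κ * (n * δ) + (β * (n.choose 2 + n) * (L * δ) + (n + 1) * (L * J) +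
          pe * (β * n.choose 2)) := by gcongr
      _ = (L * δ + pe) * (β * n.choose 2) + (κ + L * β) * n * δ + n * (L * J) + L * J := by ring
      _ = _ := by rw [h3, hκ]; ring

/-- The same balance with n capped and r cut off at K. Since the value in question may be infinite,
it stands on both sides instead of being subtracted. -/
theorem le_occInt_servQueue [IsProbabilityMeasure G] (hlam : 0 < lam)
    (hf : ∀ n : ℕ, 0 < f ((n + 1 : ℕ) : ℝ))
    (hs : Tendsto (fun m => tabooLaw lam G f (.vacation 1) m univ) atTop (𝓝 0)) :
    ENNReal.ofReal lam * meanServ G *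
        (occInt lam G f (vacQueue lam f) + occInt lam G f (servQueue lam)) +
        ENNReal.ofReal lam * occInt lam G f (areaFun lam) ≤ occInt lam G f (servQueue lam) := by
  set L := ENNReal.ofReal lam with hL
  set β := meanServ G with hβ
  have hsm := measurable_servQueue lam
  have hvm := measurable_vacQueue lam f
  have ham := measurable_areaFun lam
  have hq : Measurable fun r : ℝ => ENNReal.ofReal r := by fun_prop
  -- The mean must be truncated together with the residual time, so that activations below the cap
  -- remain exactly neutral.
  set bt : ℕ → ℝ≥0∞ := fun K => ∫⁻ b, trunc ENNReal.ofReal K b ∂G with hbt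
  have hbtlim : Tendsto bt atTop (𝓝 β) := tendsto_lintegral_trunc G hq
  have hbtfin : ∀ K, bt K ≠ ∞ := by
    intro K
    refine ne_top_of_le_ne_top (ENNReal.ofReal_ne_top (r := (K : ℝ))) ?_
    calc bt K ≤ ∫⁻ b, ENNReal.ofReal K ∂G := lintegral_mono fun b => by
          simp only [trunc]
          split_ifs with h
          · exact ENNReal.ofReal_le_ofReal h
          · exact zero_le
      _ = _ := by simp
  set k : ℕ → QState → ℝ≥0∞ := fun K => QState.fold
    (fun n => if n < K then L * bt K * (n * vacDur lam f n) else 0)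
    (fun n r => (if n < K then L * bt K * (n * servDur lam r) else 0) +
      if n < K then trunc (fun r => L * servArea lam r) K r else 0) with hk
  have hkm : ∀ K, Measurable (k K) := fun K => QState.measurable_fold fun n => by
    refine Measurable.add ?_ ?_
    · split_ifs
      · exact ((measurable_servDur lam).const_mul _).const_mul _
      · exact measurable_const
    · split_ifs
      · exact measurable_trunc ((measurable_servArea lam).const_mul _) K
      · exact measurable_const
  have hgoal : L * β * (occInt lam G f (vacQueue lam f) + occInt lam G f (servQueue lam)) +
      L * occInt lam G f (areaFun lam) = 0 + ∫⁻ p, (L * β * (vacQueue lam f p.1 +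
        servQueue lam p.1) + L * areaFun lam p.1) ∂occ lam G f (.vacation 1) := by
    rw [lintegral_add_left (by fun_prop), lintegral_const_mul _ (by fun_prop),
      lintegral_const_mul _ (by fun_prop), lintegral_add_left (by fun_prop), zero_add]
    rfl
  rw [hgoal]
  refine add_lintegral_le_of_tendsto (k := fun K p => k K p.1)
    (fun K => by have := hkm K; fun_prop) ?_ ENNReal.zero_ne_top (Eventually.of_forall ?_)
  · have hlim : ∀ (n : ℕ) (a : ℝ≥0∞), a ≠ ∞ →
        Tendsto (fun K => if n < K then L * bt K * a else 0) atTop (𝓝 (L * β * a)) := by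
      intro n a ha
      have h1 : Tendsto (fun K => L * bt K * a) atTop (𝓝 (L * β * a)) :=
        ENNReal.Tendsto.mul_const (ENNReal.Tendsto.const_mul hbtlim (Or.inr ENNReal.ofReal_ne_top))
          (Or.inr ha)
      refine h1.congr' ?_
      filter_upwards [eventually_gt_atTop n] with K hK
      rw [if_pos hK]
    rintro ⟨n | ⟨n, r⟩, t⟩
    · simp only [hk, vacQueue, servQueue, areaFun, QState.fold_vacation, add_zero, mul_zero]
      exact hlim n _ (ENNReal.mul_ne_top (by simp) ENNReal.ofReal_ne_top)
    · simp only [hk, vacQueue, servQueue, areaFun, QState.fold_service, zero_add]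
      refine (hlim n _ (ENNReal.mul_ne_top (by simp) ENNReal.ofReal_ne_top)).add ?_
      obtain ⟨N, hN⟩ := exists_nat_ge r
      refine tendsto_const_nhds.congr' ?_
      filter_upwards [eventually_gt_atTop n, eventually_ge_atTop N] with K hK hK2
      rw [if_pos hK, trunc, if_pos (hN.trans (Nat.cast_le.2 hK2))]
  intro K
  set b := bt K with hb
  set φ : QState → ℝ≥0∞ := QState.fold (fun n => b * ((min n K).choose 2 : ℕ))
    (fun n r => b * ((min n K).choose 2 : ℕ) + (min n K : ℕ) * trunc ENNReal.ofReal K r) with hφ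
  have htm := measurable_trunc hq K
  have hm : Measurable φ := QState.measurable_fold fun _ => by fun_prop
  have h1 : φ (.vacation 1) = 0 := by
    simp only [hφ, QState.fold_vacation]
    rw [Nat.choose_eq_zero_of_lt (lt_of_le_of_lt (min_le_left 1 K) (by norm_num))]
    simp
  rw [← h1]
  refine le_lintegral_occ (G := G) f hlam hsm hm ?_ (by simp [hφ])
    (C := b * (K.choose 2 : ℕ) + K * ENNReal.ofReal K) (ENNReal.add_ne_top.2
      ⟨ENNReal.mul_ne_top (hbtfin K) (by simp), ENNReal.mul_ne_top (by simp) (by simp)⟩) ?_ _ hs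
  · intro x hx
    rcases x with n | ⟨n, r⟩
    · rcases n with _ | n
      · exact absurd rfl hx
      rw [expect_vacation' hlam (hf n) hm]
      have hD := vacDur_add (f := f) hlam (n := n + 1) (hf n).le
      simp only [hk, hφ, servQueue, QState.fold_vacation, QState.fold_service, ← hL,
        zero_add] at hD ⊢
      rw [lintegral_add_left measurable_const, lintegral_const_mul _ htm]
      simp only [lintegral_const, measure_univ, mul_one]
      rw [show ∫⁻ b, trunc ENNReal.ofReal K b ∂G = b from rfl]
      set F := ENNReal.ofReal (f ((n + 1 : ℕ) : ℝ))
      set D := vacDur lam f (n + 1)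
      rcases lt_or_ge (n + 1) K with h | h
      · rw [if_pos h, min_eq_left (by omega), min_eq_left (by omega), min_eq_left (by omega),
          choose_succ_two_cast (n + 1), choose_succ_two_cast n]
        push_cast
        refine le_of_eq ?_
        symm
        calc _ = (L * D + F * D) * (b * (n.choose 2 + n)) + L * b * ((n + 1) * D) := by ring
          _ = _ := by rw [hD]; ring
      · rw [if_neg (by omega), min_eq_right h, min_eq_right (by omega), add_zero]
        -- By Pascal's rule the right side is C(min(n,K)+1, 2), and min(n,K)+1 ≥ K here.
        have h5 : ((K.choose 2 : ℕ) : ℝ≥0∞) ≤ ((min n K).choose 2 : ℕ) + (min n K : ℕ) := by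
          rw [← choose_succ_two_cast]
          exact Nat.cast_le.2 (Nat.choose_le_choose 2 (by omega))
        calc b * (K.choose 2 : ℕ) = L * D * (b * (K.choose 2 : ℕ)) + F * D * (b * (K.choose 2 : ℕ)) := by
              rw [← add_mul, hD, one_mul]
          _ ≤ L * D * (b * (K.choose 2 : ℕ)) +
              F * D * (b * (((min n K).choose 2 : ℕ) + (min n K : ℕ))) := by gcongr
          _ = _ := by ring
    · have h1 := le_expect_service (G := G) (f := f) hlam n r hm
        (A := b * ((min (n + 1) K).choose 2 : ℕ))
        (B := if r ≤ K then (min (n + 1) K : ℕ) else 0) (C := 0) (by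
          intro x hx
          simp only [hφ, QState.fold_service, zero_mul, add_zero]
          gcongr _ + ?_
          by_cases hr : r ≤ K
          · rw [if_pos hr, trunc, if_pos (hx.2.trans hr)]
          · rw [if_neg hr]; simp)
      have h2 := mul_servArea_add_servDur hlam r
      have h3 := mul_servDur_add hlam r
      simp only [hk, hφ, servQueue, QState.fold_vacation, QState.fold_service, ← hL, zero_mul,
        add_zero] at h1 h2 h3 ⊢
      refine le_trans ?_ (add_le_add_right h1 _)
      simp only [trunc]
      rw [← h2]
      set δ := servDur lam r
      set J := servArea lam r
      set pe := expMeasure lam (Ici r)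
      rcases lt_or_ge n K with h | h
      · rw [if_pos h, if_pos h, min_eq_left (by omega), min_eq_left (by omega),
          choose_succ_two_cast n]
        by_cases hr : r ≤ K
        · simp only [if_pos hr]
          push_cast
          refine le_of_eq ?_
          symm
          calc _ = (L * δ + pe) * (b * n.choose 2) + n * δ + n * (L * J) + L * J +
                L * b * (n * δ) := by ring
            _ = _ := by rw [h3]; ring
        · simp only [if_neg hr, mul_zero, add_zero, zero_mul]
          calc b * n.choose 2 + L * b * (n * δ)
              = (L * δ + pe) * (b * n.choose 2) + L * b * (n * δ) := by rw [h3, one_mul]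
            _ ≤ (L * δ + pe) * (b * n.choose 2) + L * b * (n * δ) + n * δ := le_self_add
            _ = _ := by ring
      · rw [if_neg (not_lt.2 h), if_neg (not_lt.2 h), min_eq_right (by omega), min_eq_right (by omega),
          add_zero, add_zero]
        -- Beyond the cap the test function decreases at rate at most K, while the true queue n is
        -- what is charged.
        have hnK : (K : ℝ≥0∞) ≤ n := Nat.cast_le.2 h
        by_cases hr : r ≤ K
        · simp only [if_pos hr]
          calc _ = (L * δ + pe) * (b * K.choose 2) + K * δ + K * (L * J) := by
                rw [h3]; ring
            _ ≤ (L * δ + pe) * (b * K.choose 2) + n * δ + K * (L * J) := by gcongr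
            _ = _ := by ring
        · simp only [if_neg hr, mul_zero, add_zero, zero_mul]
          calc b * K.choose 2 = (L * δ + pe) * (b * K.choose 2) := by rw [h3, one_mul]
            _ ≤ (L * δ + pe) * (b * K.choose 2) + n * δ := le_self_add
            _ = _ := by ring
  · intro x
    rcases x with n | ⟨n, r⟩
    · simp only [hφ, QState.fold_vacation]
      refine le_trans ?_ le_self_add
      gcongr
      exact min_le_right _ _
    · simp only [hφ, QState.fold_service]
      gcongr
      · exact min_le_right _ _
      · exact min_le_right _ _
      · simp only [trunc]
        split_ifs with hr
        · exact ENNReal.ofReal_le_ofReal hr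
        · exact zero_le

end

/-! ### A renewal theorem -/

theorem exists_seq_tendsto_limsup {U : ℝ → ℝ} (hU : ∀ t, |U t| ≤ 1) :
    ∃ t : ℕ → ℝ, Tendsto t atTop atTop ∧
      Tendsto (fun k => U (t k)) atTop (𝓝 (limsup U atTop)) := by
  have hb1 : IsBoundedUnder (· ≤ ·) atTop U :=
    isBoundedUnder_of ⟨1, fun t => (abs_le.1 (hU t)).2⟩
  have hb2 : IsBoundedUnder (· ≥ ·) atTop U :=
    isBoundedUnder_of ⟨-1, fun t => (abs_le.1 (hU t)).1⟩
  set α := limsup U atTop with hα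
  have key : ∀ k : ℕ, ∃ t : ℝ, (k : ℝ) ≤ t ∧ |U t - α| < 1 / ((k : ℝ) + 1) := by
    intro k
    have hpos : (0 : ℝ) < 1 / ((k : ℝ) + 1) := by positivity
    have h1 : ∃ᶠ t in atTop, α - 1 / ((k : ℝ) + 1) < U t :=
      frequently_lt_of_lt_limsup (hb2.isCoboundedUnder_le) (by linarith)
    have h2 : ∀ᶠ t in atTop, U t < α + 1 / ((k : ℝ) + 1) :=
      eventually_lt_of_limsup_lt (by linarith) hb1
    obtain ⟨t, ht1, ht2, ht3⟩ := (h1.and_eventually (h2.and (eventually_ge_atTop (k : ℝ)))).exists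
    exact ⟨t, ht3, abs_lt.2 ⟨by linarith, by linarith⟩⟩
  choose t ht1 ht2 using key
  refine ⟨t, tendsto_atTop_mono ht1 tendsto_natCast_atTop_atTop, ?_⟩
  rw [tendsto_iff_norm_sub_tendsto_zero]
  exact squeeze_zero (fun k => norm_nonneg _) (fun k => (ht2 k).le)
    tendsto_one_div_add_atTop_nhds_zero_nat

/-- If a bounded function is asymptotically equal to its average over a random shift with an
exponential component, then it is almost constant, equal to its upper limit, on long stretches. -/
theorem exists_seq_ae_tendsto_limsup {lam : ℝ} (hlam : 0 < lam) {F : Measure ℝ}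
    [IsProbabilityMeasure F] {U : ℝ → ℝ} (hUm : Measurable U) (hU : ∀ t, |U t| ≤ 1)
    (h : Tendsto (fun t => U t - ∫ p, U (t - p.1 - p.2) ∂(F.prod (expMeasure lam))) atTop (𝓝 0)) :
    ∃ s : ℕ → ℝ, Tendsto s atTop atTop ∧ ∀ᵐ x ∂volume.restrict (Ioi (0 : ℝ)),
      Tendsto (fun k => U (s k - x)) atTop (𝓝 (limsup U atTop)) := by
  have := isProbabilityMeasure_expMeasure hlam
  have hb1 : IsBoundedUnder (· ≤ ·) atTop U :=
    isBoundedUnder_of ⟨1, fun t => (abs_le.1 (hU t)).2⟩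
  obtain ⟨t, ht, hUt⟩ := exists_seq_tendsto_limsup hU
  set α := limsup U atTop with hα
  set P := F.prod (expMeasure lam) with hP
  set g : ℕ → ℝ × ℝ → ℝ := fun k p => U (t k - p.1 - p.2) with hg
  have hgm : ∀ k, Measurable (g k) := fun k => hUm.comp (by fun_prop)
  have hgi : ∀ k, Integrable (g k) P := fun k =>
    Integrable.of_bound (hgm k).aestronglyMeasurable 1 (Eventually.of_forall fun p => hU _)
  have hint : Tendsto (fun k => ∫ p, g k p ∂P) atTop (𝓝 α) := by
    have := hUt.sub (h.comp ht)
    simpa [hg, Function.comp_def] using this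
  -- Far out, `U` exceeds its upper limit by arbitrarily little, so the positive part vanishes by
  -- dominated convergence.
  have hpos : Tendsto (fun k => ∫ p, max (g k p - α) 0 ∂P) atTop (𝓝 0) := by
    suffices h0 : Tendsto (fun k => ∫ p, max (g k p - α) 0 ∂P) atTop (𝓝 (∫ _, (0 : ℝ) ∂P)) by
      simpa using h0
    refine tendsto_integral_of_dominated_convergence (F := fun k p => max (g k p - α) 0)
      (fun _ => 1 + |α|) (fun k => (((hgm k).sub_const α).max measurable_const).aestronglyMeasurable)
      (integrable_const (μ := P) _) (fun k => Eventually.of_forall fun p => ?_)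
      (Eventually.of_forall fun p => ?_)
    · have h1 := hU (t k - p.1 - p.2)
      rw [Real.norm_of_nonneg (le_max_right _ _)]
      refine max_le ?_ (by positivity)
      have := neg_abs_le α
      have := (abs_le.1 h1).2
      simp only [hg]; linarith
    · have hs : Tendsto (fun k => t k - p.1 - p.2) atTop atTop := by
        have := tendsto_atTop_add_const_right atTop (-p.1 - p.2) ht
        refine this.congr fun k => by ring
      rw [Metric.tendsto_nhds]
      intro ε hε
      have h2 : ∀ᶠ y in atTop, U y < α + ε := eventually_lt_of_limsup_lt (by linarith) hb1
      filter_upwards [hs.eventually h2] with k hk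
      rw [dist_zero_right, Real.norm_of_nonneg (le_max_right _ _)]
      exact max_lt (by simp only [hg]; linarith) hε
  -- Since |x| = 2x⁺ - x and the averages tend to `α`, the excess and the deficit both disappear:
  -- this is convergence in mean.
  have habs : Tendsto (fun k => ∫ p, ‖g k p - α‖ ∂P) atTop (𝓝 0) := by
    have h1 : ∀ k, ∫ p, ‖g k p - α‖ ∂P =
        2 * ∫ p, max (g k p - α) 0 ∂P - (∫ p, g k p ∂P - α) := by
      intro k
      have hi : Integrable (fun p => g k p - α) P := (hgi k).sub (integrable_const α)
      have hi2 : Integrable (fun p => max (g k p - α) 0) P := hi.pos_part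
      rw [← integral_const_mul, show (∫ p, g k p ∂P) - α = ∫ p, (g k p - α) ∂P by
        rw [integral_sub (hgi k) (integrable_const α)]; simp, ← integral_sub (hi2.const_mul 2) hi]
      refine integral_congr_ae (Eventually.of_forall fun p => ?_)
      simp only [Real.norm_eq_abs]
      rcases le_total 0 (g k p - α) with h | h
      · rw [abs_of_nonneg h, max_eq_left h]; ring
      · rw [abs_of_nonpos h, max_eq_right h]; ring
    simp_rw [h1]
    have := (hpos.const_mul 2).sub (hint.sub_const α)
    simpa using this
  have hLp : Tendsto (fun k => eLpNorm (g k - fun _ => α) 1 P) atTop (𝓝 0) := by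
    have h1 : ∀ k, eLpNorm (g k - fun _ => α) 1 P = ENNReal.ofReal (∫ p, ‖g k p - α‖ ∂P) := by
      intro k
      have hi : Integrable (fun p => g k p - α) P := (hgi k).sub (integrable_const α)
      rw [eLpNorm_one_eq_lintegral_enorm, ofReal_integral_norm_eq_lintegral_enorm hi]
      rfl
    simp_rw [h1]
    simpa using ENNReal.tendsto_ofReal habs
  obtain ⟨ns, hns, hae⟩ := (tendstoInMeasure_of_tendsto_eLpNorm one_ne_zero
    (fun k => (hgm k).aestronglyMeasurable) aestronglyMeasurable_const hLp).exists_seq_tendsto_ae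
  -- Fubini fixes one value of the shift under `F`. The exponential density is positive on the
  -- positive axis, so almost everywhere for it means almost everywhere for Lebesgue measure there.
  obtain ⟨y, hy⟩ := (Measure.ae_ae_of_ae_prod hae).exists
  refine ⟨fun k => t (ns k) - y, ?_, ?_⟩
  · have := tendsto_atTop_add_const_right atTop (-y) (ht.comp hns.tendsto_atTop)
    exact this.congr fun k => by simp [sub_eq_add_neg]
  · have hm : Measurable (exponentialPDF lam) := by
      unfold exponentialPDF; exact (measurable_exponentialPDFReal lam).ennreal_ofReal
    have hy' : ∀ᵐ x ∂volume.withDensity (exponentialPDF lam),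
        Tendsto (fun k => g (ns k) (y, x)) atTop (𝓝 α) := hy
    rw [ae_withDensity_iff hm] at hy'
    rw [ae_restrict_iff' measurableSet_Ioi]
    filter_upwards [hy'] with x hx hx0
    refine hx ?_
    have hx0 : 0 < x := hx0
    rw [exponentialPDF_of_nonneg hx0.le]
    simp only [ne_eq, ENNReal.ofReal_eq_zero, not_le]
    positivity

theorem setLIntegral_Iic_eq (g : ℝ → ℝ≥0∞) (t : ℝ) :
    ∫⁻ z in Iic t, g z = ∫⁻ x in Ici 0, g (t - x) := by
  rw [← lintegral_indicator measurableSet_Iic, ← lintegral_indicator measurableSet_Ici,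
    ← lintegral_sub_left_eq_self _ t]
  refine lintegral_congr fun x => ?_
  simp [indicator]

theorem setLIntegral_Iic_conv (ν : Measure ℝ) [SFinite ν] {g : ℝ → ℝ≥0∞} (hg : Measurable g)
    (t : ℝ) :
    ∫⁻ z in Iic t, ∫⁻ y, g (z - y) ∂ν = ∫⁻ x, g (t - x) * ν (Iic x) := by
  rw [setLIntegral_Iic_eq, lintegral_lintegral_swap (by fun_prop)]
  have h1 : ∀ y, ∫⁻ x in Ici 0, g (t - x - y) = ∫⁻ x, (Iic x).indicator (fun _ => g (t - x)) y := by
    intro y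
    rw [← lintegral_indicator measurableSet_Ici, ← lintegral_sub_right_eq_self _ y]
    refine lintegral_congr fun x => ?_
    simp only [indicator, mem_Iic, mem_Ici, sub_nonneg]
    congr 2; ring
  have hm : Measurable fun p : ℝ × ℝ => (Iic p.2).indicator (fun _ => g (t - p.2)) p.1 := by
    simp only [indicator, mem_Iic]
    exact Measurable.ite (measurableSet_le (by fun_prop) (by fun_prop)) (by fun_prop) (by fun_prop)
  simp_rw [h1]
  rw [lintegral_lintegral_swap hm.aemeasurable]
  refine lintegral_congr fun x => ?_
  rw [lintegral_indicator measurableSet_Iic, setLIntegral_const]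

/-- Conservation law of the renewal equation. -/
theorem renewal_conservation {lam : ℝ} (hlam : 0 < lam) {F : Measure ℝ} [IsProbabilityMeasure F]
    (hF : ∀ᵐ y ∂F, 0 ≤ y) {u w h : ℝ → ℝ≥0∞} (hum : Measurable u) (hwm : Measurable w)
    (hhm : Measurable h) (hu1 : ∀ t, u t ≤ 1) (hu0 : ∀ t < 0, u t = 0) (hw0 : ∀ t < 0, w t = 0)
    {c : ℝ≥0∞}
    (h1 : ∀ t, 0 ≤ t → u t = c * ENNReal.ofReal (Real.exp (-(lam * t))) +
      ∫⁻ x, w (t - x) ∂expMeasure lam)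
    (h2 : ∀ t, w t = h t + ∫⁻ y, u (t - y) ∂F) {t : ℝ} (ht : 0 ≤ t) :
    u t + ENNReal.ofReal lam * ∫⁻ y in Ici 0, u (t - y) * F (Ioi y) =
      c + ENNReal.ofReal lam * ∫⁻ z in Iic t, h z := by
  have := isProbabilityMeasure_expMeasure hlam
  set L := ENNReal.ofReal lam with hL
  have hFm : Measurable fun x => F (Iic x) :=
    (Monotone.measurable fun a b hab => measure_mono (Iic_subset_Iic.2 hab))
  have hEm : Measurable fun x => expMeasure lam (Iic x) :=
    (Monotone.measurable fun a b hab => measure_mono (Iic_subset_Iic.2 hab))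
  have hFm' : Measurable fun x => F (Ioi x) :=
    (Antitone.measurable fun a b hab => measure_mono (Ioi_subset_Ioi hab))
  -- integral of `u`
  have hIu : L * ∫⁻ z in Iic t, u z = c * ENNReal.ofReal (1 - Real.exp (-(lam * t))) +
      L * ∫⁻ x in Ioi 0, w (t - x) * expMeasure lam (Iic x) := by
    have e1 : ∀ z, u z = c * (Ici 0).indicator (fun z => ENNReal.ofReal (Real.exp (-(lam * z)))) z +
        ∫⁻ x, w (z - x) ∂expMeasure lam := by
      intro z
      rcases le_or_gt 0 z with hz | hz
      · rw [h1 z hz, indicator_of_mem (by exact hz)]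
      · rw [hu0 z hz, indicator_of_notMem (by simpa using hz), mul_zero, zero_add]
        symm
        rw [lintegral_eq_zero_iff (by fun_prop)]
        filter_upwards [ae_expMeasure_nonneg hlam] with x hx
        exact hw0 _ (by linarith)
    rw [setLIntegral_congr_fun measurableSet_Iic (fun z _ => e1 z), lintegral_add_right _
      (by fun_prop), setLIntegral_Iic_conv _ hwm, lintegral_const_mul _ (Measurable.indicator
      (by fun_prop) measurableSet_Ici), lintegral_indicator measurableSet_Ici,
      Measure.restrict_restrict measurableSet_Ici, Ici_inter_Iic,
      setLIntegral_congr Ioo_ae_eq_Icc.symm,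
      lintegral_Ioo_of_hasDerivAt (A := fun x => -Real.exp (-(lam * x)) / lam)
        (fun x => by
          convert! (hasDerivAt_exp_neg_mul lam x).neg.div_const lam using 1; field_simp)
        (by fun_prop) ht (fun x _ => by positivity), mul_add]
    congr 1
    · rw [mul_left_comm, ← ENNReal.ofReal_mul hlam.le]
      congr 2; simp; field_simp; ring
    · congr 1
      rw [← lintegral_indicator measurableSet_Ioi]
      refine lintegral_congr fun x => ?_
      by_cases hx : 0 < x
      · rw [indicator_of_mem (by exact hx)]
      · rw [indicator_of_notMem (by exact hx)]
        have : expMeasure lam (Iic x) = 0 := by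
          rw [← compl_Ioi, prob_compl_eq_one_sub measurableSet_Ioi, expMeasure_Ioi hlam,
            max_eq_right (not_lt.1 hx)]
          simp
        rw [this, mul_zero]
  have hIw : L * ∫⁻ z in Iic t, w z = L * (∫⁻ z in Iic t, h z) +
      L * ∫⁻ y in Ici 0, u (t - y) * F (Iic y) := by
    rw [lintegral_congr h2, lintegral_add_left hhm, setLIntegral_Iic_conv _ hum, mul_add]
    congr 2
    rw [← lintegral_indicator measurableSet_Ici]
    refine lintegral_congr fun x => ?_
    by_cases hx : 0 ≤ x
    · rw [indicator_of_mem (by exact hx)]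
    · rw [indicator_of_notMem (by exact hx)]
      have : F (Iic x) = 0 := by
        rw [measure_eq_zero_iff_ae_notMem]
        filter_upwards [hF] with y hy
        simp only [mem_Iic]; linarith
      rw [this, mul_zero]
  -- The exponential density plus λ times its distribution function is constantly λ, so the two
  -- convolutions add up to a plain integral.
  have hw : ∫⁻ x, w (t - x) ∂expMeasure lam +
      L * ∫⁻ x in Ioi 0, w (t - x) * expMeasure lam (Iic x) = L * ∫⁻ z in Iic t, w z := by
    rw [lintegral_expMeasure, setLIntegral_Iic_eq, setLIntegral_congr Ioi_ae_eq_Ici.symm,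
      ← lintegral_const_mul _ (by fun_prop), ← lintegral_const_mul _ (by fun_prop),
      ← lintegral_add_left (by fun_prop)]
    refine setLIntegral_congr_fun measurableSet_Ioi fun x hx => ?_
    have hx : 0 < x := hx
    have he : ENNReal.ofReal (Real.exp (-(lam * x))) + expMeasure lam (Iic x) = 1 := by
      have := prob_add_prob_compl (μ := expMeasure lam) (measurableSet_Ioi (a := x))
      rwa [compl_Ioi, expMeasure_Ioi hlam, max_eq_left hx.le] at this
    rw [ENNReal.ofReal_mul hlam.le]
    calc _ = L * w (t - x) * (ENNReal.ofReal (Real.exp (-(lam * x))) + expMeasure lam (Iic x)) := by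
          ring
      _ = _ := by rw [he, mul_one]
  have hsplit : L * ∫⁻ z in Iic t, u z = L * (∫⁻ y in Ici 0, u (t - y) * F (Ioi y)) +
      L * ∫⁻ y in Ici 0, u (t - y) * F (Iic y) := by
    have hm : Measurable fun y => u (t - y) * F (Ioi y) :=
      (hum.comp (measurable_const.sub measurable_id)).mul hFm'
    rw [setLIntegral_Iic_eq, ← mul_add, ← lintegral_add_left hm]
    congr 1
    refine lintegral_congr fun y => ?_
    have := prob_add_prob_compl (μ := F) (measurableSet_Ioi (a := y))
    rw [compl_Ioi] at this
    rw [← mul_add, this, mul_one]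
  have hfin : L * ∫⁻ z in Iic t, u z ≠ ∞ := by
    refine ENNReal.mul_ne_top ENNReal.ofReal_ne_top ?_
    have : ∫⁻ z in Iic t, u z ≤ ∫⁻ z, (Icc 0 t).indicator 1 z := by
      rw [← lintegral_indicator measurableSet_Iic]
      refine lintegral_mono fun z => ?_
      simp only [indicator, mem_Iic, mem_Icc, Pi.one_apply]
      rcases lt_or_ge z 0 with hz | hz
      · simp [hu0 z hz]
      · split_ifs with a b b
        · exact hu1 z
        · exact absurd ⟨hz, a⟩ b
        · exact zero_le
        · exact le_rfl
    refine ne_top_of_le_ne_top ?_ this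
    rw [lintegral_indicator_one measurableSet_Icc]
    simp
  have hfin2 : L * ∫⁻ y in Ici 0, u (t - y) * F (Iic y) ≠ ∞ := by
    rw [hsplit] at hfin
    exact (ENNReal.add_ne_top.1 hfin).2
  have hc : c * ENNReal.ofReal (Real.exp (-(lam * t))) +
      c * ENNReal.ofReal (1 - Real.exp (-(lam * t))) = c := by
    have : Real.exp (-(lam * t)) ≤ 1 := by rw [Real.exp_le_one_iff]; nlinarith
    rw [← mul_add, ← ENNReal.ofReal_add (by positivity) (by linarith)]
    simp
  -- Integrating both renewal equations up to `t` produces the same term with `F (Iic y)` on each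
  -- side. It is finite, so it cancels, and the tail of `F` remains.
  refine (ENNReal.add_left_inj hfin2).1 ?_
  calc _ = u t + L * ∫⁻ z in Iic t, u z := by rw [hsplit]; ring
    _ = c * ENNReal.ofReal (Real.exp (-(lam * t))) +
      c * ENNReal.ofReal (1 - Real.exp (-(lam * t))) + (∫⁻ x, w (t - x) ∂expMeasure lam +
      L * ∫⁻ x in Ioi 0, w (t - x) * expMeasure lam (Iic x)) := by rw [hIu, h1 t ht]; ring
    _ = c + (L * (∫⁻ z in Iic t, h z) + L * ∫⁻ y in Ici 0, u (t - y) * F (Iic y)) := by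
      rw [hc, hw, hIw]
    _ = _ := by ring

theorem tendsto_setLIntegral_Iic (h : ℝ → ℝ≥0∞) {t : ℕ → ℝ} (ht : Tendsto t atTop atTop) :
    Tendsto (fun k => ∫⁻ z in Iic (t k), h z) atTop (𝓝 (∫⁻ z, h z)) := by
  have h1 : ∀ s : ℝ, ∫⁻ z in Iic s, h z = volume.withDensity h (Iic s) := fun s =>
    (withDensity_apply h measurableSet_Iic).symm
  have h2 : ∫⁻ z, h z = volume.withDensity h univ := by
    rw [withDensity_apply h MeasurableSet.univ, Measure.restrict_univ]
  simp_rw [h1, h2]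
  exact (tendsto_measure_Iic_atTop _).comp ht

/-- **Renewal theorem** for regenerative processes whose cycles start with an exponential time. -/
theorem renewal_limit {lam : ℝ} (hlam : 0 < lam) {F : Measure ℝ} [IsProbabilityMeasure F]
    (hF : ∀ᵐ y ∂F, 0 ≤ y) {u w h : ℝ → ℝ≥0∞} (hum : Measurable u) (hwm : Measurable w)
    (hhm : Measurable h) (hu1 : ∀ t, u t ≤ 1) (hu0 : ∀ t < 0, u t = 0) (hw0 : ∀ t < 0, w t = 0)
    (hh1 : ∀ t, h t ≤ 1) (hh0 : Tendsto h atTop (𝓝 0)) {c : ℝ≥0∞} (hc : c ≠ ∞)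
    (h1 : ∀ t, 0 ≤ t → u t = c * ENNReal.ofReal (Real.exp (-(lam * t))) +
      ∫⁻ x, w (t - x) ∂expMeasure lam)
    (h2 : ∀ t, w t = h t + ∫⁻ y, u (t - y) ∂F)
    (hm : ∫⁻ y in Ici 0, F (Ioi y) ≠ ∞) :
    Tendsto u atTop (𝓝 ((c + ENNReal.ofReal lam * ∫⁻ z, h z) /
      (1 + ENNReal.ofReal lam * ∫⁻ y in Ici 0, F (Ioi y)))) := by
  have := isProbabilityMeasure_expMeasure hlam
  set L := ENNReal.ofReal lam with hL
  set m := ∫⁻ y in Ici 0, F (Ioi y) with hmdef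
  set U : ℝ → ℝ := fun t => (u t).toReal with hU
  have hFm' : Measurable fun x => F (Ioi x) :=
    (Antitone.measurable fun a b hab => measure_mono (Ioi_subset_Ioi hab))
  have huf : ∀ t, u t ≠ ∞ := fun t => ne_top_of_le_ne_top ENNReal.one_ne_top (hu1 t)
  have hUm : Measurable U := hum.ennreal_toReal
  have hU0 : ∀ t, 0 ≤ U t := fun t => ENNReal.toReal_nonneg
  have hU1 : ∀ t, |U t| ≤ 1 := fun t => by
    rw [abs_of_nonneg (hU0 t)]
    exact ENNReal.toReal_le_of_le_ofReal zero_le_one (by simpa using hu1 t)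
  -- identification of the limit along long constant stretches
  have hident : ∀ (s : ℕ → ℝ) (a : ℝ), Tendsto s atTop atTop →
      (∀ᵐ x ∂volume.restrict (Ioi (0 : ℝ)), Tendsto (fun k => U (s k - x)) atTop (𝓝 a)) →
      ENNReal.ofReal a = (c + L * ∫⁻ z, h z) / (1 + L * m) := by
    intro s a hs hae
    have hae' : ∀ᵐ x ∂volume.restrict (Ioi (0 : ℝ)),
        Tendsto (fun k => u (s k - x)) atTop (𝓝 (ENNReal.ofReal a)) := by
      filter_upwards [hae] with x hx
      refine (ENNReal.tendsto_ofReal hx).congr fun k => ENNReal.ofReal_toReal (huf _)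
    rw [ae_restrict_iff' measurableSet_Ioi] at hae'
    -- One good point is enough: the conservation law is evaluated at the times `s k - x0`, where
    -- `u` converges at the point itself and almost everywhere in its past.
    obtain ⟨x0, hx0, hx0'⟩ : ∃ x0 : ℝ, 0 < x0 ∧
        Tendsto (fun k => u (s k - x0)) atTop (𝓝 (ENNReal.ofReal a)) := by
      by_contra! hcon
      have : volume (Ioi (0 : ℝ)) = 0 := by
        rw [measure_eq_zero_iff_ae_notMem]
        filter_upwards [hae'] with x hx hx0
        exact hcon x hx0 (hx hx0)
      simp at this
    have hshift : ∀ᵐ y ∂volume.restrict (Ici (0 : ℝ)),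
        Tendsto (fun k => u (s k - x0 - y) * F (Ioi y)) atTop
          (𝓝 (ENNReal.ofReal a * F (Ioi y))) := by
      rw [ae_restrict_iff' measurableSet_Ici]
      have h3 : ∀ᵐ y : ℝ, x0 + y ∈ Ioi (0 : ℝ) →
          Tendsto (fun k => u (s k - (x0 + y))) atTop (𝓝 (ENNReal.ofReal a)) :=
        (measurePreserving_add_left volume x0).quasiMeasurePreserving.ae hae'
      filter_upwards [h3] with y hy hy0
      have hy0 : 0 ≤ y := hy0
      have h4 := hy (show 0 < x0 + y by linarith)
      simp_rw [← sub_sub] at h4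
      exact ENNReal.Tendsto.mul_const h4 (Or.inr (measure_ne_top F _))
    have hs' : Tendsto (fun k => s k - x0) atTop atTop := by
      simpa [sub_eq_add_neg] using tendsto_atTop_add_const_right atTop (-x0) hs
    -- The tail of `F` is integrable by `hm` and dominates, because `u ≤ 1`.
    have hlim1 : Tendsto (fun k => ∫⁻ y in Ici 0, u (s k - x0 - y) * F (Ioi y)) atTop
        (𝓝 (∫⁻ y in Ici 0, ENNReal.ofReal a * F (Ioi y))) := by
      refine tendsto_lintegral_of_dominated_convergence (fun y => F (Ioi y))
        (fun k => (hum.comp (by fun_prop)).mul hFm') (fun k => Eventually.of_forall fun y => ?_)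
        hm hshift
      exact mul_le_of_le_one_left zero_le (hu1 _)
    rw [lintegral_const_mul _ hFm', ← hmdef] at hlim1
    have hL1 : L ≠ ∞ := ENNReal.ofReal_ne_top
    have hlim2 := hx0'.add (ENNReal.Tendsto.const_mul hlim1 (Or.inr hL1))
    have hlim3 := (tendsto_const_nhds (x := c)).add
      (ENNReal.Tendsto.const_mul (tendsto_setLIntegral_Iic h hs') (Or.inr hL1))
    have heq : (fun k => u (s k - x0) + L * ∫⁻ y in Ici 0, u (s k - x0 - y) * F (Ioi y))
        =ᶠ[atTop] fun k => c + L * ∫⁻ z in Iic (s k - x0), h z := by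
      filter_upwards [hs'.eventually_ge_atTop 0] with k hk
      exact renewal_conservation hlam hF hum hwm hhm hu1 hu0 hw0 h1 h2 hk
    have h5 := tendsto_nhds_unique (hlim2.congr' heq) hlim3
    rw [ENNReal.eq_div_iff (by simp) (ENNReal.add_ne_top.2 ⟨by simp, ENNReal.mul_ne_top hL1 hm⟩),
      ← h5]
    ring
  -- asymptotic equality with the average
  have hsub : Tendsto (fun t => U t - ∫ p, U (t - p.1 - p.2) ∂(F.prod (expMeasure lam))) atTop
      (𝓝 0) := by
    have hinner : ∀ t, ∫⁻ x, w (t - x) ∂expMeasure lam = ∫⁻ x, h (t - x) ∂expMeasure lam +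
        ∫⁻ p, u (t - p.1 - p.2) ∂(F.prod (expMeasure lam)) := by
      intro t
      rw [lintegral_congr fun x => h2 (t - x), lintegral_add_left (by fun_prop),
        lintegral_prod_symm _ (by fun_prop)]
      congr 1
      refine lintegral_congr fun x => lintegral_congr fun y => ?_
      congr 1; ring
    have hsmall : Tendsto (fun t => c * ENNReal.ofReal (Real.exp (-(lam * t))) +
        ∫⁻ x, h (t - x) ∂expMeasure lam) atTop (𝓝 0) := by
      have e1 : Tendsto (fun t => c * ENNReal.ofReal (Real.exp (-(lam * t)))) atTop (𝓝 0) := by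
        have : Tendsto (fun t => Real.exp (-(lam * t))) atTop (𝓝 0) :=
          Real.tendsto_exp_neg_atTop_nhds_zero.comp (tendsto_id.const_mul_atTop hlam)
        simpa using ENNReal.Tendsto.const_mul (ENNReal.tendsto_ofReal this) (Or.inr hc)
      have e2 : Tendsto (fun t => ∫⁻ x, h (t - x) ∂expMeasure lam) atTop (𝓝 0) := by
        rw [← lintegral_zero (μ := expMeasure lam)]
        refine tendsto_lintegral_filter_of_dominated_convergence (fun _ => 1)
          (Eventually.of_forall fun t => by fun_prop)
          (Eventually.of_forall fun t => Eventually.of_forall fun x => hh1 _) (by simp)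
          (Eventually.of_forall fun x => ?_)
        refine hh0.comp ?_
        simpa [sub_eq_add_neg] using tendsto_atTop_add_const_right atTop (-x) tendsto_id
      simpa using e1.add e2
    have hreal := (ENNReal.tendsto_toReal ENNReal.zero_ne_top).comp hsmall
    rw [ENNReal.toReal_zero] at hreal
    refine hreal.congr' ?_
    filter_upwards [eventually_ge_atTop 0] with t ht
    have h3 := h1 t ht
    rw [hinner, ← add_assoc] at h3
    have h4 : ∫ p, U (t - p.1 - p.2) ∂(F.prod (expMeasure lam)) =
        (∫⁻ p, u (t - p.1 - p.2) ∂(F.prod (expMeasure lam))).toReal :=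
      integral_toReal (by fun_prop) (Eventually.of_forall fun p => (huf _).lt_top)
    have h5 := huf t
    rw [h3] at h5
    rw [h4]
    simp only [Function.comp, hU]
    rw [h3, ENNReal.toReal_add (ENNReal.add_ne_top.1 h5).1 (ENNReal.add_ne_top.1 h5).2]
    ring
  set A := (c + L * ∫⁻ z, h z) / (1 + L * m) with hA
  obtain ⟨s, hs, hsae⟩ := exists_seq_ae_tendsto_limsup hlam hUm hU1 hsub
  have hsub' : Tendsto (fun t => (-U t) - ∫ p, (-U (t - p.1 - p.2)) ∂(F.prod (expMeasure lam)))
      atTop (𝓝 0) := by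
    have := hsub.neg
    rw [neg_zero] at this
    refine this.congr fun t => ?_
    rw [integral_neg]; ring
  -- The same argument for `-U` treats the lower limit. Both limits are identified with the same
  -- constant, so `U` converges.
  obtain ⟨s', hs', hsae'⟩ := exists_seq_ae_tendsto_limsup (U := fun t => -U t) hlam hUm.neg
    (fun t => by rw [abs_neg]; exact hU1 t) hsub'
  have hne : ∀ (p : ℝ → Prop), (∀ᵐ x ∂volume.restrict (Ioi (0 : ℝ)), p x) → ∃ x, p x := by
    intro p hp
    have : NeBot (ae (volume.restrict (Ioi (0 : ℝ)))) := by
      rw [ae_neBot, Ne, Measure.restrict_eq_zero]; simp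
    exact hp.exists
  have ha0 : 0 ≤ limsup U atTop := by
    obtain ⟨x, hx⟩ := hne _ hsae
    exact ge_of_tendsto' hx fun k => hU0 _
  have hb0 : 0 ≤ -limsup (fun t => -U t) atTop := by
    obtain ⟨x, hx⟩ := hne _ hsae'
    have := le_of_tendsto' hx (fun k => neg_nonpos.2 (hU0 _))
    linarith
  have ha := hident s _ hs hsae
  have hb := hident s' (-limsup (fun t => -U t) atTop) hs' (by
    filter_upwards [hsae'] with x hx
    simpa using hx.neg)
  have hAf : A ≠ ∞ := by rw [← ha]; exact ENNReal.ofReal_ne_top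
  have hab : limsup U atTop = -limsup (fun t => -U t) atTop := by
    rw [← ENNReal.toReal_ofReal ha0, ← ENNReal.toReal_ofReal hb0, ha, hb]
  have hlim : Tendsto U atTop (𝓝 (limsup U atTop)) := by
    have hb1 : IsBoundedUnder (· ≤ ·) atTop U :=
      isBoundedUnder_of ⟨1, fun t => (abs_le.1 (hU1 t)).2⟩
    have hb2 : IsBoundedUnder (· ≤ ·) atTop fun t => -U t :=
      isBoundedUnder_of ⟨0, fun t => neg_nonpos.2 (hU0 t)⟩
    rw [Metric.tendsto_nhds]
    intro ε hε
    filter_upwards [eventually_lt_of_limsup_lt (b := limsup U atTop + ε) (by linarith) hb1,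
      eventually_lt_of_limsup_lt (b := limsup (fun t => -U t) atTop + ε) (by linarith) hb2]
      with t ht1 ht2
    rw [Real.dist_eq, abs_lt]
    constructor <;> linarith
  have := ENNReal.tendsto_ofReal hlim
  rw [ha] at this
  exact this.congr fun t => ENNReal.ofReal_toReal (huf t)

/-! ### Paths of the queue -/

/-- Put one set of clocks in front of a sequence of clocks. -/
def consClocks (z : ℝ × ℝ × ℝ) (ω : Clocks) : Clocks
  | 0 => z
  | n + 1 => ω n

theorem measurable_consClocks :
    Measurable fun p : (ℝ × ℝ × ℝ) × Clocks => consClocks p.1 p.2 := by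
  refine measurable_pi_lambda _ fun n => ?_
  cases n with
  | zero => exact measurable_fst
  | succ n => exact (measurable_pi_apply n).comp measurable_snd

theorem isProbabilityMeasure_clockLaw {lam : ℝ} (hlam : 0 < lam) (G : Measure ℝ)
    [IsProbabilityMeasure G] : IsProbabilityMeasure (clockLaw lam G) := by
  have := isProbabilityMeasure_expMeasure hlam
  have := isProbabilityMeasure_expMeasure one_pos
  unfold clockLaw; infer_instance

/-- An independent identically distributed sequence keeps its law when one more independent copy is
put in front, as is checked on finite cylinders. This is the Markov property at the first event. -/
theorem map_consClocks {lam : ℝ} (hlam : 0 < lam) (G : Measure ℝ) [IsProbabilityMeasure G] :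
    ((clock lam G).prod (clockLaw lam G)).map (fun p => consClocks p.1 p.2) = clockLaw lam G := by
  have := isProbabilityMeasure_expMeasure hlam
  have := isProbabilityMeasure_expMeasure one_pos
  have := isProbabilityMeasure_clock hlam G
  have := isProbabilityMeasure_clockLaw hlam G
  refine Measure.eq_infinitePi _ fun s t ht => ?_
  rw [Measure.map_apply measurable_consClocks
    (MeasurableSet.pi s.countable_toSet fun i _ => ht i)]
  set s' : Finset ℕ := s.preimage (· + 1) (add_left_injective 1).injOn with hs'
  -- A cylinder need not constrain coordinate 0; the front factor is then the whole space.
  set A : Set (ℝ × ℝ × ℝ) := if 0 ∈ s then t 0 else univ with hA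
  have hset : (fun p : (ℝ × ℝ × ℝ) × Clocks => consClocks p.1 p.2) ⁻¹' (s : Set ℕ).pi t =
      A ×ˢ (s' : Set ℕ).pi fun i => t (i + 1) := by
    ext ⟨z, ω⟩
    simp only [mem_preimage, Set.mem_pi, mem_prod, Finset.mem_coe, hs', Finset.mem_preimage, hA]
    constructor
    · intro h
      refine ⟨?_, fun i hi => h (i + 1) hi⟩
      split_ifs with h0
      · exact h 0 h0
      · trivial
    · rintro ⟨h0, h⟩ i hi
      cases i with
      | zero => rw [if_pos hi] at h0; exact h0
      | succ i => exact h i hi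
  have hpi : clockLaw lam G ((s' : Set ℕ).pi fun i => t (i + 1)) =
      ∏ i ∈ s', clock lam G (t (i + 1)) :=
    Measure.infinitePi_pi _ fun i _ => ht (i + 1)
  rw [hset, Measure.prod_prod, hpi]
  change _ = ∏ i ∈ s, clock lam G (t i)
  have hprod : ∏ i ∈ s', clock lam G (t (i + 1)) = ∏ i ∈ s.erase 0, clock lam G (t i) := by
    refine Finset.prod_bij (fun i _ => i + 1) ?_ ?_ ?_ ?_
    · intro i hi; simpa [hs'] using hi
    · intro a _ b _ h; simpa using h
    · intro b hb
      obtain ⟨hb0, hb⟩ := Finset.mem_erase.1 hb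
      obtain ⟨i, rfl⟩ := Nat.exists_eq_succ_of_ne_zero hb0
      exact ⟨i, by simpa [hs'] using hb, rfl⟩
    · intro i _; rfl
  rw [hprod, hA]
  split_ifs with h0
  · exact Finset.mul_prod_erase s (fun i => clock lam G (t i)) h0
  · rw [measure_univ, one_mul, Finset.erase_eq_of_notMem h0]

theorem lintegral_clockLaw {lam : ℝ} (hlam : 0 < lam) (G : Measure ℝ) [IsProbabilityMeasure G]
    {g : Clocks → ℝ≥0∞} (hg : Measurable g) :
    ∫⁻ ω, g ω ∂clockLaw lam G = ∫⁻ z, ∫⁻ ω, g (consClocks z ω) ∂clockLaw lam G ∂clock lam G := by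
  have := isProbabilityMeasure_clock hlam G
  have := isProbabilityMeasure_clockLaw hlam G
  conv_lhs => rw [← map_consClocks hlam G]
  rw [lintegral_map hg measurable_consClocks,
    lintegral_prod (fun p : (ℝ × ℝ × ℝ) × Clocks => g (consClocks p.1 p.2))
      (hg.comp measurable_consClocks).aemeasurable]

theorem eventSeq_cons (f : ℝ → ℝ) (s : QState) (z : ℝ × ℝ × ℝ) (ω : Clocks) (m : ℕ) :
    eventSeq f s (consClocks z ω) (m + 1) =
      ((eventSeq f (step f s z).1 ω m).1, (step f s z).2 + (eventSeq f (step f s z).1 ω m).2) := by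
  induction m with
  | zero => simp [eventSeq, consClocks]
  | succ m ih =>
    rw [eventSeq, ih]
    simp [eventSeq, consClocks, add_assoc]

theorem measurable_eventSeq (f : ℝ → ℝ) (m : ℕ) :
    Measurable fun p : QState × Clocks => eventSeq f p.1 p.2 m := by
  induction m with
  | zero => exact measurable_fst.prodMk measurable_const
  | succ m ih =>
    have h : Measurable fun p : QState × Clocks =>
        step f (eventSeq f p.1 p.2 m).1 (p.2 m) :=
      (measurable_step f).comp (ih.fst.prodMk ((measurable_pi_apply m).comp measurable_snd))
    exact h.fst.prodMk (ih.snd.add h.snd)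

theorem ae_good_clocks {lam : ℝ} (hlam : 0 < lam) {G : Measure ℝ} [IsProbabilityMeasure G]
    (hG : ∀ᵐ x ∂G, 0 ≤ x) : ∀ᵐ ω ∂clockLaw lam G, ∀ m, Good (ω m) := by
  have := isProbabilityMeasure_expMeasure hlam
  have := isProbabilityMeasure_expMeasure one_pos
  rw [ae_all_iff]
  intro m
  exact (measurePreserving_eval_infinitePi (fun _ : ℕ => clock lam G)
    (hμ := fun _ => isProbabilityMeasure_clock hlam G) m).quasiMeasurePreserving.ae
      (ae_good hlam hG)

theorem eventSeq_admissible {f : ℝ → ℝ} (hf : ∀ n : ℕ, 0 < f ((n + 1 : ℕ) : ℝ)) {s : QState}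
    (hs : s.Admissible) {ω : Clocks} (hω : ∀ m, Good (ω m)) (m : ℕ) :
    (eventSeq f s ω m).1.Admissible := by
  induction m with
  | zero => exact hs
  | succ m ih => exact (step_admissible hf ih (hω m)).1

theorem eventSeq_monotone {f : ℝ → ℝ} (hf : ∀ n : ℕ, 0 < f ((n + 1 : ℕ) : ℝ)) {s : QState}
    (hs : s.Admissible) {ω : Clocks} (hω : ∀ m, Good (ω m)) :
    Monotone fun m => (eventSeq f s ω m).2 := by
  refine monotone_nat_of_le_succ fun m => ?_
  have := (step_admissible hf (eventSeq_admissible hf hs hω m) (hω m)).2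
  simp only [eventSeq]
  linarith

/-! ### Absence of explosion -/

/-- Weight function used to rule out explosion. -/
noncomputable def weight (θ : ℝ≥0∞) : QState → ℝ≥0∞ :=
  QState.fold (fun n => θ ^ (2 * n)) (fun n _ => θ ^ (2 * n + 1))

theorem measurable_weight (θ : ℝ≥0∞) : Measurable (weight θ) :=
  QState.measurable_fold fun _ => measurable_const

/-- An arrival multiplies the weight by θ², any other event from a nonempty system by θ⁻¹. With
discounting at rate 1, the condition θ³λ ≤ λ+1 makes each event cost a factor θ⁻¹ on average,
whatever the size of `f`. -/
theorem lintegral_exp_neg_weight_le {lam : ℝ} (hlam : 0 < lam) {G : Measure ℝ}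
    [IsProbabilityMeasure G] {f : ℝ → ℝ} (hf : ∀ n : ℕ, 0 < f ((n + 1 : ℕ) : ℝ)) {θ : ℝ}
    (hθ : 1 ≤ θ) (hθ3 : θ ^ 3 * lam ≤ lam + 1) {s : QState} (hs : s.Admissible) :
    ∫⁻ z, ENNReal.ofReal (Real.exp (-(step f s z).2)) * weight (ENNReal.ofReal θ) (step f s z).1
      ∂clock lam G ≤ ENNReal.ofReal θ⁻¹ * weight (ENNReal.ofReal θ) s := by
  have hθ0 : 0 < θ := by linarith
  have hm := measurable_weight (ENNReal.ofReal θ)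
  have := isProbabilityMeasure_expMeasure one_pos
  rcases s with n | ⟨n, r⟩
  · rcases n with _ | n
    · have hst := measurable_step_right f empty
      rw [lintegral_clock hlam G (by fun_prop)]
      simp only [step, weight, QState.fold_vacation, lintegral_const, measure_univ, mul_one]
      have h1 := lintegral_expMeasure_exp_neg hlam zero_le_one
      have h2 : ∫⁻ a, ENNReal.ofReal (Real.exp (-a)) ∂expMeasure lam =
          ENNReal.ofReal (lam / (lam + 1)) := by
        rw [← h1]
        refine lintegral_congr_ae ?_
        filter_upwards [ae_expMeasure_nonneg hlam] with a ha
        rw [max_eq_left ha, one_mul]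
      rw [lintegral_mul_const _ (by fun_prop), h2, mul_zero, pow_zero, mul_one,
        ← ENNReal.ofReal_pow hθ0.le, ← ENNReal.ofReal_mul (by positivity)]
      refine ENNReal.ofReal_le_ofReal ?_
      rw [← one_div, le_div_iff₀ hθ0]
      rw [div_mul_eq_mul_div, div_mul_eq_mul_div, div_le_one (by positivity)]
      nlinarith
    · have h1 := lintegral_step_vacation hlam G (hf n) zero_le_one hm
      simp only [one_mul] at h1
      rw [h1]
      simp only [weight, QState.fold_vacation, QState.fold_service, lintegral_const, measure_univ,
        mul_one]
      set φ := f ((n + 1 : ℕ) : ℝ)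
      have hφ : 0 < φ := hf n
      simp only [← ENNReal.ofReal_pow hθ0.le]
      rw [← ENNReal.ofReal_mul (by positivity), ← ENNReal.ofReal_mul (by positivity),
        ← ENNReal.ofReal_mul (by positivity), ← ENNReal.ofReal_add (by positivity) (by positivity)]
      refine ENNReal.ofReal_le_ofReal ?_
      have e1 : θ ^ (2 * (n + 2)) = θ ^ (2 * n + 1) * θ ^ 3 := by ring
      have e2 : θ⁻¹ * θ ^ (2 * (n + 1)) = θ ^ (2 * n + 1) := by
        rw [show 2 * (n + 1) = 2 * n + 1 + 1 by ring, pow_succ]; field_simp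
      rw [e1, e2]
      have : lam / (lam + φ + 1) * θ ^ 3 + φ / (lam + φ + 1) ≤ 1 := by
        rw [div_mul_eq_mul_div, ← add_div, div_le_one (by positivity)]
        linarith
      calc _ = θ ^ (2 * n + 1) * (lam / (lam + φ + 1) * θ ^ 3 + φ / (lam + φ + 1)) := by ring
        _ ≤ θ ^ (2 * n + 1) * 1 := by gcongr
        _ = _ := mul_one _
  · have hr : 0 ≤ r := hs
    rw [lintegral_step_service hlam G f n r
      (g := fun q => ENNReal.ofReal (Real.exp (-q.2)) * weight (ENNReal.ofReal θ) q.1)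
      (by fun_prop)]
    simp only [weight, QState.fold_vacation, QState.fold_service]
    rw [lintegral_mul_const _ (by fun_prop), setLIntegral_expMeasure_exp_neg hlam,
      expMeasure_Ici hlam, max_eq_left hr]
    simp only [← ENNReal.ofReal_pow hθ0.le]
    have he : Real.exp (-((lam + 1) * r)) ≤ 1 := by
      rw [Real.exp_le_one_iff]; nlinarith
    have hE : 0 ≤ lam / (lam + 1) * (1 - Real.exp (-((lam + 1) * r))) :=
      mul_nonneg (by positivity) (by linarith)
    rw [← ENNReal.ofReal_mul hE, ← ENNReal.ofReal_mul (Real.exp_nonneg (-r)),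
      ← ENNReal.ofReal_mul (Real.exp_nonneg _), ← ENNReal.ofReal_mul (inv_nonneg.2 hθ0.le),
      ← ENNReal.ofReal_add (mul_nonneg hE (by positivity)) (by positivity)]
    refine ENNReal.ofReal_le_ofReal ?_
    have e1 : θ ^ (2 * (n + 1) + 1) = θ ^ (2 * n) * θ ^ 3 := by ring
    have e2 : θ⁻¹ * θ ^ (2 * n + 1) = θ ^ (2 * n) := by
      rw [pow_succ]; field_simp
    rw [e1, e2, ← mul_assoc (Real.exp _), ← Real.exp_add,
      show -(lam * r) + -r = -((lam + 1) * r) by ring]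
    set E := Real.exp (-((lam + 1) * r))
    have h3 : lam / (lam + 1) * θ ^ 3 ≤ 1 := by
      rw [div_mul_eq_mul_div, div_le_one (by positivity)]; linarith
    calc _ = θ ^ (2 * n) * (lam / (lam + 1) * θ ^ 3 * (1 - E) + E) := by ring
      _ ≤ θ ^ (2 * n) * (1 * (1 - E) + E) := by gcongr
      _ = _ := by ring

theorem lintegral_exp_neg_eventSeq_le {lam : ℝ} (hlam : 0 < lam) {G : Measure ℝ}
    [IsProbabilityMeasure G] (hG : ∀ᵐ x ∂G, 0 ≤ x) {f : ℝ → ℝ}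
    (hf : ∀ n : ℕ, 0 < f ((n + 1 : ℕ) : ℝ)) {θ : ℝ}
    (hθ : 1 ≤ θ) (hθ3 : θ ^ 3 * lam ≤ lam + 1) (m : ℕ) : ∀ {s : QState}, s.Admissible →
    ∫⁻ ω, ENNReal.ofReal (Real.exp (-(eventSeq f s ω m).2)) ∂clockLaw lam G ≤
      ENNReal.ofReal θ⁻¹ ^ m * weight (ENNReal.ofReal θ) s := by
  have := isProbabilityMeasure_clockLaw hlam G
  have hm := measurable_weight (ENNReal.ofReal θ)
  induction m with
  | zero =>
    intro s hs
    have h1 : 1 ≤ ENNReal.ofReal θ := by simpa using hθ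
    simp only [eventSeq, neg_zero, Real.exp_zero, ENNReal.ofReal_one, lintegral_const, measure_univ,
      mul_one, pow_zero, one_mul]
    rcases s with n | ⟨n, r⟩ <;> exact one_le_pow₀ h1
  | succ m ih =>
    intro s hs
    have hme : Measurable fun ω => eventSeq f s ω (m + 1) :=
      (measurable_eventSeq f (m + 1)).comp
        (measurable_const.prodMk measurable_id : Measurable fun ω : Clocks => (s, ω))
    have hexp : Measurable fun ω => ENNReal.ofReal (Real.exp (-(eventSeq f s ω (m + 1)).2)) :=
      (Real.measurable_exp.comp hme.snd.neg).ennreal_ofReal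
    rw [lintegral_clockLaw hlam G hexp]
    have hst := measurable_step_right f s
    calc _ = ∫⁻ z, ENNReal.ofReal (Real.exp (-(step f s z).2)) *
          ∫⁻ ω, ENNReal.ofReal (Real.exp (-(eventSeq f (step f s z).1 ω m).2)) ∂clockLaw lam G
            ∂clock lam G := by
          refine lintegral_congr fun z => ?_
          have hme' : Measurable fun ω => eventSeq f (step f s z).1 ω m :=
            (measurable_eventSeq f m).comp (measurable_const.prodMk measurable_id :
              Measurable fun ω : Clocks => ((step f s z).1, ω))
          rw [← lintegral_const_mul _ (by fun_prop)]
          refine lintegral_congr fun ω => ?_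
          rw [eventSeq_cons, neg_add, Real.exp_add, ENNReal.ofReal_mul (by positivity)]
      _ ≤ ∫⁻ z, ENNReal.ofReal θ⁻¹ ^ m * (ENNReal.ofReal (Real.exp (-(step f s z).2)) *
          weight (ENNReal.ofReal θ) (step f s z).1) ∂clock lam G := by
          refine lintegral_mono_ae ?_
          filter_upwards [ae_good hlam hG] with z hz
          rw [mul_left_comm]
          gcongr
          exact ih (step_admissible hf hs hz).1
      _ = ENNReal.ofReal θ⁻¹ ^ m * ∫⁻ z, ENNReal.ofReal (Real.exp (-(step f s z).2)) *
          weight (ENNReal.ofReal θ) (step f s z).1 ∂clock lam G :=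
          lintegral_const_mul _ (by fun_prop)
      _ ≤ ENNReal.ofReal θ⁻¹ ^ m * (ENNReal.ofReal θ⁻¹ * weight (ENNReal.ofReal θ) s) := by
          gcongr
          exact lintegral_exp_neg_weight_le hlam hf hθ hθ3 hs
      _ = _ := by rw [pow_succ, mul_assoc]

/-- Almost surely, the event times are unbounded. -/
theorem ae_exists_eventSeq_gt {lam : ℝ} (hlam : 0 < lam) {G : Measure ℝ}
    [IsProbabilityMeasure G] (hG : ∀ᵐ x ∂G, 0 ≤ x) {f : ℝ → ℝ}
    (hf : ∀ n : ℕ, 0 < f ((n + 1 : ℕ) : ℝ)) {s : QState} (hs : s.Admissible) :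
    ∀ᵐ ω ∂clockLaw lam G, ∀ t : ℝ, ∃ m, t < (eventSeq f s ω m).2 := by
  obtain ⟨θ, hθ, hθ3⟩ : ∃ θ : ℝ, 1 < θ ∧ θ ^ 3 * lam ≤ lam + 1 := by
    have h : 0 < min 1 (1 / lam) := by positivity
    -- With δ = min(1, 1/λ) ≤ 1, the terms of (1+δ/7)³ after the first sum to at most δ, as 3+3+1 =
    -- 7; moreover δλ ≤ 1.
    refine ⟨1 + min 1 (1 / lam) / 7, by linarith, ?_⟩
    set δ := min 1 (1 / lam) with hδ
    have h0 : 0 < δ := by positivity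
    have h1 : δ ≤ 1 := min_le_left _ _
    have h2 : δ * lam ≤ 1 := by
      have : δ ≤ 1 / lam := min_le_right _ _
      rwa [le_div_iff₀ hlam] at this
    have h3 : (1 + δ / 7) ^ 3 ≤ 1 + δ := by nlinarith [mul_pos h0 h0]
    calc (1 + δ / 7) ^ 3 * lam ≤ (1 + δ) * lam := by gcongr
      _ ≤ lam + 1 := by linarith
  have hθ0 : 0 < θ := by linarith
  have hme : ∀ m, Measurable fun ω => eventSeq f s ω m := fun m =>
    (measurable_eventSeq f m).comp
      (measurable_const.prodMk measurable_id : Measurable fun ω : Clocks => (s, ω))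
  have hw : weight (ENNReal.ofReal θ) s ≠ ∞ := by
    rcases s with n | ⟨n, r⟩ <;> exact ENNReal.pow_ne_top ENNReal.ofReal_ne_top
  have hk : ENNReal.ofReal θ⁻¹ < 1 := by
    rw [ENNReal.ofReal_lt_one]; exact inv_lt_one_of_one_lt₀ hθ
  -- Geometric decay makes the sum of exp(-T_m), over the event times T_m, integrable. It is
  -- therefore finite almost surely, which forces T_m to infinity.
  have hsum : ∫⁻ ω, ∑' m, ENNReal.ofReal (Real.exp (-(eventSeq f s ω m).2)) ∂clockLaw lam G ≠ ∞ := by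
    rw [lintegral_tsum fun m => by have := hme m; fun_prop]
    refine ne_top_of_le_ne_top ?_ (ENNReal.tsum_le_tsum fun m =>
      lintegral_exp_neg_eventSeq_le hlam hG hf hθ.le hθ3 m hs)
    rw [ENNReal.tsum_mul_right, ENNReal.tsum_geometric]
    refine ENNReal.mul_ne_top ?_ hw
    rw [Ne, ENNReal.inv_eq_top, tsub_eq_zero_iff_le, not_le]
    exact hk
  filter_upwards [ae_lt_top (Measurable.tsum fun m => by have := hme m; fun_prop) hsum]
    with ω hω t
  have h1 := ENNReal.tendsto_atTop_zero_of_tsum_ne_top hω.ne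
  obtain ⟨m, hm⟩ := (h1.eventually_lt_const (u := ENNReal.ofReal (Real.exp (-t)))
    (by simp [Real.exp_pos])).exists
  refine ⟨m, ?_⟩
  rw [ENNReal.ofReal_lt_ofReal_iff (by positivity), Real.exp_lt_exp] at hm
  linarith

/-! ### Transition probabilities -/

/-- Event that at time `x` exactly `k` events have happened, and `j` customers are present. -/
def atEvent (f : ℝ → ℝ) (j k : ℕ) (s : QState) (x : ℝ) : Set Clocks :=
  {ω | (eventSeq f s ω k).2 ≤ x ∧ x < (eventSeq f s ω (k + 1)).2 ∧
    (eventSeq f s ω k).1.customers = j}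

/-- Probability that `j` customers are present at time `x`, by number of events. -/
noncomputable def transProb (lam : ℝ) (G : Measure ℝ) (f : ℝ → ℝ) (j : ℕ) (q : QState × ℝ) :
    ℝ≥0∞ :=
  ∑' k, clockLaw lam G (atEvent f j k q.1 q.2)

/-- Probability that no event happens until time `x`. -/
noncomputable def surv (lam : ℝ) (G : Measure ℝ) (f : ℝ → ℝ) (q : QState × ℝ) : ℝ≥0∞ :=
  if 0 ≤ q.2 then clock lam G {z | q.2 < (step f q.1 z).2} else 0

theorem measurableSet_atEvent (f : ℝ → ℝ) (j k : ℕ) :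
    MeasurableSet {p : (QState × ℝ) × Clocks | p.2 ∈ atEvent f j k p.1.1 p.1.2} := by
  have h : ∀ k, Measurable fun p : (QState × ℝ) × Clocks => eventSeq f p.1.1 p.2 k := fun k =>
    (measurable_eventSeq f k).comp
      ((measurable_fst.comp measurable_fst).prodMk measurable_snd :
        Measurable fun p : (QState × ℝ) × Clocks => (p.1.1, p.2))
  have hx : Measurable fun p : (QState × ℝ) × Clocks => p.1.2 := by fun_prop
  exact (measurableSet_le (h k).snd hx).inter ((measurableSet_lt hx (h (k + 1)).snd).inter
    ((measurable_customers.comp (h k).fst) (measurableSet_singleton j)))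

theorem measurableSet_atEvent_right (f : ℝ → ℝ) (j k : ℕ) (s : QState) (x : ℝ) :
    MeasurableSet (atEvent f j k s x) :=
  (measurable_prodMk_left (x := (s, x))) (measurableSet_atEvent f j k)

theorem measurable_transProb {lam : ℝ} (hlam : 0 < lam) (G : Measure ℝ) [IsProbabilityMeasure G]
    (f : ℝ → ℝ) (j : ℕ) : Measurable (transProb lam G f j) := by
  have := isProbabilityMeasure_clockLaw hlam G
  exact Measurable.tsum fun k => measurable_measure_prodMk_left (measurableSet_atEvent f j k)

theorem measurable_surv {lam : ℝ} (hlam : 0 < lam) (G : Measure ℝ) [IsProbabilityMeasure G]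
    (f : ℝ → ℝ) : Measurable (surv lam G f) := by
  have := isProbabilityMeasure_clock hlam G
  refine Measurable.ite (measurable_snd measurableSet_Ici) ?_ measurable_const
  have hm : Measurable fun p : (QState × ℝ) × (ℝ × ℝ × ℝ) => step f p.1.1 p.2 :=
    (measurable_step f).comp ((measurable_fst.comp measurable_fst).prodMk measurable_snd)
  have : MeasurableSet {p : (QState × ℝ) × (ℝ × ℝ × ℝ) | p.1.2 < (step f p.1.1 p.2).2} :=
    measurableSet_lt (by fun_prop) hm.snd
  exact measurable_measure_prodMk_left this

theorem clockLaw_atEvent_zero {lam : ℝ} (hlam : 0 < lam) (G : Measure ℝ) [IsProbabilityMeasure G]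
    (f : ℝ → ℝ) (j : ℕ) (q : QState × ℝ) :
    clockLaw lam G (atEvent f j 0 q.1 q.2) =
      if q.1.customers = j then surv lam G f q else 0 := by
  have := isProbabilityMeasure_clockLaw hlam G
  rw [← lintegral_indicator_one (measurableSet_atEvent_right f j 0 q.1 q.2),
    lintegral_clockLaw hlam G (measurable_one.indicator (measurableSet_atEvent_right f j 0 q.1 q.2))]
  have hS : MeasurableSet {z | q.2 < (step f q.1 z).2} :=
    measurableSet_lt measurable_const (measurable_step_right f q.1).snd
  by_cases h : q.1.customers = j ∧ 0 ≤ q.2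
  · rw [if_pos h.1, surv, if_pos h.2, ← lintegral_indicator_one hS]
    refine lintegral_congr fun z => ?_
    have : ∀ ω, (atEvent f j 0 q.1 q.2).indicator (1 : Clocks → ℝ≥0∞) (consClocks z ω) =
        {z | q.2 < (step f q.1 z).2}.indicator 1 z := by
      intro ω
      simp [indicator, atEvent, eventSeq, consClocks, h.1, h.2]
    simp [this]
  · have h0 : ∀ z ω, (atEvent f j 0 q.1 q.2).indicator (1 : Clocks → ℝ≥0∞) (consClocks z ω) = 0 := by
      intro z ω
      rw [indicator_of_notMem]
      rintro ⟨h1, -, h2⟩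
      exact h ⟨h2, h1⟩
    simp only [h0, lintegral_zero]
    rw [surv]
    split_ifs with h1 h2
    · exact absurd ⟨h1, h2⟩ h
    · rfl
    · rfl

theorem clockLaw_atEvent_succ {lam : ℝ} (hlam : 0 < lam) (G : Measure ℝ) [IsProbabilityMeasure G]
    (f : ℝ → ℝ) (j k : ℕ) (s : QState) (x : ℝ) :
    clockLaw lam G (atEvent f j (k + 1) s x) =
      ∫⁻ z, clockLaw lam G (atEvent f j k (step f s z).1 (x - (step f s z).2)) ∂clock lam G := by
  rw [← lintegral_indicator_one (measurableSet_atEvent_right f j (k + 1) s x),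
    lintegral_clockLaw hlam G (measurable_one.indicator
      (measurableSet_atEvent_right f j (k + 1) s x))]
  refine lintegral_congr fun z => ?_
  rw [← lintegral_indicator_one (measurableSet_atEvent_right f j k _ _)]
  refine lintegral_congr fun ω => ?_
  have : consClocks z ω ∈ atEvent f j (k + 1) s x ↔
      ω ∈ atEvent f j k (step f s z).1 (x - (step f s z).2) := by
    simp only [atEvent, mem_ofPred_eq, eventSeq_cons, le_sub_iff_add_le', sub_lt_iff_lt_add']
  by_cases h : consClocks z ω ∈ atEvent f j (k + 1) s x
  · rw [indicator_of_mem h, indicator_of_mem (this.1 h)]; rfl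
  · rw [indicator_of_notMem h, indicator_of_notMem (fun h' => h (this.2 h'))]

/-- Backward equation. -/
theorem transProb_eq {lam : ℝ} (hlam : 0 < lam) (G : Measure ℝ) [IsProbabilityMeasure G]
    (f : ℝ → ℝ) (j : ℕ) (q : QState × ℝ) :
    transProb lam G f j q = (if q.1.customers = j then surv lam G f q else 0) +
      ∫⁻ z, transProb lam G f j ((step f q.1 z).1, q.2 - (step f q.1 z).2) ∂clock lam G := by
  have := isProbabilityMeasure_clockLaw hlam G
  rw [transProb, tsum_eq_zero_add' ENNReal.summable, clockLaw_atEvent_zero hlam]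
  congr 1
  simp only [transProb]
  rw [lintegral_tsum]
  · exact tsum_congr fun k => clockLaw_atEvent_succ hlam G f j k _ _
  · intro k
    have hst := measurable_step_right f q.1
    have h1 : Measurable fun q : QState × ℝ => clockLaw lam G (atEvent f j k q.1 q.2) :=
      measurable_measure_prodMk_left (measurableSet_atEvent f j k)
    exact (h1.comp (hst.fst.prodMk (measurable_const.sub hst.snd))).aemeasurable

/-- Event times are monotone and unbounded almost surely, so exactly one index k has T_k ≤ t <
T_{k+1}, and it is the supremum in `stateAt`. Under explosion that supremum could be the default
value 0 of an unbounded set of naturals. -/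
theorem clockLaw_numCustomers {lam : ℝ} (hlam : 0 < lam) {G : Measure ℝ}
    [IsProbabilityMeasure G] (hG : ∀ᵐ x ∂G, 0 ≤ x) {f : ℝ → ℝ}
    (hf : ∀ n : ℕ, 0 < f ((n + 1 : ℕ) : ℝ)) {s : QState} (hs : s.Admissible) (j : ℕ) {t : ℝ}
    (ht : 0 ≤ t) :
    clockLaw lam G {ω | numCustomers f s ω t = j} = transProb lam G f j (s, t) := by
  have hgood : ∀ᵐ ω ∂clockLaw lam G, (∀ m, Good (ω m)) ∧ ∃ m, t < (eventSeq f s ω m).2 := by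
    filter_upwards [ae_good_clocks hlam hG, ae_exists_eventSeq_gt hlam hG hf hs] with ω h1 h2
    exact ⟨h1, h2 t⟩
  have huniq : ∀ ω, (∀ m, Good (ω m)) → ∀ k, (eventSeq f s ω k).2 ≤ t →
      t < (eventSeq f s ω (k + 1)).2 → sSup {m : ℕ | (eventSeq f s ω m).2 ≤ t} = k := by
    intro ω hω k h1 h2
    have hmono := eventSeq_monotone hf hs hω
    refine IsGreatest.csSup_eq ⟨h1, fun m hm => ?_⟩
    by_contra hkm
    have h3 : (eventSeq f s ω (k + 1)).2 ≤ (eventSeq f s ω m).2 := hmono (by omega)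
    have h4 : (eventSeq f s ω m).2 ≤ t := hm
    linarith
  have hae : {ω | numCustomers f s ω t = j} =ᵐ[clockLaw lam G] ⋃ k, atEvent f j k s t := by
    rw [eventuallyEq_set]
    filter_upwards [hgood] with ω hω
    obtain ⟨hω, hex⟩ := hω
    simp only [mem_iUnion]
    constructor
    · intro h
      classical
      have hN := Nat.find_spec hex
      have hN0 : Nat.find hex ≠ 0 := by
        intro h0
        rw [h0] at hN
        simp only [eventSeq] at hN
        linarith
      obtain ⟨k, hk⟩ := Nat.exists_eq_succ_of_ne_zero hN0
      have h1 : (eventSeq f s ω k).2 ≤ t := not_lt.1 (Nat.find_min hex (by omega))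
      have h2 : t < (eventSeq f s ω (k + 1)).2 := by rw [hk] at hN; exact hN
      refine ⟨k, h1, h2, ?_⟩
      rwa [numCustomers, stateAt, huniq ω hω k h1 h2] at h
    · rintro ⟨k, h1, h2, h3⟩
      rwa [numCustomers, stateAt, huniq ω hω k h1 h2]
  rw [measure_congr hae, transProb]
  refine measure_iUnion₀ ?_ fun k => (measurableSet_atEvent_right f j k s t).nullMeasurableSet
  intro k l hkl
  rw [Function.onFun, AEDisjoint, measure_eq_zero_iff_ae_notMem]
  filter_upwards [hgood] with ω hω
  rintro ⟨⟨h1, h2, -⟩, ⟨h3, h4, -⟩⟩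
  exact hkl ((huniq ω hω.1 k h1 h2).symm.trans (huniq ω hω.1 l h3 h4))

/-- Vanishing at negative times lets the renewal equations be written as convolutions over the whole
line. -/
theorem transProb_of_neg {lam : ℝ} (hlam : 0 < lam) {G : Measure ℝ}
    [IsProbabilityMeasure G] (hG : ∀ᵐ x ∂G, 0 ≤ x) {f : ℝ → ℝ}
    (hf : ∀ n : ℕ, 0 < f ((n + 1 : ℕ) : ℝ)) {s : QState} (hs : s.Admissible) (j : ℕ) {t : ℝ}
    (ht : t < 0) : transProb lam G f j (s, t) = 0 := by
  rw [transProb, ENNReal.tsum_eq_zero]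
  intro k
  rw [measure_eq_zero_iff_ae_notMem]
  filter_upwards [ae_good_clocks hlam hG] with ω hω
  rintro ⟨h1, -, -⟩
  have h2 : (eventSeq f s ω 0).2 ≤ (eventSeq f s ω k).2 := eventSeq_monotone hf hs hω (Nat.zero_le k)
  simp only [eventSeq] at h2
  linarith

theorem transProb_le_one {lam : ℝ} (hlam : 0 < lam) {G : Measure ℝ}
    [IsProbabilityMeasure G] (hG : ∀ᵐ x ∂G, 0 ≤ x) {f : ℝ → ℝ}
    (hf : ∀ n : ℕ, 0 < f ((n + 1 : ℕ) : ℝ)) {s : QState} (hs : s.Admissible) (j : ℕ) (t : ℝ) :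
    transProb lam G f j (s, t) ≤ 1 := by
  have := isProbabilityMeasure_clockLaw hlam G
  rcases lt_or_ge t 0 with h | h
  · rw [transProb_of_neg hlam hG hf hs j h]; exact zero_le
  · rw [← clockLaw_numCustomers hlam hG hf hs j h]; exact prob_le_one

/-! ### Convergence in distribution -/

section Limit

variable {lam : ℝ} {G : Measure ℝ} {f : ℝ → ℝ}

theorem sFinite_occ [IsProbabilityMeasure G] (hlam : 0 < lam) (f : ℝ → ℝ) (s : QState) :
    SFinite (occ lam G f s) := by
  have := isFiniteMeasure_tabooLaw (G := G) f hlam s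
  unfold occ
  infer_instance

theorem ae_occ [IsProbabilityMeasure G] (hlam : 0 < lam) (hG : ∀ᵐ x ∂G, 0 ≤ x)
    (hf : ∀ n : ℕ, 0 < f ((n + 1 : ℕ) : ℝ)) {s : QState} (hs : s.Admissible) :
    ∀ᵐ p ∂occ lam G f s, p.1 ≠ empty ∧ 0 ≤ p.2 := by
  rw [occ, Measure.ae_sum_iff]
  intro k
  filter_upwards [ae_restrict_mem measurableSet_busy,
    ae_restrict_of_ae (ae_tabooLaw hlam hG hf hs k)] with p hp1 hp2
  exact ⟨hp1, hp2.2⟩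

theorem ae_hit [IsProbabilityMeasure G] (hlam : 0 < lam) (hG : ∀ᵐ x ∂G, 0 ≤ x)
    (hf : ∀ n : ℕ, 0 < f ((n + 1 : ℕ) : ℝ)) {s : QState} (hs : s.Admissible) :
    ∀ᵐ y ∂hit lam G f s, 0 ≤ y := by
  rw [hit, Measure.ae_sum_iff]
  intro k
  rw [ae_map_iff measurable_snd.aemeasurable measurableSet_Ici]
  exact ae_restrict_of_ae ((ae_tabooLaw hlam hG hf hs k).mono fun p hp => hp.2)

/-- Expectation of `c` at the current state, on the event that the system has not been empty up to
time `t`. -/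
noncomputable def pending (lam : ℝ) (G : Measure ℝ) (f : ℝ → ℝ) (c : QState → ℝ≥0∞) (s : QState)
    (t : ℝ) : ℝ≥0∞ :=
  ∫⁻ p, c p.1 * surv lam G f (p.1, t - p.2) ∂occ lam G f s

theorem measurable_pending_integrand [IsProbabilityMeasure G] (hlam : 0 < lam) (f : ℝ → ℝ)
    {c : QState → ℝ≥0∞} (hc : Measurable c) :
    Measurable fun q : ℝ × (QState × ℝ) => c q.2.1 * surv lam G f (q.2.1, q.1 - q.2.2) := by
  have h1 := measurable_surv hlam G f
  have h2 : Measurable fun q : ℝ × (QState × ℝ) => (q.2.1, q.1 - q.2.2) :=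
    measurable_snd.fst.prodMk (measurable_fst.sub measurable_snd.snd)
  exact (hc.comp measurable_snd.fst).mul (h1.comp h2)

theorem measurable_pending [IsProbabilityMeasure G] (hlam : 0 < lam) (f : ℝ → ℝ)
    {c : QState → ℝ≥0∞} (hc : Measurable c) (s : QState) :
    Measurable (pending lam G f c s) := by
  have := sFinite_occ (G := G) hlam f s
  exact (measurable_pending_integrand hlam f hc).lintegral_prod_right'

theorem lintegral_surv (lam : ℝ) (G : Measure ℝ) (f : ℝ → ℝ) (x : QState) :
    ∫⁻ t, surv lam G f (x, t) = meanDur lam G f x := by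
  rw [meanDur, ← lintegral_indicator measurableSet_Ici]
  refine lintegral_congr fun t => ?_
  simp [surv, indicator]

theorem lintegral_pending [IsProbabilityMeasure G] (hlam : 0 < lam) (hG : ∀ᵐ x ∂G, 0 ≤ x)
    (hf : ∀ n : ℕ, 0 < f ((n + 1 : ℕ) : ℝ)) {c : QState → ℝ≥0∞} (hc : Measurable c) {s : QState}
    (hs : s.Admissible) :
    ∫⁻ t, pending lam G f c s t = ∫⁻ p, c p.1 * durFun lam f p.1 ∂occ lam G f s := by
  have := sFinite_occ (G := G) hlam f s
  simp only [pending]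
  rw [lintegral_lintegral_swap (measurable_pending_integrand hlam f hc).aemeasurable]
  refine lintegral_congr_ae ?_
  filter_upwards [ae_occ hlam hG hf hs] with p hp
  have h1 := measurable_surv hlam G f
  have h2 : Measurable fun t => surv lam G f (p.1, t - p.2) :=
    h1.comp (measurable_const.prodMk (measurable_id.sub_const p.2))
  rw [lintegral_const_mul _ h2,
    lintegral_sub_right_eq_self (fun t => surv lam G f (p.1, t)) p.2, lintegral_surv,
    meanDur_eq_durFun hlam hf hp.1]

theorem pending_of_neg [IsProbabilityMeasure G] (hlam : 0 < lam) (hG : ∀ᵐ x ∂G, 0 ≤ x)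
    (hf : ∀ n : ℕ, 0 < f ((n + 1 : ℕ) : ℝ)) (c : QState → ℝ≥0∞) {s : QState}
    (hs : s.Admissible) {t : ℝ} (ht : t < 0) : pending lam G f c s t = 0 := by
  rw [pending, ← lintegral_zero (μ := occ lam G f s)]
  refine lintegral_congr_ae ?_
  filter_upwards [ae_occ hlam hG hf hs] with p hp
  have h : ¬ 0 ≤ t - p.2 := by linarith [hp.2]
  simp [surv, h]

/-- The decomposition at the first emptiness, applied to the constant function 1. -/
theorem hit_univ [IsProbabilityMeasure G] (hlam : 0 < lam) (hG : ∀ᵐ x ∂G, 0 ≤ x)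
    (hf : ∀ n : ℕ, 0 < f ((n + 1 : ℕ) : ℝ)) {s : QState} (hs : s.Admissible)
    (h0 : Tendsto (fun m => tabooLaw lam G f s m univ) atTop (𝓝 0)) :
    hit lam G f s univ = 1 := by
  have := isProbabilityMeasure_clock hlam G
  have h := eq_lintegral_occ_add_hit hlam hG hf (u := fun _ => 1) (a := fun _ => 0)
    measurable_const measurable_const (by simp) (by simp) hs h0
  simpa using h.symm

/-- The decomposition at the first emptiness for the indicator of times up to `t`: a path leaves it
through an event that straddles `t`, and `surv` is the probability of that. -/
theorem pending_one_add_hit [IsProbabilityMeasure G] (hlam : 0 < lam) (hG : ∀ᵐ x ∂G, 0 ≤ x)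
    (hf : ∀ n : ℕ, 0 < f ((n + 1 : ℕ) : ℝ)) {s : QState} (hs : s.Admissible)
    (h0 : Tendsto (fun m => tabooLaw lam G f s m univ) atTop (𝓝 0)) {t : ℝ} (ht : 0 ≤ t) :
    pending lam G f (fun _ => 1) s t + hit lam G f s (Iic t) = 1 := by
  have := isProbabilityMeasure_clock hlam G
  have h := eq_lintegral_occ_add_hit hlam hG hf
    (u := (univ ×ˢ Iic t).indicator fun _ => 1) (a := fun p => surv lam G f (p.1, t - p.2))
    (measurable_const.indicator (MeasurableSet.univ.prod measurableSet_Iic))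
    ((measurable_surv hlam G f).comp (measurable_fst.prodMk (measurable_const.sub measurable_snd)))
    ?_ ?_ hs h0
  · have h1 : ∫⁻ y, (univ ×ˢ Iic t : Set (QState × ℝ)).indicator (fun _ => (1 : ℝ≥0∞)) (empty, y)
        ∂hit lam G f s = hit lam G f s (Iic t) := by
      rw [← lintegral_indicator_one measurableSet_Iic]
      refine lintegral_congr fun y => ?_
      simp [indicator]
    rw [h1] at h
    simp only [pending, one_mul]
    rw [← h]
    simp [indicator, ht]
  · intro p hp _ _
    have hm : Measurable fun z => (step f p.1 z).2 := (measurable_step_right f p.1).snd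
    have h2 : ∫⁻ z, (univ ×ˢ Iic t : Set (QState × ℝ)).indicator (fun _ => (1 : ℝ≥0∞))
        (advance f (p, z)) ∂clock lam G = clock lam G {z | (step f p.1 z).2 ≤ t - p.2} := by
      rw [← lintegral_indicator_one (measurableSet_le hm measurable_const)]
      refine lintegral_congr fun z => ?_
      simp [indicator, advance, le_sub_iff_add_le']
    rw [h2]
    by_cases hpt : p.2 ≤ t
    · have h3 : 0 ≤ t - p.2 := by linarith
      rw [surv, if_pos h3, ← measure_union _ (measurableSet_le hm measurable_const)]
      · have : {z | t - p.2 < (step f p.1 z).2} ∪ {z | (step f p.1 z).2 ≤ t - p.2} = univ := by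
          ext z; simpa using lt_or_ge _ _
        rw [this, measure_univ]
        simp [indicator, hpt]
      · exact disjoint_left.2 fun z h1 h2 => not_le.2 (show t - p.2 < _ from h1) h2
    · have h3 : ¬ 0 ≤ t - p.2 := by linarith
      have h4 : clock lam G {z | (step f p.1 z).2 ≤ t - p.2} = 0 := by
        rw [measure_eq_zero_iff_ae_notMem]
        filter_upwards [ae_good hlam hG] with z hz h5
        have := (step_admissible hf hp hz).2
        have h6 : (step f p.1 z).2 ≤ t - p.2 := h5
        linarith
      rw [surv, if_neg h3, h4]
      simp [indicator, hpt]
  · intro p _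
    exact indicator_le_self' (fun _ _ => zero_le) p

theorem pending_one [IsProbabilityMeasure G] (hlam : 0 < lam) (hG : ∀ᵐ x ∂G, 0 ≤ x)
    (hf : ∀ n : ℕ, 0 < f ((n + 1 : ℕ) : ℝ)) {s : QState} (hs : s.Admissible)
    (h0 : Tendsto (fun m => tabooLaw lam G f s m univ) atTop (𝓝 0)) {t : ℝ} (ht : 0 ≤ t) :
    pending lam G f (fun _ => 1) s t = hit lam G f s (Ioi t) := by
  have : IsProbabilityMeasure (hit lam G f s) := ⟨hit_univ hlam hG hf hs h0⟩
  have h := pending_one_add_hit hlam hG hf hs h0 ht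
  have h2 : hit lam G f s (Ioi t) + hit lam G f s (Iic t) = 1 := by
    rw [← compl_Iic, add_comm, measure_add_measure_compl measurableSet_Iic, measure_univ]
  exact (ENNReal.add_left_inj (measure_ne_top _ _)).1 (h.trans h2.symm)

theorem tendsto_pending [IsProbabilityMeasure G] (hlam : 0 < lam) (hG : ∀ᵐ x ∂G, 0 ≤ x)
    (hf : ∀ n : ℕ, 0 < f ((n + 1 : ℕ) : ℝ)) {s : QState} (hs : s.Admissible)
    (h0 : Tendsto (fun m => tabooLaw lam G f s m univ) atTop (𝓝 0)) {c : QState → ℝ≥0∞}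
    (hc : ∀ x, c x ≤ 1) : Tendsto (pending lam G f c s) atTop (𝓝 0) := by
  have : IsProbabilityMeasure (hit lam G f s) := ⟨hit_univ hlam hG hf hs h0⟩
  have h1 : Tendsto (fun t => 1 - hit lam G f s (Iic t)) atTop (𝓝 (1 - 1)) := by
    have := tendsto_measure_Iic_atTop (hit lam G f s)
    rw [measure_univ] at this
    exact ENNReal.Tendsto.sub tendsto_const_nhds this (Or.inl ENNReal.one_ne_top)
  rw [tsub_self] at h1
  refine tendsto_of_tendsto_of_tendsto_of_le_of_le' tendsto_const_nhds h1
    (Eventually.of_forall fun _ => zero_le) ?_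
  filter_upwards [eventually_ge_atTop 0] with t ht
  refine le_trans ?_ (ENNReal.le_sub_of_add_le_right (measure_ne_top _ _)
    (pending_one_add_hit hlam hG hf hs h0 ht).le)
  exact lintegral_mono fun p => mul_le_mul_left (hc p.1) _

theorem pending_le_one [IsProbabilityMeasure G] (hlam : 0 < lam) (hG : ∀ᵐ x ∂G, 0 ≤ x)
    (hf : ∀ n : ℕ, 0 < f ((n + 1 : ℕ) : ℝ)) {s : QState} (hs : s.Admissible)
    (h0 : Tendsto (fun m => tabooLaw lam G f s m univ) atTop (𝓝 0)) {c : QState → ℝ≥0∞}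
    (hc : ∀ x, c x ≤ 1) (t : ℝ) : pending lam G f c s t ≤ 1 := by
  rcases lt_or_ge t 0 with ht | ht
  · rw [pending_of_neg hlam hG hf c hs ht]; exact zero_le
  · rw [← pending_one_add_hit hlam hG hf hs h0 ht]
    refine le_add_right ?_
    exact lintegral_mono fun p => mul_le_mul_left (hc p.1) _

/-- Indicator of having `j` customers. -/
def levelInd (j : ℕ) (x : QState) : ℝ≥0∞ := if x.customers = j then 1 else 0

theorem measurable_levelInd (j : ℕ) : Measurable (levelInd j) :=
  (measurable_of_countable fun n : ℕ => if n = j then (1 : ℝ≥0∞) else 0).comp measurable_customers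

theorem levelInd_le_one (j : ℕ) (x : QState) : levelInd j x ≤ 1 := by
  unfold levelInd; split_ifs <;> simp

/-- The backward equation `transProb_eq`, read at the remaining time, is the one-step identity
required by the decomposition at the first emptiness. -/
theorem transProb_eq_pending_add [IsProbabilityMeasure G] (hlam : 0 < lam)
    (hG : ∀ᵐ x ∂G, 0 ≤ x) (hf : ∀ n : ℕ, 0 < f ((n + 1 : ℕ) : ℝ)) {s : QState}
    (hs : s.Admissible) (h0 : Tendsto (fun m => tabooLaw lam G f s m univ) atTop (𝓝 0)) (j : ℕ)
    (t : ℝ) :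
    transProb lam G f j (s, t) = pending lam G f (levelInd j) s t +
      ∫⁻ y, transProb lam G f j (empty, t - y) ∂hit lam G f s := by
  have hm : Measurable fun p : QState × ℝ => (p.1, t - p.2) :=
    measurable_fst.prodMk (measurable_const.sub measurable_snd)
  have h := eq_lintegral_occ_add_hit hlam hG hf
    (u := fun p => transProb lam G f j (p.1, t - p.2))
    (a := fun p => levelInd j p.1 * surv lam G f (p.1, t - p.2))
    ((measurable_transProb hlam G f j).comp hm)
    (((measurable_levelInd j).comp measurable_fst).mul ((measurable_surv hlam G f).comp hm))
    (fun p _ _ _ => ?_) (fun p hp => transProb_le_one hlam hG hf hp j _) hs h0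
  · simpa [pending] using h
  · rw [transProb_eq hlam G f j]
    simp [levelInd, advance, sub_sub]

theorem transProb_empty [IsProbabilityMeasure G] (hlam : 0 < lam) (f : ℝ → ℝ) (j : ℕ) {t : ℝ}
    (ht : 0 ≤ t) :
    transProb lam G f j (empty, t) = (if j = 0 then 1 else 0) *
      ENNReal.ofReal (Real.exp (-(lam * t))) +
        ∫⁻ x, transProb lam G f j (.vacation 1, t - x) ∂expMeasure lam := by
  have h1 : IsProbabilityMeasure (expMeasure lam) := isProbabilityMeasure_expMeasure hlam
  have h2 : IsProbabilityMeasure (expMeasure 1) := isProbabilityMeasure_expMeasure one_pos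
  have hfst : (clock lam G).map Prod.fst = expMeasure lam := by
    rw [clock, Measure.map_fst_prod, measure_univ, one_smul]
  have hs : surv lam G f (empty, t) = ENNReal.ofReal (Real.exp (-(lam * t))) := by
    rw [surv, if_pos ht]
    have : {z | t < (step f empty z).2} = Prod.fst ⁻¹' Ioi t := rfl
    rw [this, ← Measure.map_apply measurable_fst measurableSet_Ioi, hfst, expMeasure_Ioi hlam,
      max_eq_left ht]
  have hm : Measurable fun x => transProb lam G f j (.vacation 1, t - x) :=
    (measurable_transProb hlam G f j).comp
      (measurable_const.prodMk (measurable_const.sub measurable_id))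
  rw [transProb_eq hlam G f j, hs, ← hfst, lintegral_map hm measurable_fst]
  congr 1
  rcases eq_or_ne j 0 with rfl | hj
  · simp [QState.customers]
  · simp [QState.customers, hj, hj.symm]

/-- Long-run fraction of time with `j` customers. -/
noncomputable def levelFrac (lam : ℝ) (G : Measure ℝ) (f : ℝ → ℝ) (j : ℕ) : ℝ≥0∞ :=
  ((if j = 0 then 1 else 0) +
      ENNReal.ofReal lam * occInt lam G f (fun x => levelInd j x * durFun lam f x)) /
    (1 + ENNReal.ofReal lam * occInt lam G f (durFun lam f))

/-- From `empty` this is the renewal theorem. Any other initial state reaches `empty` at an almost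
surely finite time, and dominated convergence over that time transfers the limit. -/
theorem tendsto_transProb [IsProbabilityMeasure G] (hlam : 0 < lam)
    (hG : ∀ᵐ x ∂G, 0 ≤ x) (hf : ∀ n : ℕ, 0 < f ((n + 1 : ℕ) : ℝ))
    (h0 : ∀ s, Tendsto (fun m => tabooLaw lam G f s m univ) atTop (𝓝 0))
    (hfin : occInt lam G f (durFun lam f) ≠ ∞) (j : ℕ) {s : QState} (hs : s.Admissible) :
    Tendsto (fun t => transProb lam G f j (s, t)) atTop (𝓝 (levelFrac lam G f j)) := by
  have hadm : ∀ n, (QState.vacation n).Admissible := fun _ => trivial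
  have hmeas : ∀ x, Measurable fun t => transProb lam G f j (x, t) := fun x =>
    (measurable_transProb hlam G f j).comp (measurable_const.prodMk measurable_id)
  -- The mean hitting time, as the integral of its tail, is the total expected duration of the busy
  -- events.
  have hI : ∫⁻ y in Ici 0, hit lam G f (.vacation 1) (Ioi y) = occInt lam G f (durFun lam f) := by
    calc _ = ∫⁻ t in Ici 0, pending lam G f (fun _ => 1) (.vacation 1) t :=
          (setLIntegral_congr_fun measurableSet_Ici fun t ht =>
            (pending_one hlam hG hf (hadm 1) (h0 _) ht)).symm
      _ = ∫⁻ t, pending lam G f (fun _ => 1) (.vacation 1) t := by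
          rw [← lintegral_indicator measurableSet_Ici]
          refine lintegral_congr fun t => ?_
          by_cases ht : 0 ≤ t
          · simp [indicator, ht]
          · rw [pending_of_neg hlam hG hf _ (hadm 1) (not_le.1 ht)]
            simp [indicator, ht]
      _ = _ := by
          rw [lintegral_pending hlam hG hf measurable_const (hadm 1)]
          simp [occInt]
  have hprob : ∀ {s : QState}, s.Admissible → IsProbabilityMeasure (hit lam G f s) :=
    fun hs => ⟨hit_univ hlam hG hf hs (h0 _)⟩
  have := hprob (hadm 1)
  have key : Tendsto (fun t => transProb lam G f j (empty, t)) atTop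
      (𝓝 (levelFrac lam G f j)) := by
    have := renewal_limit hlam (F := hit lam G f (.vacation 1)) (ae_hit hlam hG hf (hadm 1))
      (u := fun t => transProb lam G f j (empty, t))
      (w := fun t => transProb lam G f j (.vacation 1, t))
      (h := pending lam G f (levelInd j) (.vacation 1)) (c := if j = 0 then 1 else 0)
      (hmeas _) (hmeas _) (measurable_pending hlam f (measurable_levelInd j) _)
      (fun t => transProb_le_one hlam hG hf (hadm 0) j t)
      (fun t ht => transProb_of_neg hlam hG hf (hadm 0) j ht)
      (fun t ht => transProb_of_neg hlam hG hf (hadm 1) j ht)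
      (pending_le_one hlam hG hf (hadm 1) (h0 _) (levelInd_le_one j))
      (tendsto_pending hlam hG hf (hadm 1) (h0 _) (levelInd_le_one j))
      (by split_ifs <;> simp) (fun t ht => transProb_empty hlam f j ht)
      (fun t => transProb_eq_pending_add hlam hG hf (hadm 1) (h0 _) j t)
      (by rw [hI]; exact hfin)
    rw [hI, lintegral_pending hlam hG hf (measurable_levelInd j) (hadm 1)] at this
    exact this
  have := hprob hs
  simp_rw [transProb_eq_pending_add hlam hG hf hs (h0 s) j]
  rw [← zero_add (levelFrac lam G f j)]
  refine (tendsto_pending hlam hG hf hs (h0 _) (levelInd_le_one j)).add ?_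
  have h1 : ∫⁻ _, levelFrac lam G f j ∂hit lam G f s = levelFrac lam G f j := by simp
  rw [← h1]
  refine tendsto_lintegral_filter_of_dominated_convergence (fun _ => 1)
    (Eventually.of_forall fun t => ((hmeas _).comp (measurable_const.sub measurable_id)))
    (Eventually.of_forall fun t => ae_of_all _ fun y =>
      transProb_le_one hlam hG hf (hadm 0) j _) (by simp) (ae_of_all _ fun y => ?_)
  exact key.comp (tendsto_atTop_add_const_right _ (-y) tendsto_id)

/-- With φ = 1 this says that the fractions form a probability law; with φ(j) = j it gives the mean.
-/
theorem tsum_mul_levelFrac (lam : ℝ) (G : Measure ℝ) (f : ℝ → ℝ) (φ : ℕ → ℝ≥0∞) :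
    ∑' j, φ j * levelFrac lam G f j =
      (φ 0 + ENNReal.ofReal lam * occInt lam G f (fun x => φ x.customers * durFun lam f x)) /
        (1 + ENNReal.ofReal lam * occInt lam G f (durFun lam f)) := by
  have h1 : ∑' j, φ j * occInt lam G f (fun x => levelInd j x * durFun lam f x) =
      occInt lam G f (fun x => φ x.customers * durFun lam f x) := by
    have hm : ∀ j, Measurable fun p : QState × ℝ => levelInd j p.1 * durFun lam f p.1 := fun j =>
      ((measurable_levelInd j).comp measurable_fst).mul
        ((measurable_durFun lam f).comp measurable_fst)
    simp only [occInt]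
    calc _ = ∑' j, ∫⁻ p, φ j * (levelInd j p.1 * durFun lam f p.1) ∂occ lam G f (.vacation 1) :=
          tsum_congr fun j => (lintegral_const_mul _ (hm j)).symm
      _ = ∫⁻ p, ∑' j, φ j * (levelInd j p.1 * durFun lam f p.1) ∂occ lam G f (.vacation 1) :=
          (lintegral_tsum fun j => ((hm j).const_mul _).aemeasurable).symm
      _ = _ := by
          refine lintegral_congr fun p => ?_
          rw [tsum_eq_single p.1.customers]
          · simp [levelInd]
          · intro j hj
            simp [levelInd, hj.symm]
  have h2 : ∑' j, φ j * (if j = 0 then 1 else 0) = φ 0 := by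
    rw [tsum_eq_single 0 (by intro j hj; simp [hj])]
    simp
  simp only [levelFrac, div_eq_mul_inv, ← mul_assoc, mul_add]
  rw [ENNReal.tsum_mul_right, ENNReal.tsum_add, h2]
  congr 2
  rw [← h1, ← ENNReal.tsum_mul_left]
  exact tsum_congr fun j => by ring

theorem exists_steadyState [IsProbabilityMeasure G] (hlam : 0 < lam)
    (hG : ∀ᵐ x ∂G, 0 ≤ x) (hf : ∀ n : ℕ, 0 < f ((n + 1 : ℕ) : ℝ))
    (h0 : ∀ s, Tendsto (fun m => tabooLaw lam G f s m univ) atTop (𝓝 0))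
    (hfin : occInt lam G f (durFun lam f) ≠ ∞) :
    ∃ p : PMF ℕ, IsSteadyStateLaw lam G f p ∧
      mean p = ENNReal.ofReal lam *
        occInt lam G f (fun x => (x.customers : ℝ≥0∞) * durFun lam f x) /
          (1 + ENNReal.ofReal lam * occInt lam G f (durFun lam f)) := by
  have hZ : 1 + ENNReal.ofReal lam * occInt lam G f (durFun lam f) ≠ ∞ :=
    ENNReal.add_ne_top.2 ⟨ENNReal.one_ne_top, ENNReal.mul_ne_top ENNReal.ofReal_ne_top hfin⟩
  have hsum : ∑' j, levelFrac lam G f j = 1 := by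
    have := tsum_mul_levelFrac lam G f (fun _ => 1)
    simp only [one_mul] at this
    rw [this, ENNReal.div_self (by simp) hZ]
  refine ⟨⟨levelFrac lam G f, hsum ▸ ENNReal.summable.hasSum⟩, fun s hs j => ?_, ?_⟩
  · refine (tendsto_transProb hlam hG hf h0 hfin j hs).congr' ?_
    filter_upwards [eventually_ge_atTop 0] with t ht
    exact (clockLaw_numCustomers hlam hG hf hs j ht).symm
  · have := tsum_mul_levelFrac lam G f (fun j => (j : ℝ≥0∞))
    simp only [Nat.cast_zero, zero_add] at this
    exact this

end Limit

/-! ### Mean queue length -/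

/-- The slope is the supremum of the chord slopes from the left, which are bounded by every chord
slope to the right. Positivity of `x` provides chords on the left. -/
theorem exists_supporting_line {f : ℝ → ℝ} (hf : ConvexOn ℝ (Ici 0) f) {x : ℝ} (hx : 0 < x) :
    ∃ m : ℝ, ∀ y, 0 ≤ y → f x + m * (y - x) ≤ f y := by
  set S : Set ℝ := (fun y => (f x - f y) / (x - y)) '' Ico 0 x with hS
  have hub : ∀ z, x < z → ∀ c ∈ S, c ≤ (f z - f x) / (z - x) := by
    rintro z hz _ ⟨y, hy, rfl⟩
    exact hf.slope_mono_adjacent hy.1 (hx.le.trans hz.le) hy.2 hz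
  have hne : S.Nonempty := ⟨_, 0, ⟨le_rfl, hx⟩, rfl⟩
  have hbdd : BddAbove S := ⟨_, hub (x + 1) (by linarith)⟩
  refine ⟨sSup S, fun y hy => ?_⟩
  rcases lt_trichotomy y x with h | rfl | h
  · have h1 := le_csSup hbdd ⟨y, ⟨hy, h⟩, rfl⟩
    simp only [div_le_iff₀ (sub_pos.2 h)] at h1
    linarith
  · simp
  · have h1 := csSup_le hne (hub y h)
    rw [le_div_iff₀ (sub_pos.2 h)] at h1
    linarith

/-- Convexity at the point 1 of [0, n]. A convex `f` thus grows at least linearly, which yields its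
unboundedness and the finiteness of N_v. -/
theorem mul_le_of_convexOn {f : ℝ → ℝ} (hf : ConvexOn ℝ (Ici 0) f) (h0 : f 0 = 0) (n : ℕ) :
    n * f 1 ≤ f n := by
  rcases Nat.eq_zero_or_pos n with rfl | hn
  · simp [h0]
  · have hn' : (1 : ℝ) ≤ n := by exact_mod_cast hn
    have hn1 : (0 : ℝ) ≤ 1 - 1 / n := by rw [sub_nonneg, div_le_one (by linarith)]; exact hn'
    have h := hf.2 (mem_Ici.2 (le_refl (0 : ℝ))) (mem_Ici.2 (n.cast_nonneg : (0 : ℝ) ≤ n)) hn1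
      (by positivity : (0 : ℝ) ≤ 1 / n) (by ring)
    rw [smul_zero, zero_add, smul_eq_mul, one_div_mul_cancel (by linarith), h0, smul_zero,
      zero_add, smul_eq_mul, one_div, ← div_eq_inv_mul, le_div_iff₀ (by linarith)] at h
    linarith

/-- Time spent on vacation. -/
noncomputable def vacFun (lam : ℝ) (f : ℝ → ℝ) : QState → ℝ≥0∞ :=
  QState.fold (fun n => vacDur lam f n) (fun _ _ => 0)

theorem measurable_vacFun (lam : ℝ) (f : ℝ → ℝ) : Measurable (vacFun lam f) :=
  QState.measurable_fold fun _ => measurable_const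

section Mean

variable {lam : ℝ} {G : Measure ℝ} {f : ℝ → ℝ}

theorem occInt_add {g h : QState → ℝ≥0∞} (hg : Measurable g) :
    occInt lam G f (fun x => g x + h x) = occInt lam G f g + occInt lam G f h :=
  lintegral_add_left (hg.comp measurable_fst) _

theorem occInt_const_mul {g : QState → ℝ≥0∞} (c : ℝ≥0∞) (hg : Measurable g) :
    occInt lam G f (fun x => c * g x) = c * occInt lam G f g :=
  lintegral_const_mul c (hg.comp measurable_fst)

theorem occInt_dur (lam : ℝ) (G : Measure ℝ) (f : ℝ → ℝ) :
    occInt lam G f (durFun lam f) = occInt lam G f (vacFun lam f) + occInt lam G f (servFun lam) := by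
  rw [← occInt_add (measurable_vacFun lam f)]
  congr 1
  funext x
  rcases x with n | ⟨n, r⟩ <;> simp [durFun, vacFun, servFun]

theorem occInt_customers (lam : ℝ) (G : Measure ℝ) (f : ℝ → ℝ) :
    occInt lam G f (fun x => (x.customers : ℝ≥0∞) * durFun lam f x) =
      occInt lam G f (vacQueue lam f) + occInt lam G f (servQueue lam) +
        occInt lam G f (servFun lam) := by
  have h : Measurable fun x => vacQueue lam f x + servQueue lam x :=
    (measurable_vacQueue lam f).add (measurable_servQueue lam)
  rw [← occInt_add (measurable_vacQueue lam f), ← occInt_add h]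
  congr 1
  funext x
  rcases x with n | ⟨n, r⟩ <;>
    simp [durFun, vacQueue, servQueue, servFun, QState.customers, add_mul]

/-- An affine bound on `f` integrated over vacations. The negative part `b` of the intercept is kept
on the left, since subtraction truncates in `ℝ≥0∞`. -/
theorem occInt_act_add_le {a b m : ℝ≥0∞} (h : ∀ n : ℕ, ENNReal.ofReal (f n) + b ≤ a + m * n) :
    occInt lam G f (actFun lam f) + b * occInt lam G f (vacFun lam f) ≤
      a * occInt lam G f (vacFun lam f) + m * occInt lam G f (vacQueue lam f) := by
  have m1 := measurable_actFun lam f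
  have m2 := measurable_vacFun lam f
  have m3 := measurable_vacQueue lam f
  rw [← occInt_const_mul _ m2, ← occInt_const_mul _ m2, ← occInt_const_mul _ m3,
    ← occInt_add m1, ← occInt_add (m2.const_mul _)]
  refine lintegral_mono fun p => ?_
  rcases p with ⟨n | ⟨n, r⟩, τ⟩
  · simp only [actFun, vacFun, vacQueue, QState.fold_vacation]
    calc _ = (ENNReal.ofReal (f n) + b) * vacDur lam f n := by ring
      _ ≤ (a + m * n) * vacDur lam f n := mul_le_mul_left (h n) _
      _ = _ := by ring
  · simp [actFun, vacFun, vacQueue]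

theorem le_occInt_act_add {a b m : ℝ≥0∞} (h : ∀ n : ℕ, a + m * n ≤ ENNReal.ofReal (f n) + b) :
    a * occInt lam G f (vacFun lam f) + m * occInt lam G f (vacQueue lam f) ≤
      occInt lam G f (actFun lam f) + b * occInt lam G f (vacFun lam f) := by
  have m1 := measurable_actFun lam f
  have m2 := measurable_vacFun lam f
  have m3 := measurable_vacQueue lam f
  rw [← occInt_const_mul _ m2, ← occInt_const_mul _ m2, ← occInt_const_mul _ m3,
    ← occInt_add m1, ← occInt_add (m2.const_mul _)]
  refine lintegral_mono fun p => ?_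
  rcases p with ⟨n | ⟨n, r⟩, τ⟩
  · simp only [actFun, vacFun, vacQueue, QState.fold_vacation]
    calc _ = (a + m * n) * vacDur lam f n := by ring
      _ ≤ (ENNReal.ofReal (f n) + b) * vacDur lam f n := mul_le_mul_left (h n) _
      _ = _ := by ring
  · simp [actFun, vacFun, vacQueue]

/-- Activations require vacation time with customers present. The result makes x₀ positive, as the
supporting line demands. -/
theorem occInt_vacQueue_ne_zero (hlam : 0 < lam) (hf : ∀ n : ℕ, 0 < f ((n + 1 : ℕ) : ℝ))
    (hf0 : f 0 = 0) (h : occInt lam G f (actFun lam f) ≠ 0) :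
    occInt lam G f (vacQueue lam f) ≠ 0 := by
  contrapose! h
  have h1 : ∀ᵐ p ∂occ lam G f (.vacation 1), vacQueue lam f p.1 = 0 :=
    (lintegral_eq_zero_iff ((measurable_vacQueue lam f).comp measurable_fst)).1 h
  refine (lintegral_eq_zero_iff ((measurable_actFun lam f).comp measurable_fst)).2 ?_
  filter_upwards [h1] with p hp
  rcases p with ⟨n | ⟨n, r⟩, τ⟩
  · rcases n with _ | n
    · simp [actFun, hf0]
    · exfalso
      have := hf n
      simp only [vacQueue, QState.fold_vacation, vacDur, mul_eq_zero, ENNReal.ofReal_eq_zero,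
        not_le.2 (show 0 < 1 / (lam + f ((n + 1 : ℕ) : ℝ)) by positivity), or_false] at hp
      exact absurd hp (by positivity)
  · simp [actFun]

/-! ### The stationary mean over a cycle and the two Jensen bounds -/

/-- The stationary law and its mean in terms of integrals over a regeneration cycle: `z` is the mean
number of activations, `V` the mean time on vacation with customers present. -/
theorem exists_steadyState_mean [IsProbabilityMeasure G] (hlam : 0 < lam)
    (hG : ∀ᵐ x ∂G, 0 ≤ x) (hG2 : Integrable (fun x : ℝ => x ^ 2) G) (hrho : rho lam G < 1)
    (hf : ∀ n : ℕ, 0 < f ((n + 1 : ℕ) : ℝ)) (hmono : Monotone fun n : ℕ => f n)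
    (hunb : ∀ y, ∃ n : ℕ, y ≤ f n) :
    ∃ (p : PMF ℕ) (z V : ℝ), IsSteadyStateLaw lam G f p ∧ 1 ≤ z ∧ 0 ≤ V ∧
      lam * V + 1 = z * (1 - rho lam G) ∧
      occInt lam G f (actFun lam f) = ENNReal.ofReal z ∧
      occInt lam G f (vacFun lam f) = ENNReal.ofReal V ∧
      mean p = ENNReal.ofReal lam * (occInt lam G f (vacQueue lam f) +
        occInt lam G f (servQueue lam) + ENNReal.ofReal ((∫ x, x ∂G) * z)) / ENNReal.ofReal z ∧
      ENNReal.ofReal (1 - rho lam G) * occInt lam G f (servQueue lam) ≤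
        ENNReal.ofReal (rho lam G) * occInt lam G f (vacQueue lam f) +
          ENNReal.ofReal (lam * ((∫ x, x ^ 2 ∂G) / 2 * z)) ∧
      ENNReal.ofReal (rho lam G) * (occInt lam G f (vacQueue lam f) +
          occInt lam G f (servQueue lam)) + ENNReal.ofReal (lam * ((∫ x, x ^ 2 ∂G) / 2 * z)) ≤
        occInt lam G f (servQueue lam) := by
  have hGi : Integrable (fun x : ℝ => x) G := by
    refine (hG2.add (integrable_const (1 : ℝ))).mono' (by fun_prop) (ae_of_all _ fun x => ?_)
    rw [Real.norm_eq_abs, Pi.add_apply, abs_le]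
    constructor <;> nlinarith [sq_nonneg (x - 1), sq_nonneg (x + 1)]
  have hβ : 0 ≤ ∫ x, x ∂G := integral_nonneg_of_ae hG
  have hσ : 0 ≤ ∫ x, x ^ 2 ∂G := integral_nonneg fun x => sq_nonneg x
  have hserv : meanServ G = ENNReal.ofReal (∫ x, x ∂G) :=
    (ofReal_integral_eq_lintegral_ofReal hGi hG).symm
  have hhalf : halfSecond G = ENNReal.ofReal ((∫ x, x ^ 2 ∂G) / 2) := by
    rw [← integral_div, ofReal_integral_eq_lintegral_ofReal (hG2.div_const 2)
      (ae_of_all _ fun x => by positivity)]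
    refine lintegral_congr_ae ?_
    filter_upwards [hG] with x hx
    rw [halfSq, max_eq_left hx]
  have hrec := positive_recurrence hlam hG hGi hrho hf hmono hunb
  have h0 := fun s => (hrec s).2
  have hfin : occInt lam G f (durFun lam f) ≠ ∞ := (hrec _).1
  have hact : occInt lam G f (actFun lam f) =
      1 + ENNReal.ofReal lam * occInt lam G f (durFun lam f) :=
    le_antisymm (occInt_act_le hlam hf) (le_occInt_act hlam hf (h0 _))
  have hactfin : occInt lam G f (actFun lam f) ≠ ∞ := by
    rw [hact]
    exact ENNReal.add_ne_top.2 ⟨ENNReal.one_ne_top, ENNReal.mul_ne_top ENNReal.ofReal_ne_top hfin⟩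
  have hS := occInt_serv_eq hlam hf (h0 _) hactfin
  have hA := occInt_area_eq hlam hf (h0 _) hactfin
  have hle := occInt_servQueue_le (G := G) (κ := ENNReal.ofReal (1 - rho lam G)) hlam hf (by
    rw [hserv, ← ENNReal.ofReal_mul hlam.le, ← ENNReal.ofReal_add (by linarith)
      (mul_nonneg hlam.le hβ), rho, sub_add_cancel, ENNReal.ofReal_one])
  have hge := le_occInt_servQueue hlam hf (h0 (.vacation 1))
  obtain ⟨p, hp, hmean⟩ := exists_steadyState hlam hG hf h0 hfin
  -- The normalising constant 1 + λ·(busy time) is the mean number z of activations.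
  rw [occInt_customers, ← hact, hS] at hmean
  rw [occInt_dur] at hfin
  have hV : occInt lam G f (vacFun lam f) ≠ ∞ := (ENNReal.add_ne_top.1 hfin).1
  rw [occInt_dur, hS] at hact
  rw [hA] at hle hge
  obtain ⟨z, hz⟩ : ∃ z, z = (occInt lam G f (actFun lam f)).toReal := ⟨_, rfl⟩
  obtain ⟨V, hVd⟩ : ∃ V, V = (occInt lam G f (vacFun lam f)).toReal := ⟨_, rfl⟩
  have hz0 : 0 ≤ z := hz ▸ ENNReal.toReal_nonneg
  have hV0 : 0 ≤ V := hVd ▸ ENNReal.toReal_nonneg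
  have hz' : occInt lam G f (actFun lam f) = ENNReal.ofReal z := by
    rw [hz, ENNReal.ofReal_toReal hactfin]
  have hV' : occInt lam G f (vacFun lam f) = ENNReal.ofReal V := by
    rw [hVd, ENNReal.ofReal_toReal hV]
  rw [hz', hserv, ← ENNReal.ofReal_mul hβ] at hmean
  rw [hz', hserv, hhalf, ← ENNReal.ofReal_mul hlam.le, ← ENNReal.ofReal_mul (by positivity),
    ← ENNReal.ofReal_mul hlam.le] at hle hge
  -- With all terms finite the balance becomes the real identity z = 1 + λ(V + βz).
  rw [hz', hV', hserv, ← ENNReal.ofReal_mul hβ, ← ENNReal.ofReal_add hV0 (by positivity),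
    ← ENNReal.ofReal_mul hlam.le, ← ENNReal.ofReal_one, ← ENNReal.ofReal_add zero_le_one
    (by positivity), ENNReal.ofReal_eq_ofReal_iff hz0 (by positivity)] at hact
  refine ⟨p, z, V, hp, ?_, hV0, ?_, hz', hV', hmean, hle, hge⟩
  · rw [hact, le_add_iff_nonneg_right]
    positivity
  · rw [rho]
    linarith

theorem ofReal_bound_le_mean [IsProbabilityMeasure G] (hlam : 0 < lam)
    (hG : ∀ᵐ x ∂G, 0 ≤ x) (hG2 : Integrable (fun x : ℝ => x ^ 2) G) (hrho : rho lam G < 1)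
    (hf0 : f 0 = 0) (hmono : StrictMonoOn f (Ici 0)) (hconc : ConcaveOn ℝ (Ici 0) f)
    (hunb : ¬ BddAbove (f '' Ici 0)) :
    ∃ p : PMF ℕ, IsSteadyStateLaw lam G f p ∧ ENNReal.ofReal (bound lam G f) ≤ mean p := by
  have hmem : ∀ n : ℕ, (n : ℝ) ∈ Ici (0 : ℝ) := fun n => mem_Ici.2 n.cast_nonneg
  have hf : ∀ n : ℕ, 0 < f ((n + 1 : ℕ) : ℝ) := fun n => by
    rw [← hf0]
    exact hmono (mem_Ici.2 le_rfl) (hmem _) (by positivity)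
  have hunb' : ∀ y, ∃ n : ℕ, y ≤ f n := by
    intro y
    obtain ⟨_, ⟨x, hx, rfl⟩, hxy⟩ := not_bddAbove_iff.1 hunb y
    exact ⟨⌈x⌉₊, hxy.le.trans (hmono.monotoneOn hx (hmem _) (Nat.le_ceil x))⟩
  obtain ⟨p, z, V, hp, hz1, hV0, hzV, hz, hV, hmean, -, hge⟩ := exists_steadyState_mean hlam hG hG2
    hrho hf (fun m n h => hmono.monotoneOn (hmem m) (hmem n) (by exact_mod_cast h)) hunb'
  refine ⟨p, hp, ?_⟩
  have hz0 : 0 < z := by linarith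
  have hβ : 0 ≤ ∫ x, x ∂G := integral_nonneg_of_ae hG
  have hσ : 0 ≤ ∫ x, x ^ 2 ∂G := integral_nonneg fun x => sq_nonneg x
  have hρ0 : 0 ≤ rho lam G := mul_nonneg hlam.le hβ
  -- For concave `f` the mean may be infinite, and the lower bound is then trivial.
  by_cases htop : occInt lam G f (vacQueue lam f) + occInt lam G f (servQueue lam) = ∞
  · rw [hmean, htop, top_add, ENNReal.mul_top (by simpa using hlam),
      ENNReal.top_div_of_ne_top ENNReal.ofReal_ne_top]
    exact le_top
  obtain ⟨hNv, hNs⟩ := ENNReal.add_ne_top.1 htop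
  have hNv0 := occInt_vacQueue_ne_zero (G := G) hlam hf hf0 (by rw [hz]; simpa using hz0)
  obtain ⟨v, hv⟩ : ∃ v, v = (occInt lam G f (vacQueue lam f)).toReal := ⟨_, rfl⟩
  obtain ⟨s, hs⟩ : ∃ s, s = (occInt lam G f (servQueue lam)).toReal := ⟨_, rfl⟩
  have hv0 : 0 < v := hv ▸ ENNReal.toReal_pos hNv0 hNv
  have hs0 : 0 ≤ s := hs ▸ ENNReal.toReal_nonneg
  have hv' : occInt lam G f (vacQueue lam f) = ENNReal.ofReal v := by
    rw [hv, ENNReal.ofReal_toReal hNv]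
  have hs' : occInt lam G f (servQueue lam) = ENNReal.ofReal s := by
    rw [hs, ENNReal.ofReal_toReal hNs]
  rw [hv', hs', ← ENNReal.ofReal_add hv0.le hs0, ← ENNReal.ofReal_mul hρ0,
    ← ENNReal.ofReal_add (by positivity) (by positivity), ENNReal.ofReal_le_ofReal_iff hs0] at hge
  rw [hmean, hv', hs', ← ENNReal.ofReal_add hv0.le hs0, ← ENNReal.ofReal_add (by positivity)
    (by positivity), ← ENNReal.ofReal_mul hlam.le, ← ENNReal.ofReal_div_of_pos hz0]
  refine ENNReal.ofReal_le_ofReal ?_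
  have h1ρ : 0 < 1 - rho lam G := by linarith
  -- Vacation time per cycle, the empty period included, is V + 1/λ = z(1-ρ)/λ; so x₀ is the mean
  -- number of customers on vacation.
  set x₀ := lam * v / (z * (1 - rho lam G)) with hx₀
  have hx₀pos : 0 < x₀ := by positivity
  have hfx : lam / (1 - rho lam G) ≤ f x₀ := by
    obtain ⟨m, hm⟩ := exists_supporting_line hconc.neg hx₀pos
    simp only [Pi.neg_apply] at hm
    have hfx0 : 0 < f x₀ := hf0 ▸ hmono (mem_Ici.2 le_rfl) (mem_Ici.2 hx₀pos.le) hx₀pos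
    have hm0 : 0 ≤ -m := by
      have h1 := hm (x₀ + 1) (by linarith)
      have h2 := hmono (mem_Ici.2 hx₀pos.le) (mem_Ici.2 (by linarith : (0 : ℝ) ≤ x₀ + 1))
        (by linarith)
      linarith
    have h := occInt_act_add_le (lam := lam) (G := G) (f := f)
      (b := ENNReal.ofReal (-m * x₀)) (a := ENNReal.ofReal (f x₀)) (m := ENNReal.ofReal (-m))
      (fun n => by
        have hfn : 0 ≤ f n := hf0 ▸ hmono.monotoneOn (mem_Ici.2 le_rfl) (hmem n) (hmem n)
        rw [← ENNReal.ofReal_natCast, ← ENNReal.ofReal_mul hm0,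
          ← ENNReal.ofReal_add hfn (by positivity), ← ENNReal.ofReal_add hfx0.le (by positivity)]
        refine ENNReal.ofReal_le_ofReal ?_
        linarith [hm n (hmem n)])
    rw [hz, hV, hv', ← ENNReal.ofReal_mul (by positivity),
      ← ENNReal.ofReal_mul hfx0.le, ← ENNReal.ofReal_mul hm0,
      ← ENNReal.ofReal_add hz0.le (by positivity), ← ENNReal.ofReal_add (by positivity)
      (by positivity), ENNReal.ofReal_le_ofReal_iff (by positivity)] at h
    -- The occupation measure omits the empty period. The supporting line at 0, where `f` vanishes,
    -- supplies its contribution to Jensen's inequality.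
    have h2 := hm 0 le_rfl
    have h3 : x₀ * (lam * V + 1) = lam * v := by
      rw [hzV, hx₀]; field_simp
    rw [div_le_iff₀ h1ρ]
    have h4 : z * lam ≤ z * (f x₀ * (1 - rho lam G)) := by
      calc z * lam ≤ lam * (f x₀ * V + -m * v - -m * x₀ * V) := by nlinarith
        _ = f x₀ * (lam * V + 1) - f x₀ - m * (x₀ * (lam * V + 1)) + lam * m * x₀ * V := by
            rw [h3]; ring
        _ = f x₀ * (lam * V + 1) - f x₀ - m * x₀ := by ring
        _ ≤ f x₀ * (lam * V + 1) := by linarith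
        _ = _ := by rw [hzV]; ring
    exact le_of_mul_le_mul_left h4 hz0
  have hinv : inv f (lam / (1 - rho lam G)) ≤ x₀ := csInf_le ⟨0, fun _ h => h.1⟩ ⟨hx₀pos.le, hfx⟩
  rw [bound]
  refine (add_le_add_right hinv _).trans ?_
  rw [le_div_iff₀ hz0]
  have hβ' : lam * ∫ x, x ∂G = rho lam G := rfl
  have hs1 : (rho lam G * v + lam * ((∫ x, x ^ 2 ∂G) / 2 * z)) / (1 - rho lam G) ≤ s := by
    rw [div_le_iff₀ h1ρ]; linarith
  calc _ = lam * (v + (rho lam G * v + lam * ((∫ x, x ^ 2 ∂G) / 2 * z)) / (1 - rho lam G)) +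
        (lam * ∫ x, x ∂G) * z := by rw [hβ', hx₀]; field_simp; ring
    _ ≤ lam * (v + s) + (lam * ∫ x, x ∂G) * z := by gcongr
    _ = _ := by ring

theorem mean_le_ofReal_bound [IsProbabilityMeasure G] (hlam : 0 < lam)
    (hG : ∀ᵐ x ∂G, 0 ≤ x) (hG2 : Integrable (fun x : ℝ => x ^ 2) G) (hrho : rho lam G < 1)
    (hf0 : f 0 = 0) (hmono : StrictMonoOn f (Ici 0)) (hconv : ConvexOn ℝ (Ici 0) f) :
    ∃ p : PMF ℕ, IsSteadyStateLaw lam G f p ∧ mean p ≤ ENNReal.ofReal (bound lam G f) := by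
  have hmem : ∀ n : ℕ, (n : ℝ) ∈ Ici (0 : ℝ) := fun n => mem_Ici.2 n.cast_nonneg
  have hf : ∀ n : ℕ, 0 < f ((n + 1 : ℕ) : ℝ) := fun n => by
    rw [← hf0]
    exact hmono (mem_Ici.2 le_rfl) (hmem _) (by positivity)
  have hf1 : 0 < f 1 := by simpa using hf 0
  have hunb : ∀ y, ∃ n : ℕ, y ≤ f n := by
    intro y
    obtain ⟨n, hn⟩ := exists_nat_ge (y / f 1)
    rw [div_le_iff₀ hf1] at hn
    exact ⟨n, hn.trans (mul_le_of_convexOn hconv hf0 n)⟩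
  obtain ⟨p, z, V, hp, hz1, hV0, hzV, hz, hV, hmean, hle, -⟩ := exists_steadyState_mean hlam hG hG2
    hrho hf (fun m n h => hmono.monotoneOn (hmem m) (hmem n) (by exact_mod_cast h)) hunb
  refine ⟨p, hp, ?_⟩
  have hz0 : 0 < z := by linarith
  have h1ρ : 0 < 1 - rho lam G := by linarith
  have hβ : 0 ≤ ∫ x, x ∂G := integral_nonneg_of_ae hG
  have hσ : 0 ≤ ∫ x, x ^ 2 ∂G := integral_nonneg fun x => sq_nonneg x
  have hρ0 : 0 ≤ rho lam G := mul_nonneg hlam.le hβ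
  -- Since n·f(1) ≤ f(n), the integral N_v is at most z/f(1).
  have hNv : occInt lam G f (vacQueue lam f) ≠ ∞ := by
    have h : ENNReal.ofReal (f 1) * occInt lam G f (vacQueue lam f) ≤ ENNReal.ofReal z := by
      rw [← hz, ← occInt_const_mul _ (measurable_vacQueue lam f)]
      refine lintegral_mono fun q => ?_
      rcases q with ⟨n | ⟨n, r⟩, τ⟩
      · simp only [vacQueue, actFun, QState.fold_vacation]
        rw [← mul_assoc, ← ENNReal.ofReal_natCast, ← ENNReal.ofReal_mul hf1.le]
        gcongr
        rw [mul_comm]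
        exact mul_le_of_convexOn hconv hf0 n
      · simp [vacQueue, actFun]
    intro htop
    rw [htop, ENNReal.mul_top (by simpa using hf1)] at h
    exact absurd h (by simp)
  have hNs : occInt lam G f (servQueue lam) ≠ ∞ := by
    intro htop
    rw [htop, ENNReal.mul_top (by simpa using h1ρ), top_le_iff] at hle
    exact ENNReal.add_ne_top.2
      ⟨ENNReal.mul_ne_top ENNReal.ofReal_ne_top hNv, ENNReal.ofReal_ne_top⟩ hle
  have hNv0 := occInt_vacQueue_ne_zero (G := G) hlam hf hf0 (by rw [hz]; simpa using hz0)
  obtain ⟨v, hv⟩ : ∃ v, v = (occInt lam G f (vacQueue lam f)).toReal := ⟨_, rfl⟩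
  obtain ⟨s, hs⟩ : ∃ s, s = (occInt lam G f (servQueue lam)).toReal := ⟨_, rfl⟩
  have hv0 : 0 < v := hv ▸ ENNReal.toReal_pos hNv0 hNv
  have hs0 : 0 ≤ s := hs ▸ ENNReal.toReal_nonneg
  have hv' : occInt lam G f (vacQueue lam f) = ENNReal.ofReal v := by
    rw [hv, ENNReal.ofReal_toReal hNv]
  have hs' : occInt lam G f (servQueue lam) = ENNReal.ofReal s := by
    rw [hs, ENNReal.ofReal_toReal hNs]
  rw [hv', hs', ← ENNReal.ofReal_mul h1ρ.le, ← ENNReal.ofReal_mul hρ0,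
    ← ENNReal.ofReal_add (by positivity) (by positivity),
    ENNReal.ofReal_le_ofReal_iff (by positivity)] at hle
  rw [hmean, hv', hs', ← ENNReal.ofReal_add hv0.le hs0, ← ENNReal.ofReal_add (by positivity)
    (by positivity), ← ENNReal.ofReal_mul hlam.le, ← ENNReal.ofReal_div_of_pos hz0]
  refine ENNReal.ofReal_le_ofReal ?_
  set x₀ := lam * v / (z * (1 - rho lam G)) with hx₀
  have hx₀pos : 0 < x₀ := by positivity
  have hfx : f x₀ ≤ lam / (1 - rho lam G) := by
    obtain ⟨m, hm⟩ := exists_supporting_line hconv hx₀pos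
    have hfx0 : 0 < f x₀ := hf0 ▸ hmono (mem_Ici.2 le_rfl) (mem_Ici.2 hx₀pos.le) hx₀pos
    have h2 := hm 0 le_rfl
    -- A negative slope would put the supporting line above `f 0 = 0` at the origin.
    have hm0 : 0 ≤ m := by
      by_contra! hneg
      nlinarith
    have h := le_occInt_act_add (lam := lam) (G := G) (f := f)
      (b := ENNReal.ofReal (m * x₀)) (a := ENNReal.ofReal (f x₀)) (m := ENNReal.ofReal m)
      (fun n => by
        have hfn : 0 ≤ f n := hf0 ▸ hmono.monotoneOn (mem_Ici.2 le_rfl) (hmem n) (hmem n)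
        rw [← ENNReal.ofReal_natCast, ← ENNReal.ofReal_mul hm0,
          ← ENNReal.ofReal_add hfn (by positivity), ← ENNReal.ofReal_add hfx0.le (by positivity)]
        refine ENNReal.ofReal_le_ofReal ?_
        linarith [hm n (hmem n)])
    rw [hz, hV, hv', ← ENNReal.ofReal_mul hfx0.le, ← ENNReal.ofReal_mul hm0,
      ← ENNReal.ofReal_mul (by positivity), ← ENNReal.ofReal_add (by positivity) (by positivity),
      ← ENNReal.ofReal_add hz0.le (by positivity),
      ENNReal.ofReal_le_ofReal_iff (by positivity)] at h
    have h3 : x₀ * (lam * V + 1) = lam * v := by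
      rw [hzV, hx₀]; field_simp
    rw [le_div_iff₀ h1ρ]
    have h4 : z * (f x₀ * (1 - rho lam G)) ≤ z * lam := by
      calc _ = f x₀ * (lam * V + 1) := by rw [hzV]; ring
        _ ≤ f x₀ * (lam * V + 1) - f x₀ + m * x₀ := by linarith
        _ = f x₀ * (lam * V + 1) - f x₀ + m * (x₀ * (lam * V + 1)) - lam * m * x₀ * V := by ring
        _ = lam * (f x₀ * V + m * v - m * x₀ * V) := by rw [h3]; ring
        _ ≤ z * lam := by nlinarith
    exact le_of_mul_le_mul_left h4 hz0
  have hinv : x₀ ≤ inv f (lam / (1 - rho lam G)) := by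
    -- Unboundedness makes the set in `inv` nonempty; otherwise its infimum would be the default
    -- value 0.
    obtain ⟨n, hn⟩ := hunb (lam / (1 - rho lam G))
    refine le_csInf ⟨n, hmem n, hn⟩ fun x hx => ?_
    exact (hmono.le_iff_le (mem_Ici.2 hx₀pos.le) hx.1).1 (hfx.trans hx.2)
  rw [bound]
  refine le_trans ?_ (add_le_add_right hinv _)
  rw [div_le_iff₀ hz0]
  have hβ' : lam * ∫ x, x ∂G = rho lam G := rfl
  have hs1 : s ≤ (rho lam G * v + lam * ((∫ x, x ^ 2 ∂G) / 2 * z)) / (1 - rho lam G) := by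
    rw [le_div_iff₀ h1ρ]; linarith
  calc _ = lam * (v + s) + (lam * ∫ x, x ∂G) * z := by ring
    _ ≤ lam * (v + (rho lam G * v + lam * ((∫ x, x ^ 2 ∂G) / 2 * z)) / (1 - rho lam G)) +
        (lam * ∫ x, x ∂G) * z := by gcongr
    _ = _ := by rw [hβ', hx₀]; field_simp; ring

end Mean

end BackoffQueue

theorem mainTheorem10 (lam : ℝ) (hlam : 0 < lam)
    (G : Measure ℝ) [IsProbabilityMeasure G] (hG_nonneg : ∀ᵐ x ∂G, 0 ≤ x)
    (hG_sq : Integrable (fun x : ℝ => x ^ 2) G)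
    (hrho : BackoffQueue.rho lam G < 1)
    (f : ℝ → ℝ) (hf_zero : f 0 = 0) (hf_mono : StrictMonoOn f (Set.Ici 0)) :
    (ConcaveOn ℝ (Set.Ici 0) f → ¬ BddAbove (f '' Set.Ici 0) →
      ∃ p : PMF ℕ, BackoffQueue.IsSteadyStateLaw lam G f p ∧
        ENNReal.ofReal (BackoffQueue.bound lam G f) ≤ BackoffQueue.mean p) ∧
    (ConvexOn ℝ (Set.Ici 0) f →
      ∃ p : PMF ℕ, BackoffQueue.IsSteadyStateLaw lam G f p ∧
        BackoffQueue.mean p ≤ ENNReal.ofReal (BackoffQueue.bound lam G f)) :=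
  ⟨BackoffQueue.ofReal_bound_le_mean hlam hG_nonneg hG_sq hrho hf_zero hf_mono,
    BackoffQueue.mean_le_ofReal_bound hlam hG_nonneg hG_sq hrho hf_zero hf_mono⟩
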